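/- All objects are vector spaces over $\mathbb C$, and Sweedler notation is used. For a right comodule $X$ and a left comodule $Y$ over a coalgebra $D$, $X\square_D Y\subseteq X\otimes Y$ is the space of tensors $x\otimes y$ (sums are suppressed) with $x_{[0]}\otimes x_{[1]}\otimes y=x\otimes y_{[-1]}\otimes y_{[0]}$. **Right $\times_C$-Hopf coalgebras.** Let $C$ be a coalgebra. A right bicoalgebroid $\mathcal B$ over $C$ is a coalgebra $\mathcal B$ with coalgebra maps $\alpha:\mathcal B\to C$ and $\beta:\mathcal B\to C_{\rm cop}$ such that $\alpha(b^{(1)})\otimes\beta(b^{(2)})=\alpha(b^{(2)})\otimes\beta(b^{(1)})$, which is a $C$-bicomodule by $b\mapsto\beta(b^{(2)})\otimes b^{(1)}$ and $b\mapsto b^{(1)}\otimes\alpha(b^{(2)})$, together with $C$-bicomodule maps $\mu:\mathcal B\square_C\mathcal B\to\mathcal B$, $\mu(b\otimes b')=bb'$, and $\eta:C\to\mathcal B$ such that $\mu$ is associative, $b^{(1)}\eta(\alpha(b^{(2)}))=b=\eta(\beta(b^{(2)}))b^{(1)}$, and for $b\otimes b'\in\mathcal B\square_C\mathcal B$, $c\in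 C$: $$bb'^{(2)}\otimes\beta(b'^{(1)})=b^{(2)}b'\otimes\alpha(b^{(1)}),\quad \Delta(bb')=b^{(1)}b'^{(1)}\otimes b^{(2)}b'^{(2)},\quad \varepsilon(bb')=\varepsilon(b)\varepsilon(b'),$$ $$\Delta(\eta(c))=\eta(\alpha(\eta(c)^{(1)}))\otimes\eta(c)^{(2)}=\eta(\beta(\eta(c)^{(1)}))\otimes\eta(c)^{(2)},\quad \varepsilon(\eta(c))=\varepsilon(c).$$ It is a right $\times_C$-Hopf coalgebra if $\nu:\mathcal B\square_C\mathcal B\to\mathcal B\square_{C_{\rm cop}}\mathcal B$, $b\otimes b'\mapsto b^{(1)}\otimes b^{(2)}b'$, is bijective, where $\mathcal B$ is a $C_{\rm cop}$-comodule on the right by $b\mapsto b^{(1)}\otimes\beta(b^{(2)})$ and on the left by $b\mapsto\beta(b^{(1)})\otimes b^{(2)}$. Write $\nu^{-1}(b\otimes b')=\nu^-(b,b')\otimes\nu^+(b,b')$. **SAYD modules.** A right-left stable anti Yetter–Drinfeld module $M$ over $\mathcal B$ is a left $\mathcal B$-comodule $m\mapsto m_{\langle-1\rangle}\otimes m_{\langle0\rangle}$,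 regarded as a right $C$-comodule by $m_{[0]}\otimes m_{[1]}=m_{\langle0\rangle}\otimes\beta(m_{\langle-1\rangle})$, with an associative unital ($m_{[0]}\triangleleft\eta(m_{[1]})=m$) right action $M\square_C\mathcal B\to M$ satisfying $(m\triangleleft b)_{[0]}\otimes(m\triangleleft b)_{[1]}=m\triangleleft b^{(1)}\otimes\alpha(b^{(2)})$, such that * $\alpha(m_{\langle-1\rangle})\otimes m_{\langle0\rangle}=\alpha(\eta(m_{[1]})^{(1)})\otimes m_{[0]}\triangleleft\eta(m_{[1]})^{(2)}$ for $m\in M$; * $(m\triangleleft b)_{\langle-1\rangle}\otimes(m\triangleleft b)_{\langle0\rangle}=\nu^+(b^{(2)},m_{\langle-1\rangle})\,b^{(1)}\otimes m_{\langle0\rangle}\triangleleft\nu^-(b^{(2)},m_{\langle-1\rangle})$ for $m\otimes b\in M\square_C\mathcal B$; * $m_{\langle0\rangle}\triangleleft m_{\langle-1\rangle}=m$ for $m\in M$. **Comodule $C$-rings.** A right $\mathcal B$-comodule $C$-ring $A$ is a right $\mathcal B$-comodule $a\mapsto a_{\langle0\rangle}\otimes a_{\langle1\rangle}$, regarded as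 a $C$-bicomodule by $a_{[-1]}\otimes a_{[0]}=\beta(a_{\langle1\rangle})\otimes a_{\langle0\rangle}$ and $a_{[0]}\otimes a_{[1]}=a_{\langle0\rangle}\otimes\alpha(a_{\langle1\rangle})$, with $C$-bicomodule maps $\mathfrak m:A\square_CA\to A$ (associative) and $\eta_A:C\to A$ such that $\mathfrak m(a_{[0]}\otimes\eta_A(a_{[1]}))=a=\mathfrak m(\eta_A(a_{[-1]})\otimes a_{[0]})$, and $$\eta_A(c)_{\langle0\rangle}\otimes\eta_A(c)_{\langle1\rangle}=\eta_A(\alpha(\eta(c)^{(1)}))\otimes\eta(c)^{(2)},$$ $$\mathfrak m(a\otimes a')_{\langle0\rangle}\otimes\mathfrak m(a\otimes a')_{\langle1\rangle}=\mathfrak m(a_{\langle0\rangle}\otimes a'_{\langle0\rangle})\otimes a_{\langle1\rangle}a'_{\langle1\rangle}.$$ **Proposition.** Let $\mathcal B$ be a right $\times_C$-Hopf coalgebra, $M$ a right-left SAYD module over $\mathcal B$ and $A$ a right $\mathcal B$-comodule $C$-ring. For $n\ge0$ let $\widetilde C^n=A^{\square_C(n+1)}\square_{\mathcal B}M$, where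 $A^{\square_C(n+1)}$ has the coaction $a_0\otimes\cdots\otimes a_n\mapsto a_{0\langle0\rangle}\otimes\cdots\otimes a_{n\langle0\rangle}\otimes a_{0\langle1\rangle}\cdots a_{n\langle1\rangle}$. Then the operators $$\delta_i:\widetilde C^n\to\widetilde C^{n+1},\quad \delta_i(a_0\otimes\cdots\otimes a_n\otimes m)=a_0\otimes\cdots\otimes\eta_A(a_{i[-1]})\otimes a_{i[0]}\otimes\cdots\otimes a_n\otimes m,\quad 0\le i\le n,$$ $$\sigma_i:\widetilde C^{n+1}\to\widetilde C^{n},\quad \sigma_i(a_0\otimes\cdots\otimes a_{n+1}\otimes m)=a_0\otimes\cdots\otimes\mathfrak m(a_i\otimes a_{i+1})\otimes\cdots\otimes a_{n+1}\otimes m,\quad 0\le i\le n,$$ $$\tau_n:\widetilde C^n\to\widetilde C^n,\quad \tau_n(a_0\otimes\cdots\otimes a_n\otimes m)=a_1\otimes\cdots\otimes a_n\otimes a_{0\langle0\rangle}\otimes m\triangleleft a_{0\langle1\rangle},$$ and the last coface $\delta_{n+1}=\tau_{n+1}\delta_0:\widetilde C^n\to\widetilde C^{n+1}$ are well defined and make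 $\widetilde C^\bullet$ a cocyclic module: they satisfy the cosimplicial identities, $\tau\delta_i=\delta_{i-1}\tau$ for $i\ge1$, $\tau\sigma_i=\sigma_{i-1}\tau$ for $i\ge1$, $\tau_n\sigma_0=\sigma_n\tau_{n+1}^2$, and $\tau_n^{n+1}=\mathrm{Id}$. In particular the cochains $x\in\widetilde C^n$ with $(-1)^n\tau_nx=x$ form a complex under $\sum_{i=0}^{n+1}(-1)^i\delta_i$, whose cohomology is the cyclic cohomology of $A$ with coefficients in $M$. -/

import Mathlib

open scoped TensorProduct

universe u

noncomputable section

namespace HopfCyc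

section Comodules

variable {C D X Y Z V : Type*}
  [AddCommGroup C] [Module ℂ C] [AddCommGroup D] [Module ℂ D] [Coalgebra ℂ D]
  [AddCommGroup X] [Module ℂ X] [AddCommGroup Y] [Module ℂ Y]
  [AddCommGroup Z] [Module ℂ Z] [AddCommGroup V] [Module ℂ V]

/-- A coassociative and counital left coaction `v ↦ v[-1] ⊗ v[0]` of the coalgebra `D`. -/
structure IsLeftCoaction (l : V →ₗ[ℂ] D ⊗[ℂ] V) : Prop where
  coassoc : ∀ v, TensorProduct.assoc ℂ D D V ((Coalgebra.comul (R := ℂ)).rTensor V (l v)) =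
    l.lTensor D (l v)
  counit : ∀ v, TensorProduct.lid ℂ V ((Coalgebra.counit (R := ℂ)).rTensor V (l v)) = v

/-- A coassociative and counital right coaction `v ↦ v[0] ⊗ v[1]` of the coalgebra `D`. -/
structure IsRightCoaction (r : V →ₗ[ℂ] V ⊗[ℂ] D) : Prop where
  coassoc : ∀ v, TensorProduct.assoc ℂ V D D (r.rTensor D (r v)) =
    (Coalgebra.comul (R := ℂ)).lTensor V (r v)
  counit : ∀ v, TensorProduct.rid ℂ V ((Coalgebra.counit (R := ℂ)).lTensor V (r v)) = v

/-- The map `x ⊗ y ↦ x[0] ⊗ x[1] ⊗ y`. -/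
def viaRight (r : X →ₗ[ℂ] X ⊗[ℂ] C) (Y : Type*) [AddCommGroup Y] [Module ℂ Y] :
    X ⊗[ℂ] Y →ₗ[ℂ] X ⊗[ℂ] (C ⊗[ℂ] Y) :=
  (TensorProduct.assoc ℂ X C Y).toLinearMap ∘ₗ r.rTensor Y

/-- The map `x ⊗ y ↦ x ⊗ y[-1] ⊗ y[0]`. -/
def viaLeft (X : Type*) [AddCommGroup X] [Module ℂ X] (l : Y →ₗ[ℂ] C ⊗[ℂ] Y) :
    X ⊗[ℂ] Y →ₗ[ℂ] X ⊗[ℂ] (C ⊗[ℂ] Y) :=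
  l.lTensor X

/-- The cotensor product `X □_C Y`, a subspace of `X ⊗ Y`. -/
def cotensor (r : X →ₗ[ℂ] X ⊗[ℂ] C) (l : Y →ₗ[ℂ] C ⊗[ℂ] Y) : Submodule ℂ (X ⊗[ℂ] Y) :=
  LinearMap.eqLocus (viaRight r Y) (viaLeft X l)

/-- The cotensor product `X □_C Y □_C Z`, a subspace of `X ⊗ (Y ⊗ Z)`. -/
def cotensor₃ (rX : X →ₗ[ℂ] X ⊗[ℂ] C) (lY : Y →ₗ[ℂ] C ⊗[ℂ] Y) (rY : Y →ₗ[ℂ] Y ⊗[ℂ] C)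
    (lZ : Z →ₗ[ℂ] C ⊗[ℂ] Z) : Submodule ℂ (X ⊗[ℂ] (Y ⊗[ℂ] Z)) :=
  cotensor rX ((TensorProduct.assoc ℂ C Y Z).toLinearMap ∘ₗ lY.rTensor Z) ⊓
    LinearMap.eqLocus ((viaRight rY Z).lTensor X) ((viaLeft Y lZ).lTensor X)

/-- A linear extension to the whole space of a map defined on a subspace. Products and actions in
this theory are only defined on cotensor products; `ext` allows one to write composites such as
`Id ⊗ μ` without naming `Z ⊗ (X □ Y)`. Whenever it is used below, the operations can be carried out
one after the other so that each is applied to a tensor lying in (a vector space tensored with)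
its true domain, so that the result does not depend on the extension. -/
def ext {S : Submodule ℂ V} (f : S →ₗ[ℂ] Z) : V →ₗ[ℂ] Z :=
  (LinearMap.exists_extend f).choose

theorem ext_apply {S : Submodule ℂ V} (f : S →ₗ[ℂ] Z) (x : S) : ext f (x : V) = f x :=
  LinearMap.congr_fun (LinearMap.exists_extend f).choose_spec x

end Comodules

section Bicoalgebroid

variable {C B : Type*} [AddCommGroup C] [Module ℂ C] [Coalgebra ℂ C]
  [AddCommGroup B] [Module ℂ B] [Coalgebra ℂ B]

/-- `b ↦ β(b⁽²⁾) ⊗ b⁽¹⁾`. -/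
def baseLeft (β : B →ₗ[ℂ] C) : B →ₗ[ℂ] C ⊗[ℂ] B :=
  β.rTensor B ∘ₗ (TensorProduct.comm ℂ B B).toLinearMap ∘ₗ Coalgebra.comul

/-- `b ↦ b⁽¹⁾ ⊗ α(b⁽²⁾)`. -/
def baseRight (α : B →ₗ[ℂ] C) : B →ₗ[ℂ] B ⊗[ℂ] C :=
  α.lTensor B ∘ₗ Coalgebra.comul

/-- `b ↦ β(b⁽¹⁾) ⊗ b⁽²⁾`. -/
def copLeft (β : B →ₗ[ℂ] C) : B →ₗ[ℂ] C ⊗[ℂ] B :=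
  β.rTensor B ∘ₗ Coalgebra.comul

/-- `b ↦ b⁽¹⁾ ⊗ β(b⁽²⁾)`. -/
def copRight (β : B →ₗ[ℂ] C) : B →ₗ[ℂ] B ⊗[ℂ] C :=
  β.lTensor B ∘ₗ Coalgebra.comul

variable (C B) in
/-- Source `α`, target `β`, product `μ : B □_C B → B` and unit `η : C → B`; the coproduct and the
counit of `B` and of `C` are given by the `Coalgebra` instances. -/
structure BicoalgebroidData where
  /-- the source map -/
  α : B →ₗc[ℂ] C
  /-- the target map -/
  β : B →ₗ[ℂ] C
  /-- the multiplication -/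
  mul : cotensor (baseRight α.toLinearMap) (baseLeft β) →ₗ[ℂ] B
  /-- the unit -/
  η : C →ₗ[ℂ] B

namespace BicoalgebroidData

variable (H : BicoalgebroidData C B)

/-- The left `C`-coaction of `B`. -/
def left : B →ₗ[ℂ] C ⊗[ℂ] B := baseLeft H.β

/-- The right `C`-coaction of `B`. -/
def right : B →ₗ[ℂ] B ⊗[ℂ] C := baseRight H.α.toLinearMap

/-- `B □_C B`. -/
def sq : Submodule ℂ (B ⊗[ℂ] B) := cotensor H.right H.left

/-- `B □_{C_cop} B`. -/
def sqCop : Submodule ℂ (B ⊗[ℂ] B) := cotensor (copRight H.β) (copLeft H.β)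

/-- `B □_C B □_C B`. -/
def cube : Submodule ℂ (B ⊗[ℂ] (B ⊗[ℂ] B)) := cotensor₃ H.right H.left H.right H.left

/-- The multiplication, extended to `B ⊗ B`. -/
def mulE : B ⊗[ℂ] B →ₗ[ℂ] B := ext H.mul

/-- `b ⊗ b' ↦ b⁽¹⁾ ⊗ b⁽²⁾ b'`. -/
def nu : B ⊗[ℂ] B →ₗ[ℂ] B ⊗[ℂ] B :=
  H.mulE.lTensor B ∘ₗ (TensorProduct.assoc ℂ B B B).toLinearMap ∘ₗ
    (Coalgebra.comul (R := ℂ)).rTensor B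

end BicoalgebroidData

variable (C B) in
/-- A right bicoalgebroid `B` over the coalgebra `C`. -/
structure RightBicoalgebroid extends BicoalgebroidData C B where
  counit_β : ∀ b, Coalgebra.counit (R := ℂ) (β b) = Coalgebra.counit (R := ℂ) b
  /-- `β` is a coalgebra map to `C_cop`: `Δ(β(b)) = β(b⁽²⁾) ⊗ β(b⁽¹⁾)` -/
  comul_β : ∀ b, Coalgebra.comul (R := ℂ) (β b) =
    TensorProduct.comm ℂ C C (TensorProduct.map β β (Coalgebra.comul (R := ℂ) b))
  /-- `α(b⁽¹⁾) ⊗ β(b⁽²⁾) = α(b⁽²⁾) ⊗ β(b⁽¹⁾)` -/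
  cocommute : ∀ b, TensorProduct.map α.toLinearMap β (Coalgebra.comul (R := ℂ) b) =
    TensorProduct.map α.toLinearMap β (TensorProduct.comm ℂ B B (Coalgebra.comul (R := ℂ) b))
  /-- `μ` is left `C`-colinear -/
  left_mul : ∀ x : toBicoalgebroidData.sq, toBicoalgebroidData.left (mul x) =
    toBicoalgebroidData.mulE.lTensor C
      (TensorProduct.assoc ℂ C B B (toBicoalgebroidData.left.rTensor B (x : B ⊗[ℂ] B)))
  /-- `μ` is right `C`-colinear -/
  right_mul : ∀ x : toBicoalgebroidData.sq, toBicoalgebroidData.right (mul x) =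
    toBicoalgebroidData.mulE.rTensor C
      ((TensorProduct.assoc ℂ B B C).symm (toBicoalgebroidData.right.lTensor B (x : B ⊗[ℂ] B)))
  /-- `η` is left `C`-colinear -/
  left_η : ∀ c, toBicoalgebroidData.left (η c) = η.lTensor C (Coalgebra.comul (R := ℂ) c)
  /-- `η` is right `C`-colinear -/
  right_η : ∀ c, toBicoalgebroidData.right (η c) = η.rTensor C (Coalgebra.comul (R := ℂ) c)
  mul_assoc : ∀ x ∈ toBicoalgebroidData.cube,
    toBicoalgebroidData.mulE (toBicoalgebroidData.mulE.lTensor B x) =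
      toBicoalgebroidData.mulE
        (toBicoalgebroidData.mulE.rTensor B ((TensorProduct.assoc ℂ B B B).symm x))
  mul_unit : ∀ b, toBicoalgebroidData.mulE (η.lTensor B (toBicoalgebroidData.right b)) = b
  unit_mul : ∀ b, toBicoalgebroidData.mulE (η.rTensor B (toBicoalgebroidData.left b)) = b
  /-- `β(b'⁽¹⁾) ⊗ b b'⁽²⁾ = α(b⁽¹⁾) ⊗ b⁽²⁾ b'` -/
  takeuchi : ∀ x ∈ toBicoalgebroidData.sq,
    TensorProduct.map β toBicoalgebroidData.mulE (TensorProduct.leftComm ℂ B B B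
        ((Coalgebra.comul (R := ℂ)).lTensor B x)) =
      TensorProduct.map α.toLinearMap toBicoalgebroidData.mulE (TensorProduct.assoc ℂ B B B
        ((Coalgebra.comul (R := ℂ)).rTensor B x))
  /-- `Δ(b b') = b⁽¹⁾ b'⁽¹⁾ ⊗ b⁽²⁾ b'⁽²⁾` -/
  comul_mul : ∀ x : toBicoalgebroidData.sq, Coalgebra.comul (R := ℂ) (mul x) =
    TensorProduct.map toBicoalgebroidData.mulE toBicoalgebroidData.mulE
      (TensorProduct.tensorTensorTensorComm ℂ B B B B
        (TensorProduct.map (Coalgebra.comul (R := ℂ)) (Coalgebra.comul (R := ℂ)) (x : B ⊗[ℂ] B)))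
  /-- `ε(b b') = ε(b) ε(b')` -/
  counit_mul : ∀ x : toBicoalgebroidData.sq, Coalgebra.counit (R := ℂ) (mul x) =
    TensorProduct.lid ℂ ℂ
      (TensorProduct.map (Coalgebra.counit (R := ℂ)) (Coalgebra.counit (R := ℂ)) (x : B ⊗[ℂ] B))
  /-- `Δ(η(c)) = η(α(η(c)⁽¹⁾)) ⊗ η(c)⁽²⁾` -/
  comul_η_α : ∀ c, Coalgebra.comul (R := ℂ) (η c) =
    (η ∘ₗ α.toLinearMap).rTensor B (Coalgebra.comul (R := ℂ) (η c))
  /-- `Δ(η(c)) = η(β(η(c)⁽¹⁾)) ⊗ η(c)⁽²⁾` -/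
  comul_η_β : ∀ c, Coalgebra.comul (R := ℂ) (η c) =
    (η ∘ₗ β).rTensor B (Coalgebra.comul (R := ℂ) (η c))
  counit_η : ∀ c, Coalgebra.counit (R := ℂ) (η c) = Coalgebra.counit (R := ℂ) c

variable (C B) in
/-- A right `×_C`-Hopf coalgebra: a right bicoalgebroid for which
`ν : B □_C B → B □_{C_cop} B`, `b ⊗ b' ↦ b⁽¹⁾ ⊗ b⁽²⁾ b'`, is bijective. -/
structure RightHopfCoalgebra extends RightBicoalgebroid C B where
  nu_mem : ∀ x ∈ toBicoalgebroidData.sq, toBicoalgebroidData.nu x ∈ toBicoalgebroidData.sqCop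
  nu_bijective : Function.Bijective (toBicoalgebroidData.nu.restrict nu_mem)

/-- `ν⁻¹ : B □_{C_cop} B → B □_C B`. -/
def RightHopfCoalgebra.nuInv (H : RightHopfCoalgebra C B) : H.sqCop →ₗ[ℂ] H.sq :=
  (LinearEquiv.ofBijective (H.nu.restrict H.nu_mem) H.nu_bijective).symm.toLinearMap

/-- `ν⁻¹`, written `b ⊗ b' ↦ ν⁻(b, b') ⊗ ν⁺(b, b')`, with values in `B ⊗ B` and extended
to `B ⊗ B`. -/
def RightHopfCoalgebra.nuInvE (H : RightHopfCoalgebra C B) : B ⊗[ℂ] B →ₗ[ℂ] B ⊗[ℂ] B :=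
  ext (H.sq.subtype ∘ₗ H.nuInv)

end Bicoalgebroid

section Coefficients

variable {C B : Type*} [AddCommGroup C] [Module ℂ C] [Coalgebra ℂ C]
  [AddCommGroup B] [Module ℂ B] [Coalgebra ℂ B]

/-- A right module over `B`: a right `C`-comodule `M` with a unital associative right `C`-colinear
action `M □_C B → M`. -/
structure RightModule (H : RightBicoalgebroid C B) (M : Type*) [AddCommGroup M] [Module ℂ M] where
  /-- the right `C`-coaction -/
  right : M →ₗ[ℂ] M ⊗[ℂ] C
  isRightCoaction_right : IsRightCoaction right
  /-- the action -/
  act : cotensor right H.left →ₗ[ℂ] M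
  /-- `(m ◁ b)[0] ⊗ (m ◁ b)[1] = m ◁ b⁽¹⁾ ⊗ α(b⁽²⁾)` -/
  right_act : ∀ x : cotensor right H.left, right (act x) =
    (ext act).rTensor C ((TensorProduct.assoc ℂ M B C).symm
      (H.right.lTensor M (x : M ⊗[ℂ] B)))
  act_assoc : ∀ x ∈ cotensor₃ right H.left H.right H.left,
    ext act (H.mulE.lTensor M x) =
      ext act ((ext act).rTensor B ((TensorProduct.assoc ℂ M B B).symm x))
  act_unit : ∀ m, ext act (H.η.lTensor M (right m)) = m

/-- The action, extended to `M ⊗ B`. -/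
def RightModule.actE {H : RightBicoalgebroid C B} {M : Type*} [AddCommGroup M] [Module ℂ M]
    (S : RightModule H M) : M ⊗[ℂ] B →ₗ[ℂ] M := ext S.act

/-- The map
`m ⊗ b ↦ ν⁺(b⁽²⁾, m⁽⁻¹⁾) b⁽¹⁾ ⊗ m⁽⁰⁾ ◁ ν⁻(b⁽²⁾, m⁽⁻¹⁾)`, where `coact m = m⁽⁻¹⁾ ⊗ m⁽⁰⁾`. -/
def aydMap (H : RightHopfCoalgebra C B) {M : Type*} [AddCommGroup M] [Module ℂ M]
    (actE : M ⊗[ℂ] B →ₗ[ℂ] M) (coact : M →ₗ[ℂ] B ⊗[ℂ] M) : M ⊗[ℂ] B →ₗ[ℂ] B ⊗[ℂ] M :=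
  -- `(ν⁺ ⊗ b⁽¹⁾) ⊗ (ν⁻ ⊗ m⁽⁰⁾)` is sent to `ν⁺ b⁽¹⁾ ⊗ m⁽⁰⁾ ◁ ν⁻`
  TensorProduct.map H.mulE (actE ∘ₗ (TensorProduct.comm ℂ B M).toLinearMap) ∘ₗ
  (TensorProduct.tensorTensorTensorComm ℂ B B B M).toLinearMap ∘ₗ
  -- `(b⁽²⁾ ⊗ m⁽⁻¹⁾) ⊗ (b⁽¹⁾ ⊗ m⁽⁰⁾)` is sent to `(ν⁺ ⊗ ν⁻) ⊗ (b⁽¹⁾ ⊗ m⁽⁰⁾)`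
  ((TensorProduct.comm ℂ B B).toLinearMap ∘ₗ H.nuInvE).rTensor (B ⊗[ℂ] M) ∘ₗ
  (TensorProduct.tensorTensorTensorComm ℂ B B B M).toLinearMap ∘ₗ
  -- `b ⊗ m` is sent to `(b⁽²⁾ ⊗ b⁽¹⁾) ⊗ (m⁽⁻¹⁾ ⊗ m⁽⁰⁾)`
  TensorProduct.map ((TensorProduct.comm ℂ B B).toLinearMap ∘ₗ Coalgebra.comul) coact ∘ₗ
  (TensorProduct.comm ℂ M B).toLinearMap

/-- A right-left stable anti Yetter-Drinfeld module over `B`. -/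
structure SAYDModule (H : RightHopfCoalgebra C B) (M : Type*) [AddCommGroup M] [Module ℂ M]
    extends RightModule H.toRightBicoalgebroid M where
  /-- the left `B`-coaction `m ↦ m⁽⁻¹⁾ ⊗ m⁽⁰⁾` -/
  coact : M →ₗ[ℂ] B ⊗[ℂ] M
  isLeftCoaction_coact : IsLeftCoaction coact
  /-- the right `C`-coaction of the module `M` is the one induced by the `B`-coaction:
  `m[0] ⊗ m[1] = m⁽⁰⁾ ⊗ β(m⁽⁻¹⁾)` -/
  right_eq : ∀ m, right m = TensorProduct.comm ℂ C M (H.β.rTensor M (coact m))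
  /-- the left `C`-coaction induced by the `B`-coaction is the canonical one of the module `M`:
  `α(m⁽⁻¹⁾) ⊗ m⁽⁰⁾ = α(η(m[1])⁽¹⁾) ⊗ m[0] ◁ η(m[1])⁽²⁾` -/
  left_eq : ∀ m, H.α.toLinearMap.rTensor M (coact m) =
    TensorProduct.map H.α.toLinearMap toRightModule.actE (TensorProduct.leftComm ℂ M B B
      (((Coalgebra.comul (R := ℂ)) ∘ₗ H.η).lTensor M (right m)))
  ayd : ∀ x : cotensor right H.left,
    coact (act x) = aydMap H toRightModule.actE coact (x : M ⊗[ℂ] B)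
  /-- `m⁽⁰⁾ ◁ m⁽⁻¹⁾ = m` -/
  stable : ∀ m, toRightModule.actE (TensorProduct.comm ℂ B M (coact m)) = m

variable (C) in
/-- A `C`-ring: a `C`-bicomodule `A` with a `C`-bicolinear associative multiplication
`A □_C A → A` and a `C`-bicolinear unit map `C → A`. -/
structure CRing (A : Type*) [AddCommGroup A] [Module ℂ A] where
  /-- the left `C`-coaction -/
  left : A →ₗ[ℂ] C ⊗[ℂ] A
  /-- the right `C`-coaction -/
  right : A →ₗ[ℂ] A ⊗[ℂ] C
  isLeftCoaction_left : IsLeftCoaction left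
  isRightCoaction_right : IsRightCoaction right
  left_right : ∀ a, TensorProduct.assoc ℂ C A C (left.rTensor C (right a)) =
    right.lTensor C (left a)
  /-- the multiplication -/
  mul : cotensor right left →ₗ[ℂ] A
  /-- the unit map -/
  η : C →ₗ[ℂ] A
  left_mul : ∀ x : cotensor right left, left (mul x) =
    (ext mul).lTensor C (TensorProduct.assoc ℂ C A A (left.rTensor A (x : A ⊗[ℂ] A)))
  right_mul : ∀ x : cotensor right left, right (mul x) =
    (ext mul).rTensor C ((TensorProduct.assoc ℂ A A C).symm (right.lTensor A (x : A ⊗[ℂ] A)))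
  left_η : ∀ c, left (η c) = η.lTensor C (Coalgebra.comul (R := ℂ) c)
  right_η : ∀ c, right (η c) = η.rTensor C (Coalgebra.comul (R := ℂ) c)
  mul_assoc : ∀ x ∈ cotensor₃ right left right left,
    ext mul ((ext mul).lTensor A x) =
      ext mul ((ext mul).rTensor A ((TensorProduct.assoc ℂ A A A).symm x))
  mul_unit : ∀ a, ext mul (η.lTensor A (right a)) = a
  unit_mul : ∀ a, ext mul (η.rTensor A (left a)) = a

/-- The multiplication, extended to `A ⊗ A`. -/
def CRing.mulE {A : Type*} [AddCommGroup A] [Module ℂ A] (R : CRing C A) : A ⊗[ℂ] A →ₗ[ℂ] A :=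
  ext R.mul

/-- A right `B`-comodule `C`-ring. -/
structure ComoduleRing (H : RightHopfCoalgebra C B) (A : Type*) [AddCommGroup A] [Module ℂ A]
    extends CRing C A where
  /-- the right `B`-coaction `a ↦ a⁽⁰⁾ ⊗ a⁽¹⁾` -/
  coact : A →ₗ[ℂ] A ⊗[ℂ] B
  isRightCoaction_coact : IsRightCoaction coact
  /-- the left `C`-coaction is the one induced by the `B`-coaction:
  `a[-1] ⊗ a[0] = β(a⁽¹⁾) ⊗ a⁽⁰⁾` -/
  left_eq : ∀ a, left a = TensorProduct.comm ℂ A C (H.β.lTensor A (coact a))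
  /-- the right `C`-coaction is the one induced by the `B`-coaction:
  `a[0] ⊗ a[1] = a⁽⁰⁾ ⊗ α(a⁽¹⁾)` -/
  right_eq : ∀ a, right a = H.α.toLinearMap.lTensor A (coact a)
  /-- `η_A(c)⁽⁰⁾ ⊗ η_A(c)⁽¹⁾ = η_A(α(η_B(c)⁽¹⁾)) ⊗ η_B(c)⁽²⁾` -/
  coact_η : ∀ c, coact (η c) =
    TensorProduct.map (η ∘ₗ H.α.toLinearMap) LinearMap.id (Coalgebra.comul (R := ℂ) (H.η c))
  /-- `(a a')⁽⁰⁾ ⊗ (a a')⁽¹⁾ = a⁽⁰⁾ a'⁽⁰⁾ ⊗ a⁽¹⁾ a'⁽¹⁾` -/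
  coact_mul : ∀ x : cotensor right left, coact (mul x) =
    TensorProduct.map toCRing.mulE H.mulE (TensorProduct.tensorTensorTensorComm ℂ A B A B
      (TensorProduct.map coact coact (x : A ⊗[ℂ] A)))

end Coefficients

section Cochains

variable (A M : Type u) [AddCommGroup A] [Module ℂ A] [AddCommGroup M] [Module ℂ M]

/-- `A^{⊗ n} ⊗ M`, that is, `A ⊗ (A ⊗ ⋯ (A ⊗ M))` with `n` factors `A`. -/
def TW : ℕ → ModuleCat.{u} ℂ
  | 0 => ModuleCat.of ℂ M
  | n + 1 => ModuleCat.of ℂ (A ⊗[ℂ] (TW n))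

/-- `A^{⊗ 0} ⊗ M = M`. -/
def TW.zero : TW A M 0 ≃ₗ[ℂ] M := LinearEquiv.refl ℂ M

/-- `A^{⊗ (n+1)} ⊗ M = A ⊗ (A^{⊗ n} ⊗ M)`. -/
def TW.succ (n : ℕ) : TW A M (n + 1) ≃ₗ[ℂ] A ⊗[ℂ] TW A M n :=
  LinearEquiv.refl ℂ (A ⊗[ℂ] TW A M n)

variable {A M}

/-- Apply `f : A^{⊗ n} ⊗ M → A^{⊗ m} ⊗ M` behind a first factor `A`. -/
def TW.shift {n m : ℕ} (f : TW A M n →ₗ[ℂ] TW A M m) : TW A M (n + 1) →ₗ[ℂ] TW A M (m + 1) :=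
  (TW.succ A M m).symm.toLinearMap ∘ₗ f.lTensor A ∘ₗ (TW.succ A M n).toLinearMap

variable {Z : Type*} [AddCommGroup Z] [Module ℂ Z]

/-- Given `f : A^{⊗ n} ⊗ M → Z ⊗ (A^{⊗ n} ⊗ M)`, apply it behind a first factor `A` and move the
factor `Z` to the front. -/
def TW.shiftOut {n : ℕ} (f : TW A M n →ₗ[ℂ] Z ⊗[ℂ] TW A M n) :
    TW A M (n + 1) →ₗ[ℂ] Z ⊗[ℂ] TW A M (n + 1) :=
  (TW.succ A M n).symm.toLinearMap.lTensor Z ∘ₗ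
    (TensorProduct.leftComm ℂ A Z (TW A M n)).toLinearMap ∘ₗ
    f.lTensor A ∘ₗ (TW.succ A M n).toLinearMap

/-- Apply a coaction `A → Z ⊗ A` to the `i`-th factor of `a₀ ⊗ ⋯ ⊗ aₙ₋₁ ⊗ m` and move the factor
in `Z` to the front. -/
def coactAt (k : A →ₗ[ℂ] Z ⊗[ℂ] A) :
    (n : ℕ) → Fin n → (TW A M n →ₗ[ℂ] Z ⊗[ℂ] TW A M n)
  | 0, i => i.elim0
  | n + 1, i => Fin.cases
      ((TW.succ A M n).symm.toLinearMap.lTensor Z ∘ₗ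
        (TensorProduct.assoc ℂ Z A (TW A M n)).toLinearMap ∘ₗ
        k.rTensor (TW A M n) ∘ₗ (TW.succ A M n).toLinearMap)
      (fun j => TW.shiftOut (coactAt k n j)) i

/-- Apply a coaction `M → Z ⊗ M` to the last factor of `a₀ ⊗ ⋯ ⊗ aₙ₋₁ ⊗ m` and move the factor
in `Z` to the front. -/
def coactLast (k : M →ₗ[ℂ] Z ⊗[ℂ] M) : (n : ℕ) → (TW A M n →ₗ[ℂ] Z ⊗[ℂ] TW A M n)
  | 0 => (TW.zero A M).symm.toLinearMap.lTensor Z ∘ₗ k ∘ₗ (TW.zero A M).toLinearMap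
  | n + 1 => TW.shiftOut (coactLast k n)

variable {C B : Type*} [AddCommGroup C] [Module ℂ C] [Coalgebra ℂ C]
  [AddCommGroup B] [Module ℂ B] [Coalgebra ℂ B] {H : RightHopfCoalgebra C B}

/-- `a₀ ⊗ ⋯ ⊗ aₙ ⊗ m ↦ a₀⁽¹⁾ (⋯ (aₙ₋₁⁽¹⁾ aₙ⁽¹⁾)) ⊗ (a₀⁽⁰⁾ ⊗ ⋯ ⊗ aₙ⁽⁰⁾ ⊗ m)`. -/
def coactDiag (R : ComoduleRing H A) :
    (n : ℕ) → (TW A M (n + 1) →ₗ[ℂ] B ⊗[ℂ] TW A M (n + 1))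
  | 0 => coactAt ((TensorProduct.comm ℂ A B).toLinearMap ∘ₗ R.coact) 1 0
  | n + 1 =>
      (TW.succ A M (n + 1)).symm.toLinearMap.lTensor B ∘ₗ
      H.mulE.rTensor (A ⊗[ℂ] TW A M (n + 1)) ∘ₗ
      (TensorProduct.tensorTensorTensorComm ℂ B A B (TW A M (n + 1))).toLinearMap ∘ₗ
      TensorProduct.map ((TensorProduct.comm ℂ A B).toLinearMap ∘ₗ R.coact) (coactDiag R n) ∘ₗ
      (TW.succ A M (n + 1)).toLinearMap

/-- The space `A^{□_C (n+1)} □_B M` as a subspace of `A^{⊗ (n+1)} ⊗ M`: the condition indexed by `i`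
is the one for the cotensor product over `C` of the factors `aᵢ` and `aᵢ₊₁`, and the last one is
`a₀⁽⁰⁾ ⊗ ⋯ ⊗ aₙ⁽⁰⁾ ⊗ a₀⁽¹⁾ ⋯ aₙ⁽¹⁾ ⊗ m = a₀ ⊗ ⋯ ⊗ aₙ ⊗ m⁽⁻¹⁾ ⊗ m⁽⁰⁾`. -/
def cochains (R : ComoduleRing H A) (S : SAYDModule H M) (n : ℕ) :
    Submodule ℂ (TW A M (n + 1)) :=
  (⨅ i : Fin n, LinearMap.eqLocus
    (coactAt (M := M) ((TensorProduct.comm ℂ A C).toLinearMap ∘ₗ R.right) (n + 1) i.castSucc)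
    (coactAt (M := M) R.left (n + 1) i.succ)) ⊓
  LinearMap.eqLocus (coactDiag R n) (coactLast S.coact (n + 1))

/-- `a₀ ⊗ ⋯ ⊗ aₙ₋₁ ⊗ m ↦ a₀ ⊗ ⋯ ⊗ η_A(aᵢ[-1]) ⊗ aᵢ[0] ⊗ ⋯ ⊗ aₙ₋₁ ⊗ m`. -/
def faceAt (R : ComoduleRing H A) : (n : ℕ) → Fin n → (TW A M n →ₗ[ℂ] TW A M (n + 1))
  | 0, i => i.elim0
  | n + 1, i => Fin.cases
      ((TW.succ A M (n + 1)).symm.toLinearMap ∘ₗ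
        (TW.succ A M n).symm.toLinearMap.lTensor A ∘ₗ
        (TensorProduct.assoc ℂ A A (TW A M n)).toLinearMap ∘ₗ
        (R.η.rTensor A ∘ₗ R.left).rTensor (TW A M n) ∘ₗ (TW.succ A M n).toLinearMap)
      (fun j => TW.shift (faceAt R n j)) i

/-- `a₀ ⊗ ⋯ ⊗ aₙ ⊗ m ↦ a₀ ⊗ ⋯ ⊗ aᵢ aᵢ₊₁ ⊗ ⋯ ⊗ aₙ ⊗ m`. -/
def degeneracyAt (R : ComoduleRing H A) :
    (n : ℕ) → Fin n → (TW A M (n + 1) →ₗ[ℂ] TW A M n)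
  | 0, i => i.elim0
  | n + 1, i => Fin.cases
      ((TW.succ A M n).symm.toLinearMap ∘ₗ
        R.mulE.rTensor (TW A M n) ∘ₗ
        (TensorProduct.assoc ℂ A A (TW A M n)).symm.toLinearMap ∘ₗ
        (TW.succ A M n).toLinearMap.lTensor A ∘ₗ (TW.succ A M (n + 1)).toLinearMap)
      (fun j => TW.shift (degeneracyAt R n j)) i

/-- `a ⊗ (a₁ ⊗ ⋯ ⊗ aₙ ⊗ m) ↦ a₁ ⊗ ⋯ ⊗ aₙ ⊗ a⁽⁰⁾ ⊗ m ◁ a⁽¹⁾`. -/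
def push (R : ComoduleRing H A) (S : SAYDModule H M) :
    (n : ℕ) → (A ⊗[ℂ] TW A M n →ₗ[ℂ] TW A M (n + 1))
  | 0 => (TW.succ A M 0).symm.toLinearMap ∘ₗ
      (TW.zero A M).symm.toLinearMap.lTensor A ∘ₗ
      (S.actE ∘ₗ (TensorProduct.comm ℂ B M).toLinearMap).lTensor A ∘ₗ
      (TensorProduct.assoc ℂ A B M).toLinearMap ∘ₗ
      R.coact.rTensor M ∘ₗ (TW.zero A M).toLinearMap.lTensor A
  | n + 1 => (TW.succ A M (n + 1)).symm.toLinearMap ∘ₗ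
      (push R S n).lTensor A ∘ₗ
      (TensorProduct.leftComm ℂ A A (TW A M n)).toLinearMap ∘ₗ
      (TW.succ A M n).toLinearMap.lTensor A

/-- `a₀ ⊗ ⋯ ⊗ aₙ ⊗ m ↦ a₁ ⊗ ⋯ ⊗ aₙ ⊗ a₀⁽⁰⁾ ⊗ m ◁ a₀⁽¹⁾`. -/
def cyclicOp (R : ComoduleRing H A) (S : SAYDModule H M) (n : ℕ) :
    TW A M (n + 1) →ₗ[ℂ] TW A M (n + 1) :=
  push R S n ∘ₗ (TW.succ A M n).toLinearMap

end Cochains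

section Cocyclic

/-- A cocyclic module structure on a sequence of vector spaces. -/
structure CocyclicModule (V : ℕ → Type*) [∀ n, AddCommGroup (V n)] [∀ n, Module ℂ (V n)] where
  /-- the cofaces -/
  δ : ∀ n, Fin (n + 2) → (V n →ₗ[ℂ] V (n + 1))
  /-- the codegeneracies -/
  σ : ∀ n, Fin (n + 1) → (V (n + 1) →ₗ[ℂ] V n)
  /-- the cyclic operators -/
  τ : ∀ n, V n →ₗ[ℂ] V n
  δ_comp_δ : ∀ n (i j : Fin (n + 2)), i ≤ j →
    δ (n + 1) j.succ ∘ₗ δ n i = δ (n + 1) i.castSucc ∘ₗ δ n j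
  σ_comp_σ : ∀ n (i j : Fin (n + 1)), i ≤ j →
    σ n j ∘ₗ σ (n + 1) i.castSucc = σ n i ∘ₗ σ (n + 1) j.succ
  σ_comp_δ_of_le : ∀ n (i : Fin (n + 2)) (j : Fin (n + 1)), i ≤ j.castSucc →
    σ (n + 1) j.succ ∘ₗ δ (n + 1) i.castSucc = δ n i ∘ₗ σ n j
  σ_comp_δ_self : ∀ n (i : Fin (n + 1)), σ n i ∘ₗ δ n i.castSucc = LinearMap.id
  σ_comp_δ_succ : ∀ n (i : Fin (n + 1)), σ n i ∘ₗ δ n i.succ = LinearMap.id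
  σ_comp_δ_of_gt : ∀ n (i : Fin (n + 2)) (j : Fin (n + 1)), j.castSucc < i →
    σ (n + 1) j.castSucc ∘ₗ δ (n + 1) i.succ = δ n i ∘ₗ σ n j
  τ_comp_δ_succ : ∀ n (i : Fin (n + 1)), τ (n + 1) ∘ₗ δ n i.succ = δ n i.castSucc ∘ₗ τ n
  τ_comp_δ_zero : ∀ n, τ (n + 1) ∘ₗ δ n 0 = δ n (Fin.last (n + 1))
  τ_comp_σ_succ : ∀ n (i : Fin n), τ n ∘ₗ σ n i.succ = σ n i.castSucc ∘ₗ τ (n + 1)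
  τ_comp_σ_zero : ∀ n, τ n ∘ₗ σ n 0 = σ n (Fin.last n) ∘ₗ τ (n + 1) ∘ₗ τ (n + 1)
  τ_pow : ∀ n, (τ n) ^ (n + 1) = 1

namespace CocyclicModule

variable {V : ℕ → Type*} [∀ n, AddCommGroup (V n)] [∀ n, Module ℂ (V n)] (X : CocyclicModule V)

/-- The Hochschild coboundary `∑ (-1)ⁱ δᵢ`. -/
def b (n : ℕ) : V n →ₗ[ℂ] V (n + 1) := ∑ i : Fin (n + 2), (-1 : ℂ) ^ (i : ℕ) • X.δ n i

/-- The cyclic cochains: those `x` with `(-1)ⁿ τₙ x = x`. -/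
def cyclicCochains (n : ℕ) : Submodule ℂ (V n) :=
  LinearMap.eqLocus ((-1 : ℂ) ^ n • X.τ n) LinearMap.id

/-- The cyclic cocycles. -/
def cyclicCocycles (n : ℕ) : Submodule ℂ (V n) := LinearMap.ker (X.b n) ⊓ X.cyclicCochains n

/-- The coboundaries of cyclic cochains. -/
def cyclicCoboundaries : (n : ℕ) → Submodule ℂ (V n)
  | 0 => ⊥
  | n + 1 => (X.cyclicCochains n).map (X.b n)

/-- Cyclic cohomology `HCⁿ`: cyclic cocycles modulo coboundaries of cyclic cochains. -/
abbrev cyclicCohomology (n : ℕ) : Type _ :=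
  X.cyclicCocycles n ⧸ (X.cyclicCoboundaries n).comap (X.cyclicCocycles n).subtype

end CocyclicModule

end Cocyclic

end HopfCyc

end

/-!
Products and actions are only defined on cotensor products, so every identity of the theory holds
only on tensors satisfying cotensor conditions. Over a field such an identity can still be used
beside spectator factors: a tensor in `V ⊗ W` is determined by its slices, the images in `W` under
functionals on `V`, and if the slices lie in the domain of an identity then the identity holds
behind `V` (`lTensor_congr`, `lTensor_congr_of_eq`). Coactions are written with the new factor moved
to the front, so that cotensor conditions become equations between the operators `front` and
`behind`, and Sweedler notation is the expansion `sum_legs` into pure tensors.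

Inner cofaces and codegeneracies preserve the cochains because the maps `a ↦ η(a[-1]) ⊗ a[0]` and
`a ⊗ a' ↦ a a'` are colinear over `B` (`diag_split`, `out_mulE`); the first of these uses the unit
law together with `β(b'⁽¹⁾) ⊗ b b'⁽²⁾ = α(b⁽¹⁾) ⊗ b⁽²⁾ b'` (`unit_coact`). Their identities are the
ring axioms of `A`.

The cyclic operator is the rotation of the factors after `theta`, which is the map
`a ⊗ t ↦ a⁽⁰⁾ ⊗ t ◁ a⁽¹⁾`. Here `t` ranges over `A^{⊗ n} ⊗ M`, which satisfies the laws of a stable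
anti Yetter–Drinfeld module with the factors `A` as spectators (`isSAYD_actAt`). That `τ` preserves
the cochains rests on two facts.
* The left `C`-coaction of `t ◁ b` along the source is governed by `b`: one has
  `α(t⁽⁻¹⁾) ⊗ t⁽⁰⁾ ◁ b = β(b⁽¹⁾) ⊗ t ◁ b⁽²⁾` (`IsSAYD.takeuchi`). Hence `a₀⁽⁰⁾` may be placed behind the
  last factor `A` (`coactAt_last_theta`).
* On a cochain the coaction of `M` is the product `a₀⁽¹⁾ t⁽¹⁾` of the coactions of the factors. The
  anti Yetter–Drinfeld condition therefore applies `ν⁻¹` to `a₀⁽²⁾ ⊗ a₀⁽³⁾ t⁽¹⁾ = ν(a₀⁽²⁾ ⊗ t⁽¹⁾)`, and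
  the coaction of `M` after the action is `t⁽¹⁾ a₀⁽¹⁾`, the coaction of the rotated factors
  (`behind_theta`).

By associativity of the action, the actions of successive factors combine to the action of the
product of their coactions (`act_theta`). For two factors, colinearity of the multiplication and of
the unit insertion gives `τ σ₀ = σₙ τ²` and `τ² δ₀ = δₙ τ`. For all `n + 1` factors, `τ^(n+1)` is the
action of the diagonal coaction (`actFirst_eq`), which on a cochain is the coaction of `M`, so
stability gives `τ^(n+1) = 1` (`cyclicOp_pow_eq_self`). The identity `σₙ τ δ₀ = 1` is the right unit
law, since `τ δ₀` inserts a unit behind the last factor `A` (`theta_unit`). The remaining identities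
of the last coface `τ δ₀` are formal consequences (`CocyclicModule.ofInner`), and so are `b² = 0` and the
invariance of the cyclic cochains under `b`.
-/


noncomputable section

namespace HopfCyc

/-! ### Tensors and their slices -/

section LinearAlgebra

variable {X Y Z V W U : Type*} [AddCommGroup X] [Module ℂ X] [AddCommGroup Y] [Module ℂ Y]
  [AddCommGroup Z] [Module ℂ Z] [AddCommGroup V] [Module ℂ V] [AddCommGroup W] [Module ℂ W]
  [AddCommGroup U] [Module ℂ U]

/-- The index set of a chosen decomposition of the tensor `f v` into pure tensors. -/
def legs (f : V →ₗ[ℂ] X ⊗[ℂ] Y) (v : V) : Finset (X × Y) :=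
  (TensorProduct.exists_finset (f v)).choose

/-- Sweedler notation: `f v` is written as a sum of pure tensors. -/
theorem sum_legs (f : V →ₗ[ℂ] X ⊗[ℂ] Y) (v : V) : f v = ∑ p ∈ legs f v, p.1 ⊗ₜ p.2 :=
  (TensorProduct.exists_finset (f v)).choose_spec

/-- Evaluate the first factor of a tensor at a functional. -/
def slice (φ : V →ₗ[ℂ] ℂ) (W : Type*) [AddCommGroup W] [Module ℂ W] : V ⊗[ℂ] W →ₗ[ℂ] W :=
  (TensorProduct.lid ℂ W).toLinearMap ∘ₗ φ.rTensor W

theorem slice_lTensor (φ : V →ₗ[ℂ] ℂ) (f : W →ₗ[ℂ] U) (x : V ⊗[ℂ] W) :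
    slice φ U (f.lTensor V x) = f (slice φ W x) := by
  induction x with
  | zero => simp
  | add x y hx hy => simp only [map_add, hx, hy]
  | tmul v w => simp [slice]

/-- A tensor over a field is determined by its slices. -/
theorem eq_of_slice {x y : V ⊗[ℂ] W} (h : ∀ φ : V →ₗ[ℂ] ℂ, slice φ W x = slice φ W y) :
    x = y := by
  classical
  let b := Module.Basis.ofVectorSpace ℂ V
  let e := (TensorProduct.congr b.repr (LinearEquiv.refl ℂ W)).trans
    (TensorProduct.finsuppScalarLeft ℂ W _)
  have key : ∀ z i, e z i = slice (b.coord i) W z := by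
    intro z i
    induction z with
    | zero => simp
    | add x y hx hy => rw [map_add, map_add, ← hx, ← hy]; rfl
    | tmul v w => simp [slice, e]
  apply e.injective
  ext i
  rw [key, key, h]

/-- Two maps agree on a tensor in `V ⊗ W` as soon as they agree on its slices: an identity that
holds only on a subspace of `W` may be applied behind a spectator factor `V`. -/
theorem lTensor_congr {F G : W →ₗ[ℂ] U} (P : W → Prop) {x : V ⊗[ℂ] W}
    (hx : ∀ φ : V →ₗ[ℂ] ℂ, P (slice φ W x)) (h : ∀ w, P w → F w = G w) :
    F.lTensor V x = G.lTensor V x :=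
  eq_of_slice fun φ => by rw [slice_lTensor, slice_lTensor, h _ (hx φ)]

/-- An identity that holds on the equalizer of `f` and `g` holds behind a spectator factor on the
equalizer of `V ⊗ f` and `V ⊗ g`. -/
theorem lTensor_congr_of_eq {f g : W →ₗ[ℂ] U} {F G : W →ₗ[ℂ] Z}
    (h : ∀ w, f w = g w → F w = G w) {x : V ⊗[ℂ] W} (hx : f.lTensor V x = g.lTensor V x) :
    F.lTensor V x = G.lTensor V x :=
  lTensor_congr (fun w => f w = g w)
    (fun φ => by rw [← slice_lTensor, ← slice_lTensor, hx]) h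

theorem comm_rTensor (f : V →ₗ[ℂ] U) (x : V ⊗[ℂ] W) :
    TensorProduct.comm ℂ U W (f.rTensor W x) = f.lTensor W (TensorProduct.comm ℂ V W x) := by
  induction x with
  | zero => simp
  | add x y hx hy => simp only [map_add, hx, hy]
  | tmul v w => simp

theorem rTensor_congr_of_eq {f g : W →ₗ[ℂ] U} {F G : W →ₗ[ℂ] Z}
    (h : ∀ w, f w = g w → F w = G w) {x : W ⊗[ℂ] V} (hx : f.rTensor V x = g.rTensor V x) :
    F.rTensor V x = G.rTensor V x := by
  apply (TensorProduct.comm ℂ Z V).injective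
  rw [comm_rTensor, comm_rTensor]
  apply lTensor_congr_of_eq h
  rw [← comm_rTensor, ← comm_rTensor, hx]

/-! ### Operators that move a new factor to the front -/

/-- Apply `f : V → Z ⊗ V` to the first factor of `V ⊗ T`. -/
def front (f : V →ₗ[ℂ] Z ⊗[ℂ] V) (T : Type*) [AddCommGroup T] [Module ℂ T] :
    V ⊗[ℂ] T →ₗ[ℂ] Z ⊗[ℂ] (V ⊗[ℂ] T) :=
  (TensorProduct.assoc ℂ Z V T).toLinearMap ∘ₗ f.rTensor T

/-- Apply `f : W → Z ⊗ W` to the second factor of `V ⊗ W` and move the factor in `Z` to the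
front. -/
def behind (V : Type*) [AddCommGroup V] [Module ℂ V] (f : W →ₗ[ℂ] Z ⊗[ℂ] W) :
    V ⊗[ℂ] W →ₗ[ℂ] Z ⊗[ℂ] (V ⊗[ℂ] W) :=
  (TensorProduct.leftComm ℂ V Z W).toLinearMap ∘ₗ f.lTensor V

/-- `v ⊗ w ↦ (v[-1] ⊗ w[-1]) ⊗ (v[0] ⊗ w[0])`. -/
def pair (k : V →ₗ[ℂ] X ⊗[ℂ] V) (d : W →ₗ[ℂ] Y ⊗[ℂ] W) :
    V ⊗[ℂ] W →ₗ[ℂ] (X ⊗[ℂ] Y) ⊗[ℂ] (V ⊗[ℂ] W) :=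
  (TensorProduct.tensorTensorTensorComm ℂ X V Y W).toLinearMap ∘ₗ TensorProduct.map k d

theorem front_congr {f g : V →ₗ[ℂ] Z ⊗[ℂ] V} {x : V ⊗[ℂ] W} (h : f.rTensor W x = g.rTensor W x) :
    front f W x = front g W x := by
  simp only [front, LinearMap.comp_apply, h]

theorem behind_congr {f g : W →ₗ[ℂ] Z ⊗[ℂ] W} {x : V ⊗[ℂ] W} (h : f.lTensor V x = g.lTensor V x) :
    behind V f x = behind V g x := by
  simp only [behind, LinearMap.comp_apply, h]

theorem rTensor_eq_of_front {f g : V →ₗ[ℂ] Z ⊗[ℂ] V} {x : V ⊗[ℂ] W}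
    (h : front f W x = front g W x) : f.rTensor W x = g.rTensor W x :=
  (TensorProduct.assoc ℂ Z V W).injective h

theorem lTensor_eq_of_behind {f g : W →ₗ[ℂ] Z ⊗[ℂ] W} {x : V ⊗[ℂ] W}
    (h : behind V f x = behind V g x) : f.lTensor V x = g.lTensor V x :=
  (TensorProduct.leftComm ℂ V Z W).injective h

/-- `front` is natural. -/
theorem front_rTensor {f : U →ₗ[ℂ] Z ⊗[ℂ] U} {g : V →ₗ[ℂ] U} {f' : V →ₗ[ℂ] Z ⊗[ℂ] V}
    {x : V ⊗[ℂ] W} (h : (f ∘ₗ g).rTensor W x = (g.lTensor Z ∘ₗ f').rTensor W x) :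
    front f W (g.rTensor W x) = (g.rTensor W).lTensor Z (front f' W x) := by
  have h1 : ∀ x : V ⊗[ℂ] W, front f W (g.rTensor W x) =
      TensorProduct.assoc ℂ Z U W ((f ∘ₗ g).rTensor W x) := by
    intro x
    induction x with
    | zero => simp
    | add x y hx hy => simp only [map_add, hx, hy]
    | tmul v w => simp [front]
  have h2 : ∀ x : V ⊗[ℂ] W, (g.rTensor W).lTensor Z (front f' W x) =
      TensorProduct.assoc ℂ Z U W ((g.lTensor Z ∘ₗ f').rTensor W x) := by
    intro x
    induction x with
    | zero => simp
    | add x y hx hy => simp only [map_add, hx, hy]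
    | tmul v w => simp [front, sum_legs f', TensorProduct.sum_tmul]
  rw [h1, h2, h]

/-- `behind` is natural. -/
theorem behind_lTensor {f : U →ₗ[ℂ] Z ⊗[ℂ] U} {g : W →ₗ[ℂ] U} {f' : W →ₗ[ℂ] Z ⊗[ℂ] W}
    {x : V ⊗[ℂ] W} (h : (f ∘ₗ g).lTensor V x = (g.lTensor Z ∘ₗ f').lTensor V x) :
    behind V f (g.lTensor V x) = (g.lTensor V).lTensor Z (behind V f' x) := by
  have h1 : ∀ x : V ⊗[ℂ] W, behind V f (g.lTensor V x) =
      TensorProduct.leftComm ℂ V Z U ((f ∘ₗ g).lTensor V x) := by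
    intro x
    induction x with
    | zero => simp
    | add x y hx hy => simp only [map_add, hx, hy]
    | tmul v w => simp [behind]
  have h2 : ∀ x : V ⊗[ℂ] W, (g.lTensor V).lTensor Z (behind V f' x) =
      TensorProduct.leftComm ℂ V Z U ((g.lTensor Z ∘ₗ f').lTensor V x) := by
    intro x
    induction x with
    | zero => simp
    | add x y hx hy => simp only [map_add, hx, hy]
    | tmul v w => simp [behind, sum_legs f', TensorProduct.tmul_sum]
  rw [h1, h2, h]

/-- `front` commutes with maps of the second factor. -/
theorem front_lTensor (f : V →ₗ[ℂ] Z ⊗[ℂ] V) (g : W →ₗ[ℂ] U) (x : V ⊗[ℂ] W) :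
    front f U (g.lTensor V x) = (g.lTensor V).lTensor Z (front f W x) := by
  induction x with
  | zero => simp
  | add x y hx hy => simp only [map_add, hx, hy]
  | tmul v w => simp [front, sum_legs f, TensorProduct.sum_tmul]

/-- `behind` commutes with maps of the first factor. -/
theorem behind_rTensor (f : W →ₗ[ℂ] Z ⊗[ℂ] W) (g : V →ₗ[ℂ] U) (x : V ⊗[ℂ] W) :
    behind U f (g.rTensor W x) = (g.rTensor W).lTensor Z (behind V f x) := by
  induction x with
  | zero => simp
  | add x y hx hy => simp only [map_add, hx, hy]
  | tmul v w => simp [behind, sum_legs f, TensorProduct.tmul_sum]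

/-- Compatibility of `f` and `k` on `V`, with a spectator factor `W`: a coaction of the leg of `k`
in `X` comes from a coaction `r` of `V`. -/
theorem front_front {k : V →ₗ[ℂ] X ⊗[ℂ] V} {f : X →ₗ[ℂ] Z ⊗[ℂ] X} {r : V →ₗ[ℂ] Z ⊗[ℂ] V}
    {x : V ⊗[ℂ] W} (h : (front f V ∘ₗ k).rTensor W x = (k.lTensor Z ∘ₗ r).rTensor W x) :
    front f (V ⊗[ℂ] W) (front k W x) = (front k W).lTensor Z (front r W x) := by
  let Ψ : (Z ⊗[ℂ] (X ⊗[ℂ] V)) ⊗[ℂ] W →ₗ[ℂ] Z ⊗[ℂ] (X ⊗[ℂ] (V ⊗[ℂ] W)) :=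
    (TensorProduct.assoc ℂ X V W).toLinearMap.lTensor Z ∘ₗ
      (TensorProduct.assoc ℂ Z (X ⊗[ℂ] V) W).toLinearMap
  have h1 : ∀ x : V ⊗[ℂ] W, front f (V ⊗[ℂ] W) (front k W x) =
      Ψ ((front f V ∘ₗ k).rTensor W x) := by
    intro x
    induction x with
    | zero => simp
    | add x y hx hy => simp only [map_add, hx, hy]
    | tmul v w => simp [Ψ, front, sum_legs k, sum_legs f, TensorProduct.sum_tmul]
  have h2 : ∀ x : V ⊗[ℂ] W, (front k W).lTensor Z (front r W x) =
      Ψ ((k.lTensor Z ∘ₗ r).rTensor W x) := by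
    intro x
    induction x with
    | zero => simp
    | add x y hx hy => simp only [map_add, hx, hy]
    | tmul v w => simp [Ψ, front, sum_legs k, sum_legs r, TensorProduct.sum_tmul,
      TensorProduct.tmul_sum]
  rw [h1, h2, h]

/-- The first legs of `pair k d` are compatible with a coaction with which `k` is compatible. -/
theorem front_front_pair {k : V →ₗ[ℂ] X ⊗[ℂ] V} {d : W →ₗ[ℂ] Y ⊗[ℂ] W} {f : X →ₗ[ℂ] Z ⊗[ℂ] X}
    {r : V →ₗ[ℂ] Z ⊗[ℂ] V} {x : V ⊗[ℂ] W}
    (h : (front f V ∘ₗ k).rTensor W x = (k.lTensor Z ∘ₗ r).rTensor W x) :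
    front (front f Y) (V ⊗[ℂ] W) (pair k d x) = (pair k d).lTensor Z (front r W x) := by
  let Ψ : (Z ⊗[ℂ] (X ⊗[ℂ] V)) ⊗[ℂ] W →ₗ[ℂ] Z ⊗[ℂ] ((X ⊗[ℂ] Y) ⊗[ℂ] (V ⊗[ℂ] W)) :=
    ((TensorProduct.tensorTensorTensorComm ℂ X V Y W).toLinearMap ∘ₗ d.lTensor _).lTensor Z ∘ₗ
      (TensorProduct.assoc ℂ Z (X ⊗[ℂ] V) W).toLinearMap
  have h1 : ∀ x : V ⊗[ℂ] W, front (front f Y) (V ⊗[ℂ] W) (pair k d x) =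
      Ψ ((front f V ∘ₗ k).rTensor W x) := by
    intro x
    induction x with
    | zero => simp
    | add x y hx hy => simp only [map_add, hx, hy]
    | tmul v w =>
      simp [Ψ, front, pair, sum_legs k, sum_legs d, sum_legs f, TensorProduct.sum_tmul,
        TensorProduct.tmul_sum]
      simp only [Finset.sum_comm (t := legs d w)]
  have h2 : ∀ x : V ⊗[ℂ] W, (pair k d).lTensor Z (front r W x) =
      Ψ ((k.lTensor Z ∘ₗ r).rTensor W x) := by
    intro x
    induction x with
    | zero => simp
    | add x y hx hy => simp only [map_add, hx, hy]
    | tmul v w =>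
      simp [Ψ, front, pair, sum_legs k, sum_legs d, sum_legs r, TensorProduct.sum_tmul,
        TensorProduct.tmul_sum]
      simp only [Finset.sum_comm (t := legs d w)]
  rw [h1, h2, h]

/-- The second legs of `pair k d` are compatible with a coaction with which `d` is compatible. -/
theorem front_behind_pair {k : V →ₗ[ℂ] X ⊗[ℂ] V} {d : W →ₗ[ℂ] Y ⊗[ℂ] W} {f : Y →ₗ[ℂ] Z ⊗[ℂ] Y}
    {r : W →ₗ[ℂ] Z ⊗[ℂ] W} {x : V ⊗[ℂ] W}
    (h : (front f W ∘ₗ d).lTensor V x = (d.lTensor Z ∘ₗ r).lTensor V x) :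
    front (behind X f) (V ⊗[ℂ] W) (pair k d x) = (pair k d).lTensor Z (behind V r x) := by
  let Ψ : V ⊗[ℂ] (Z ⊗[ℂ] (Y ⊗[ℂ] W)) →ₗ[ℂ] Z ⊗[ℂ] ((X ⊗[ℂ] Y) ⊗[ℂ] (V ⊗[ℂ] W)) :=
    ((TensorProduct.tensorTensorTensorComm ℂ X V Y W).toLinearMap ∘ₗ k.rTensor _).lTensor Z ∘ₗ
      (TensorProduct.leftComm ℂ V Z (Y ⊗[ℂ] W)).toLinearMap
  have h1 : ∀ x : V ⊗[ℂ] W, front (behind X f) (V ⊗[ℂ] W) (pair k d x) =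
      Ψ ((front f W ∘ₗ d).lTensor V x) := by
    intro x
    induction x with
    | zero => simp
    | add x y hx hy => simp only [map_add, hx, hy]
    | tmul v w =>
      simp [Ψ, front, behind, pair, sum_legs k, sum_legs d, sum_legs f, TensorProduct.sum_tmul,
        TensorProduct.tmul_sum]
      simp only [Finset.sum_comm (t := legs k v)]
  have h2 : ∀ x : V ⊗[ℂ] W, (pair k d).lTensor Z (behind V r x) =
      Ψ ((d.lTensor Z ∘ₗ r).lTensor V x) := by
    intro x
    induction x with
    | zero => simp
    | add x y hx hy => simp only [map_add, hx, hy]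
    | tmul v w =>
      simp [Ψ, behind, pair, sum_legs k, sum_legs d, sum_legs r, TensorProduct.sum_tmul,
        TensorProduct.tmul_sum]
  rw [h1, h2, h]

theorem pair_rTensor_comp (k : V →ₗ[ℂ] X ⊗[ℂ] V) (d : W →ₗ[ℂ] Y ⊗[ℂ] W) (g : Y →ₗ[ℂ] U)
    (x : V ⊗[ℂ] W) :
    pair k (g.rTensor W ∘ₗ d) x = (g.lTensor X).rTensor (V ⊗[ℂ] W) (pair k d x) := by
  induction x with
  | zero => simp
  | add x y hx hy => simp only [map_add, hx, hy]
  | tmul v w => simp [pair, sum_legs k, sum_legs d, TensorProduct.sum_tmul, TensorProduct.tmul_sum]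

theorem pair_comp_rTensor (k : V →ₗ[ℂ] X ⊗[ℂ] V) (d : W →ₗ[ℂ] Y ⊗[ℂ] W) (g : X →ₗ[ℂ] U)
    (x : V ⊗[ℂ] W) :
    pair (g.rTensor V ∘ₗ k) d x = (g.rTensor Y).rTensor (V ⊗[ℂ] W) (pair k d x) := by
  induction x with
  | zero => simp
  | add x y hx hy => simp only [map_add, hx, hy]
  | tmul v w => simp [pair, sum_legs k, sum_legs d, TensorProduct.sum_tmul, TensorProduct.tmul_sum]

theorem pair_assoc {X' V' : Type*} [AddCommGroup X'] [Module ℂ X'] [AddCommGroup V'] [Module ℂ V']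
    (k : V →ₗ[ℂ] X ⊗[ℂ] V) (k' : V' →ₗ[ℂ] X' ⊗[ℂ] V') (d : W →ₗ[ℂ] Y ⊗[ℂ] W)
    (x : V ⊗[ℂ] (V' ⊗[ℂ] W)) :
    (TensorProduct.assoc ℂ V V' W).toLinearMap.lTensor ((X ⊗[ℂ] X') ⊗[ℂ] Y)
        (pair (pair k k') d ((TensorProduct.assoc ℂ V V' W).symm x)) =
      (TensorProduct.assoc ℂ X X' Y).symm.toLinearMap.rTensor (V ⊗[ℂ] (V' ⊗[ℂ] W))
        (pair k (pair k' d) x) := by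
  induction x using TensorProduct.induction_on with
  | zero => simp
  | add x y hx hy => simp only [map_add, hx, hy]
  | tmul v y =>
    induction y using TensorProduct.induction_on with
    | zero => simp
    | add x y hx hy => simp only [TensorProduct.tmul_add, map_add, hx, hy]
    | tmul v' w =>
      simp [pair, sum_legs k, sum_legs k', sum_legs d, TensorProduct.sum_tmul,
        TensorProduct.tmul_sum]

/-- `pair` is natural in its first argument. -/
theorem pair_rTensor {k : V →ₗ[ℂ] X ⊗[ℂ] V} {k' : U →ₗ[ℂ] X ⊗[ℂ] U} {d : W →ₗ[ℂ] Y ⊗[ℂ] W}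
    {g : V →ₗ[ℂ] U} {x : V ⊗[ℂ] W}
    (h : (k' ∘ₗ g).rTensor W x = (g.lTensor X ∘ₗ k).rTensor W x) :
    pair k' d (g.rTensor W x) = (g.rTensor W).lTensor (X ⊗[ℂ] Y) (pair k d x) := by
  let Ψ : (X ⊗[ℂ] U) ⊗[ℂ] W →ₗ[ℂ] (X ⊗[ℂ] Y) ⊗[ℂ] (U ⊗[ℂ] W) :=
    (TensorProduct.tensorTensorTensorComm ℂ X U Y W).toLinearMap ∘ₗ d.lTensor _
  have h1 : ∀ x : V ⊗[ℂ] W, pair k' d (g.rTensor W x) = Ψ ((k' ∘ₗ g).rTensor W x) := by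
    intro x
    induction x with
    | zero => simp
    | add x y hx hy => simp only [map_add, hx, hy]
    | tmul v w => simp [Ψ, pair]
  have h2 : ∀ x : V ⊗[ℂ] W, (g.rTensor W).lTensor (X ⊗[ℂ] Y) (pair k d x) =
      Ψ ((g.lTensor X ∘ₗ k).rTensor W x) := by
    intro x
    induction x with
    | zero => simp
    | add x y hx hy => simp only [map_add, hx, hy]
    | tmul v w =>
      simp [Ψ, pair, sum_legs k, sum_legs d, TensorProduct.sum_tmul, TensorProduct.tmul_sum]
      simp only [Finset.sum_comm (t := legs d w)]
  rw [h1, h2, h]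

/-- `pair` is natural in its second argument. -/
theorem pair_lTensor {k : V →ₗ[ℂ] X ⊗[ℂ] V} {d : W →ₗ[ℂ] Y ⊗[ℂ] W} {d' : U →ₗ[ℂ] Y ⊗[ℂ] U}
    {g : W →ₗ[ℂ] U} {x : V ⊗[ℂ] W}
    (h : (d' ∘ₗ g).lTensor V x = (g.lTensor Y ∘ₗ d).lTensor V x) :
    pair k d' (g.lTensor V x) = (g.lTensor V).lTensor (X ⊗[ℂ] Y) (pair k d x) := by
  let Ψ : V ⊗[ℂ] (Y ⊗[ℂ] U) →ₗ[ℂ] (X ⊗[ℂ] Y) ⊗[ℂ] (V ⊗[ℂ] U) :=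
    (TensorProduct.tensorTensorTensorComm ℂ X V Y U).toLinearMap ∘ₗ k.rTensor _
  have h1 : ∀ x : V ⊗[ℂ] W, pair k d' (g.lTensor V x) = Ψ ((d' ∘ₗ g).lTensor V x) := by
    intro x
    induction x with
    | zero => simp
    | add x y hx hy => simp only [map_add, hx, hy]
    | tmul v w => simp [Ψ, pair]
  have h2 : ∀ x : V ⊗[ℂ] W, (g.lTensor V).lTensor (X ⊗[ℂ] Y) (pair k d x) =
      Ψ ((g.lTensor Y ∘ₗ d).lTensor V x) := by
    intro x
    induction x with
    | zero => simp
    | add x y hx hy => simp only [map_add, hx, hy]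
    | tmul v w =>
      simp [Ψ, pair, sum_legs k, sum_legs d, TensorProduct.sum_tmul, TensorProduct.tmul_sum]
  rw [h1, h2, h]

theorem mem_cotensor_iff {r : X →ₗ[ℂ] X ⊗[ℂ] Z} {l : Y →ₗ[ℂ] Z ⊗[ℂ] Y} {x : X ⊗[ℂ] Y} :
    x ∈ cotensor r l ↔
      front ((TensorProduct.comm ℂ X Z).toLinearMap ∘ₗ r) Y x = behind X l x := by
  have h : ∀ x : X ⊗[ℂ] Y, front ((TensorProduct.comm ℂ X Z).toLinearMap ∘ₗ r) Y x =
      TensorProduct.leftComm ℂ X Z Y (viaRight r Y x) := by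
    intro x
    induction x with
    | zero => simp
    | add x y hx hy => simp only [map_add, hx, hy]
    | tmul v w => simp [front, viaRight, sum_legs r, TensorProduct.sum_tmul]
  rw [h]
  exact (TensorProduct.leftComm ℂ X Z Y).injective.eq_iff.symm

end LinearAlgebra

/-! ### Commuting coactions -/

section LinearAlgebra

variable {X Y Z V W U : Type*} [AddCommGroup X] [Module ℂ X] [AddCommGroup Y] [Module ℂ Y]
  [AddCommGroup Z] [Module ℂ Z] [AddCommGroup V] [Module ℂ V] [AddCommGroup W] [Module ℂ W]
  [AddCommGroup U] [Module ℂ U]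

/-- Coactions on different factors commute. -/
theorem front_lTensor_behind (f : V →ₗ[ℂ] X ⊗[ℂ] V) (g : W →ₗ[ℂ] Y ⊗[ℂ] W) (x : V ⊗[ℂ] W) :
    (front f W).lTensor Y (behind V g x) =
      TensorProduct.leftComm ℂ X Y _ ((behind V g).lTensor X (front f W x)) := by
  induction x with
  | zero => simp
  | add x y hx hy => simp only [map_add, hx, hy]
  | tmul v w =>
    simp [front, behind, sum_legs f, sum_legs g, TensorProduct.sum_tmul, TensorProduct.tmul_sum]
    simp only [Finset.sum_comm (t := legs f v)]

theorem front_lTensor_front {f : V →ₗ[ℂ] X ⊗[ℂ] V} {g : V →ₗ[ℂ] Y ⊗[ℂ] V} {x : V ⊗[ℂ] W}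
    (h : (f.lTensor Y ∘ₗ g).rTensor W x =
      ((TensorProduct.leftComm ℂ X Y V).toLinearMap ∘ₗ g.lTensor X ∘ₗ f).rTensor W x) :
    (front f W).lTensor Y (front g W x) =
      TensorProduct.leftComm ℂ X Y _ ((front g W).lTensor X (front f W x)) := by
  let Ψ : (Y ⊗[ℂ] (X ⊗[ℂ] V)) ⊗[ℂ] W →ₗ[ℂ] Y ⊗[ℂ] (X ⊗[ℂ] (V ⊗[ℂ] W)) :=
    (TensorProduct.assoc ℂ X V W).toLinearMap.lTensor Y ∘ₗ
      (TensorProduct.assoc ℂ Y (X ⊗[ℂ] V) W).toLinearMap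
  have h1 : ∀ x : V ⊗[ℂ] W, (front f W).lTensor Y (front g W x) =
      Ψ ((f.lTensor Y ∘ₗ g).rTensor W x) := by
    intro x
    induction x with
    | zero => simp
    | add x y hx hy => simp only [map_add, hx, hy]
    | tmul v w =>
      simp [Ψ, front, sum_legs f, sum_legs g, TensorProduct.sum_tmul, TensorProduct.tmul_sum]
  have h2 : ∀ x : V ⊗[ℂ] W,
      TensorProduct.leftComm ℂ X Y _ ((front g W).lTensor X (front f W x)) =
        Ψ (((TensorProduct.leftComm ℂ X Y V).toLinearMap ∘ₗ g.lTensor X ∘ₗ f).rTensor W x) := by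
    intro x
    induction x with
    | zero => simp
    | add x y hx hy => simp only [map_add, hx, hy]
    | tmul v w =>
      simp [Ψ, front, sum_legs f, sum_legs g, TensorProduct.sum_tmul, TensorProduct.tmul_sum]
  rw [h1, h2, h]

theorem behind_lTensor_behind {f : W →ₗ[ℂ] X ⊗[ℂ] W} {g : W →ₗ[ℂ] Y ⊗[ℂ] W} {x : V ⊗[ℂ] W}
    (h : (f.lTensor Y ∘ₗ g).lTensor V x =
      ((TensorProduct.leftComm ℂ X Y W).toLinearMap ∘ₗ g.lTensor X ∘ₗ f).lTensor V x) :
    (behind V f).lTensor Y (behind V g x) =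
      TensorProduct.leftComm ℂ X Y _ ((behind V g).lTensor X (behind V f x)) := by
  let Ψ : V ⊗[ℂ] (Y ⊗[ℂ] (X ⊗[ℂ] W)) →ₗ[ℂ] Y ⊗[ℂ] (X ⊗[ℂ] (V ⊗[ℂ] W)) :=
    (TensorProduct.leftComm ℂ V X W).toLinearMap.lTensor Y ∘ₗ
      (TensorProduct.leftComm ℂ V Y (X ⊗[ℂ] W)).toLinearMap
  have h1 : ∀ x : V ⊗[ℂ] W, (behind V f).lTensor Y (behind V g x) =
      Ψ ((f.lTensor Y ∘ₗ g).lTensor V x) := by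
    intro x
    induction x with
    | zero => simp
    | add x y hx hy => simp only [map_add, hx, hy]
    | tmul v w =>
      simp [Ψ, behind, sum_legs f, sum_legs g, TensorProduct.tmul_sum]
  have h2 : ∀ x : V ⊗[ℂ] W,
      TensorProduct.leftComm ℂ X Y _ ((behind V g).lTensor X (behind V f x)) =
        Ψ (((TensorProduct.leftComm ℂ X Y W).toLinearMap ∘ₗ g.lTensor X ∘ₗ f).lTensor V x) := by
    intro x
    induction x with
    | zero => simp
    | add x y hx hy => simp only [map_add, hx, hy]
    | tmul v w =>
      simp [Ψ, behind, sum_legs f, sum_legs g, TensorProduct.tmul_sum]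
  rw [h1, h2, h]

theorem rTensor_lTensor_apply (f : X →ₗ[ℂ] Y) (g : V →ₗ[ℂ] W) (x : X ⊗[ℂ] V) :
    f.rTensor W (g.lTensor X x) = g.lTensor Y (f.rTensor V x) := by
  rw [← LinearMap.comp_apply, ← LinearMap.comp_apply, LinearMap.rTensor_comp_lTensor,
    LinearMap.lTensor_comp_rTensor]

theorem leftComm_leftComm (x : X ⊗[ℂ] (Y ⊗[ℂ] Z)) :
    TensorProduct.leftComm ℂ Y X Z (TensorProduct.leftComm ℂ X Y Z x) = x := by
  induction x using TensorProduct.induction_on with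
  | zero => simp
  | add x y hx hy => simp only [map_add, hx, hy]
  | tmul x y =>
    induction y using TensorProduct.induction_on with
    | zero => simp
    | add y z hy hz => simp only [TensorProduct.tmul_add, map_add, hy, hz]
    | tmul y z => simp

/-- Identities that hold where two pairs of maps agree, as on triple cotensor products, hold beside
a spectator factor. -/
theorem rTensor_congr_of_eq₂ {f g : W →ₗ[ℂ] U} {f' g' : W →ₗ[ℂ] X} {F G : W →ₗ[ℂ] Z}
    (h : ∀ w, f w = g w → f' w = g' w → F w = G w) {x : W ⊗[ℂ] V}
    (hx : f.rTensor V x = g.rTensor V x) (hx' : f'.rTensor V x = g'.rTensor V x) :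
    F.rTensor V x = G.rTensor V x := by
  apply (TensorProduct.comm ℂ Z V).injective
  rw [comm_rTensor, comm_rTensor]
  refine lTensor_congr (fun w => f w = g w ∧ f' w = g' w) (fun φ => ⟨?_, ?_⟩)
    fun w hw => h w hw.1 hw.2
  · rw [← slice_lTensor, ← slice_lTensor, ← comm_rTensor, ← comm_rTensor, hx]
  · rw [← slice_lTensor, ← slice_lTensor, ← comm_rTensor, ← comm_rTensor, hx']

end LinearAlgebra

/-! ### Products in a bicoalgebroid -/

section Coalgebra

variable {C B : Type*} [AddCommGroup C] [Module ℂ C]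
  [AddCommGroup B] [Module ℂ B] [Coalgebra ℂ B]

/-- `b ↦ f(b⁽²⁾) ⊗ b⁽¹⁾`. -/
def copOut (f : B →ₗ[ℂ] C) : B →ₗ[ℂ] C ⊗[ℂ] B :=
  f.rTensor B ∘ₗ (TensorProduct.comm ℂ B B).toLinearMap ∘ₗ Coalgebra.comul

theorem counit_copOut (f : B →ₗ[ℂ] C) (b : B) :
    TensorProduct.rid ℂ C ((Coalgebra.counit (R := ℂ)).lTensor C (copOut f b)) = f b := by
  have h := congrArg (TensorProduct.lid ℂ C) (congrArg (f.lTensor ℂ)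
    (Coalgebra.rTensor_counit_comul (R := ℂ) b))
  simp [sum_legs (Coalgebra.comul (R := ℂ) (A := B)), copOut] at h ⊢
  exact h

end Coalgebra

section Axioms

variable {C B : Type*} [AddCommGroup C] [Module ℂ C] [Coalgebra ℂ C]
  [AddCommGroup B] [Module ℂ B] [Coalgebra ℂ B]

variable (H : RightBicoalgebroid C B)

theorem comm_right : (TensorProduct.comm ℂ B C).toLinearMap ∘ₗ H.right =
    copOut H.α.toLinearMap := by
  ext b
  simp [BicoalgebroidData.right, baseRight, copOut, sum_legs (Coalgebra.comul (R := ℂ) (A := B))]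

/-- Membership in `B □_C B`, with the middle factor `C` moved to the front. -/
theorem mem_sq_iff {x : B ⊗[ℂ] B} :
    x ∈ H.sq ↔ front (copOut H.α.toLinearMap) B x = behind B (copOut H.β) x := by
  rw [← comm_right]
  exact mem_cotensor_iff

theorem mulE_apply {x : B ⊗[ℂ] B} (hx : x ∈ H.sq) : H.mulE x = H.mul ⟨x, hx⟩ :=
  ext_apply H.mul ⟨x, hx⟩

theorem left_mulE {x : B ⊗[ℂ] B} (hx : x ∈ H.sq) :
    copOut H.β (H.mulE x) = H.mulE.lTensor C (front (copOut H.β) B x) := by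
  rw [mulE_apply H hx]
  exact H.left_mul ⟨x, hx⟩

theorem right_mulE {x : B ⊗[ℂ] B} (hx : x ∈ H.sq) :
    copOut H.α.toLinearMap (H.mulE x) =
      H.mulE.lTensor C (behind B (copOut H.α.toLinearMap) x) := by
  rw [mulE_apply H hx, ← comm_right, LinearMap.comp_apply]
  refine (congrArg (TensorProduct.comm ℂ B C) (H.right_mul ⟨x, hx⟩)).trans ?_
  simp only
  generalize H.right = r
  clear hx
  induction x with
  | zero => simp
  | add x y hx hy => simp only [map_add, hx, hy]
  | tmul v w => simp [behind, sum_legs r, TensorProduct.tmul_sum]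

/-- The product of a tensor in `(B □_C B) ⊗ V` may be computed by any identity on `B □_C B`. -/
theorem rTensor_congr_sq {Z V : Type*} [AddCommGroup Z] [Module ℂ Z] [AddCommGroup V] [Module ℂ V]
    {F G : B ⊗[ℂ] B →ₗ[ℂ] Z} (h : ∀ x ∈ H.sq, F x = G x) {y : (B ⊗[ℂ] B) ⊗[ℂ] V}
    (hy : front (front (copOut H.α.toLinearMap) B) V y = front (behind B (copOut H.β)) V y) :
    F.rTensor V y = G.rTensor V y :=
  rTensor_congr_of_eq (fun w hw => h w ((mem_sq_iff H).2 hw)) (rTensor_eq_of_front hy)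

theorem lTensor_congr_sq {Z V : Type*} [AddCommGroup Z] [Module ℂ Z] [AddCommGroup V] [Module ℂ V]
    {F G : B ⊗[ℂ] B →ₗ[ℂ] Z} (h : ∀ x ∈ H.sq, F x = G x) {y : V ⊗[ℂ] (B ⊗[ℂ] B)}
    (hy : (front (copOut H.α.toLinearMap) B).lTensor V y = (behind B (copOut H.β)).lTensor V y) :
    F.lTensor V y = G.lTensor V y :=
  lTensor_congr_of_eq (fun w hw => h w ((mem_sq_iff H).2 hw)) hy

/-- The two `C`-coactions of `B` commute. -/
theorem copOut_comm : (copOut H.α.toLinearMap).lTensor C ∘ₗ copOut H.β =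
    (TensorProduct.leftComm ℂ C C B).toLinearMap ∘ₗ (copOut H.β).lTensor C ∘ₗ
      copOut H.α.toLinearMap := by
  ext b
  -- both sides are images of `b⁽¹⁾ ⊗ b⁽²⁾ ⊗ b⁽³⁾`, by `α(b⁽²⁾) ⊗ β(b⁽³⁾)` and `α(b⁽³⁾) ⊗ β(b⁽²⁾)`
  let Φ : B ⊗[ℂ] (C ⊗[ℂ] C) →ₗ[ℂ] C ⊗[ℂ] (C ⊗[ℂ] B) :=
    (TensorProduct.leftComm ℂ C C B).toLinearMap ∘ₗ
    (TensorProduct.assoc ℂ C C B).toLinearMap ∘ₗ (TensorProduct.comm ℂ B (C ⊗[ℂ] C)).toLinearMap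
  have h1 := congrArg (Φ ∘ₗ (TensorProduct.map H.α.toLinearMap H.β).lTensor B)
    (Coalgebra.coassoc_apply (R := ℂ) b)
  have h2 := congrArg (Φ ∘ₗ (TensorProduct.map H.α.toLinearMap H.β ∘ₗ
      (TensorProduct.comm ℂ B B).toLinearMap).lTensor B) (Coalgebra.coassoc_apply (R := ℂ) b)
  have h3 := congrArg (fun f : B →ₗ[ℂ] C ⊗[ℂ] C => Φ (f.lTensor B (Coalgebra.comul (R := ℂ) b)))
    (LinearMap.ext H.cocommute :
      TensorProduct.map H.α.toLinearMap H.β ∘ₗ Coalgebra.comul = TensorProduct.map H.α.toLinearMap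
        H.β ∘ₗ (TensorProduct.comm ℂ B B).toLinearMap ∘ₗ Coalgebra.comul)
  simp [Φ, sum_legs (Coalgebra.comul (R := ℂ) (A := B)), copOut, TensorProduct.sum_tmul,
    TensorProduct.tmul_sum] at h1 h2 h3 ⊢
  rw [h1, h2, h3]

theorem counit_mulE {x : B ⊗[ℂ] B} (hx : x ∈ H.sq) :
    Coalgebra.counit (R := ℂ) (H.mulE x) = TensorProduct.lid ℂ ℂ
      (TensorProduct.map (Coalgebra.counit (R := ℂ)) (Coalgebra.counit (R := ℂ)) x) := by
  rw [mulE_apply H hx]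
  exact H.counit_mul ⟨x, hx⟩

/-- `α(b b') = ε(b) α(b')`. -/
theorem α_mulE {x : B ⊗[ℂ] B} (hx : x ∈ H.sq) :
    H.α.toLinearMap (H.mulE x) = TensorProduct.lid ℂ C
      (TensorProduct.map (Coalgebra.counit (R := ℂ)) H.α.toLinearMap x) := by
  have hx' := (mem_sq_iff H).1 hx
  have h1 : (front (copOut H.α.toLinearMap) B).lTensor C (behind B (copOut H.α.toLinearMap) x) =
      (behind B (copOut H.β)).lTensor C (behind B (copOut H.α.toLinearMap) x) := by
    rw [front_lTensor_behind, hx', behind_lTensor_behind (f := copOut H.α.toLinearMap),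
]
    · exact leftComm_leftComm _
    · rw [copOut_comm]
  have h2 := lTensor_congr_sq H (F := (Coalgebra.counit (R := ℂ)) ∘ₗ H.mulE)
    (G := (TensorProduct.lid ℂ ℂ).toLinearMap ∘ₗ TensorProduct.map Coalgebra.counit
      Coalgebra.counit) (fun x hx => counit_mulE H hx) h1
  rw [← counit_copOut H.α.toLinearMap, right_mulE H hx, ← LinearMap.comp_apply,
    ← LinearMap.lTensor_comp, h2]
  clear h2 h1 hx' hx
  induction x with
  | zero => simp
  | add x y hx hy => simp only [map_add, hx, hy]
  | tmul v w =>
    rw [TensorProduct.map_tmul, ← counit_copOut H.α.toLinearMap w]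
    generalize H.α.toLinearMap = a
    simp [behind, sum_legs (copOut a), TensorProduct.tmul_sum, mul_smul]
    exact Finset.sum_congr rfl fun _ _ => smul_comm _ _ _

/-- `β(b b') = β(b) ε(b')`. -/
theorem β_mulE {x : B ⊗[ℂ] B} (hx : x ∈ H.sq) :
    H.β (H.mulE x) = TensorProduct.rid ℂ C
      (TensorProduct.map H.β (Coalgebra.counit (R := ℂ)) x) := by
  have hx' := (mem_sq_iff H).1 hx
  have h1 : (front (copOut H.α.toLinearMap) B).lTensor C (front (copOut H.β) B x) =
      (behind B (copOut H.β)).lTensor C (front (copOut H.β) B x) := by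
    rw [front_lTensor_front, hx', front_lTensor_behind]
    · exact leftComm_leftComm _
    · rw [copOut_comm]
  have h2 := lTensor_congr_sq H (F := (Coalgebra.counit (R := ℂ)) ∘ₗ H.mulE)
    (G := (TensorProduct.lid ℂ ℂ).toLinearMap ∘ₗ TensorProduct.map Coalgebra.counit
      Coalgebra.counit) (fun x hx => counit_mulE H hx) h1
  rw [← counit_copOut H.β, left_mulE H hx, ← LinearMap.comp_apply,
    ← LinearMap.lTensor_comp, h2]
  clear h2 h1 hx' hx
  induction x with
  | zero => simp
  | add x y hx hy => simp only [map_add, hx, hy]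
  | tmul v w =>
    rw [TensorProduct.map_tmul, ← counit_copOut H.β v]
    simp [front, sum_legs (copOut H.β), TensorProduct.sum_tmul, mul_smul]
    exact Finset.sum_congr rfl fun _ _ => smul_comm _ _ _

/-- Cotensor conditions behind a spectator factor, with the middle factor moved to the front. -/
theorem lTensor_viaRight_eq_iff {X Y Z V : Type*} [AddCommGroup X] [Module ℂ X]
    [AddCommGroup Y] [Module ℂ Y] [AddCommGroup Z] [Module ℂ Z] [AddCommGroup V] [Module ℂ V]
    {r : X →ₗ[ℂ] X ⊗[ℂ] Z} {l : Y →ₗ[ℂ] Z ⊗[ℂ] Y} {x : V ⊗[ℂ] (X ⊗[ℂ] Y)} :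
    (viaRight r Y).lTensor V x = (viaLeft X l).lTensor V x ↔
      (front ((TensorProduct.comm ℂ X Z).toLinearMap ∘ₗ r) Y).lTensor V x =
        (behind X l).lTensor V x := by
  constructor
  · exact lTensor_congr_of_eq fun w hw => mem_cotensor_iff.1 hw
  · exact lTensor_congr_of_eq fun w hw => mem_cotensor_iff.2 hw

theorem mulE_assoc {x : B ⊗[ℂ] (B ⊗[ℂ] B)}
    (h1 : front (copOut H.α.toLinearMap) (B ⊗[ℂ] B) x = behind B (front (copOut H.β) B) x)
    (h2 : behind B (front (copOut H.α.toLinearMap) B) x = behind B (behind B (copOut H.β)) x) :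
    H.mulE (H.mulE.lTensor B x) =
      H.mulE (H.mulE.rTensor B ((TensorProduct.assoc ℂ B B B).symm x)) := by
  refine H.mul_assoc x ⟨?_, ?_⟩
  · refine mem_cotensor_iff.2 ?_
    rw [comm_right]
    exact h1
  · refine lTensor_viaRight_eq_iff.2 ?_
    rw [comm_right]
    exact lTensor_eq_of_behind h2

/-! ### Products of coactions -/

variable {E E' T : Type*} [AddCommGroup E] [Module ℂ E] [AddCommGroup E'] [Module ℂ E']
  [AddCommGroup T] [Module ℂ T]

/-- `e ⊗ t ↦ e⁽¹⁾ t⁽¹⁾ ⊗ (e⁽⁰⁾ ⊗ t⁽⁰⁾)`. -/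
def diag (k : E →ₗ[ℂ] B ⊗[ℂ] E) (d : T →ₗ[ℂ] B ⊗[ℂ] T) : E ⊗[ℂ] T →ₗ[ℂ] B ⊗[ℂ] (E ⊗[ℂ] T) :=
  H.mulE.rTensor (E ⊗[ℂ] T) ∘ₗ pair k d

variable {k : E →ₗ[ℂ] B ⊗[ℂ] E} {k' : E' →ₗ[ℂ] B ⊗[ℂ] E'} {d : T →ₗ[ℂ] B ⊗[ℂ] T}
  {r : E →ₗ[ℂ] C ⊗[ℂ] E} {l : T →ₗ[ℂ] C ⊗[ℂ] T}

/-- The legs `e⁽¹⁾` and `t⁽¹⁾` of a tensor in `E □_C T` may be multiplied. -/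
theorem pair_mem_sq {x : E ⊗[ℂ] T}
    (hk : (front (copOut H.α.toLinearMap) E ∘ₗ k).rTensor T x = (k.lTensor C ∘ₗ r).rTensor T x)
    (hd : (front (copOut H.β) T ∘ₗ d).lTensor E x = (d.lTensor C ∘ₗ l).lTensor E x)
    (hx : front r T x = behind E l x) :
    front (front (copOut H.α.toLinearMap) B) (E ⊗[ℂ] T) (pair k d x) =
      front (behind B (copOut H.β)) (E ⊗[ℂ] T) (pair k d x) := by
  rw [front_front_pair hk, front_behind_pair hd, hx]

/-- The product coaction is compatible with the left coaction of the first factor. -/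
theorem front_left_diag {l' : E →ₗ[ℂ] C ⊗[ℂ] E} {x : E ⊗[ℂ] T}
    (hx : front (front (copOut H.α.toLinearMap) B) (E ⊗[ℂ] T) (pair k d x) =
      front (behind B (copOut H.β)) (E ⊗[ℂ] T) (pair k d x))
    (hk : (front (copOut H.β) E ∘ₗ k).rTensor T x = (k.lTensor C ∘ₗ l').rTensor T x) :
    front (copOut H.β) (E ⊗[ℂ] T) (diag H k d x) =
      (diag H k d).lTensor C (front l' T x) := by
  rw [diag, LinearMap.comp_apply, front_rTensor (f' := front (copOut H.β) B),
    front_front_pair hk, LinearMap.lTensor_comp, LinearMap.comp_apply]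
  exact rTensor_congr_sq H (fun x hx => left_mulE H hx) hx

/-- The product coaction is compatible with the right coaction of the last factor. -/
theorem front_right_diag {r' : T →ₗ[ℂ] C ⊗[ℂ] T} {x : E ⊗[ℂ] T}
    (hx : front (front (copOut H.α.toLinearMap) B) (E ⊗[ℂ] T) (pair k d x) =
      front (behind B (copOut H.β)) (E ⊗[ℂ] T) (pair k d x))
    (hd : (front (copOut H.α.toLinearMap) T ∘ₗ d).lTensor E x =
      (d.lTensor C ∘ₗ r').lTensor E x) :
    front (copOut H.α.toLinearMap) (E ⊗[ℂ] T) (diag H k d x) =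
      (diag H k d).lTensor C (behind E r' x) := by
  rw [diag, LinearMap.comp_apply, front_rTensor (f' := behind B (copOut H.α.toLinearMap)),
    front_behind_pair hd, LinearMap.lTensor_comp, LinearMap.comp_apply]
  exact rTensor_congr_sq H (fun x hx => right_mulE H hx) hx

theorem diag_rTensor {g : E →ₗ[ℂ] E'} {x : E ⊗[ℂ] T}
    (h : (k' ∘ₗ g).rTensor T x = (g.lTensor B ∘ₗ k).rTensor T x) :
    diag H k' d (g.rTensor T x) = (g.rTensor T).lTensor B (diag H k d x) := by
  rw [diag, LinearMap.comp_apply, pair_rTensor h, diag, LinearMap.comp_apply,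
    rTensor_lTensor_apply]

theorem diag_lTensor {T' : Type*} [AddCommGroup T'] [Module ℂ T'] {d' : T' →ₗ[ℂ] B ⊗[ℂ] T'}
    {g : T →ₗ[ℂ] T'} {x : E ⊗[ℂ] T}
    (h : (d' ∘ₗ g).lTensor E x = (g.lTensor B ∘ₗ d).lTensor E x) :
    diag H k d' (g.lTensor E x) = (g.lTensor E).lTensor B (diag H k d x) := by
  rw [diag, LinearMap.comp_apply, pair_lTensor h, diag, LinearMap.comp_apply,
    rTensor_lTensor_apply]

/-- Associativity of the product of coactions. -/
theorem diag_assoc {r' l'' : E' →ₗ[ℂ] C ⊗[ℂ] E'} {x : E ⊗[ℂ] (E' ⊗[ℂ] T)}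
    (hk : front (copOut H.α.toLinearMap) E ∘ₗ k = k.lTensor C ∘ₗ r)
    (hk'l : ((front (copOut H.β) E' ∘ₗ k').rTensor T).lTensor E x =
      ((k'.lTensor C ∘ₗ l'').rTensor T).lTensor E x)
    (hk'r : ((front (copOut H.α.toLinearMap) E' ∘ₗ k').rTensor T).lTensor E x =
      ((k'.lTensor C ∘ₗ r').rTensor T).lTensor E x)
    (hd : ((front (copOut H.β) T ∘ₗ d).lTensor E').lTensor E x =
      ((d.lTensor C ∘ₗ l).lTensor E').lTensor E x)
    (h1 : front r (E' ⊗[ℂ] T) x = behind E (front l'' T) x)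
    (h2 : behind E (front r' T) x = behind E (behind E' l) x) :
    (TensorProduct.assoc ℂ E E' T).toLinearMap.lTensor B
        (diag H (diag H k k') d ((TensorProduct.assoc ℂ E E' T).symm x)) =
      diag H k (diag H k' d) x := by
  have e1 : diag H k (diag H k' d) x = (H.mulE ∘ₗ H.mulE.lTensor B).rTensor (E ⊗[ℂ] (E' ⊗[ℂ] T))
      (pair k (pair k' d) x) := by
    rw [diag, diag, LinearMap.comp_apply, pair_rTensor_comp, LinearMap.rTensor_comp,
      LinearMap.comp_apply]
  have e2 : (TensorProduct.assoc ℂ E E' T).toLinearMap.lTensor B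
      (diag H (diag H k k') d ((TensorProduct.assoc ℂ E E' T).symm x)) =
      (H.mulE ∘ₗ H.mulE.rTensor B ∘ₗ
        (TensorProduct.assoc ℂ B B B).symm.toLinearMap).rTensor (E ⊗[ℂ] (E' ⊗[ℂ] T))
      (pair k (pair k' d) x) := by
    rw [diag, diag, LinearMap.comp_apply, pair_comp_rTensor, LinearMap.rTensor_comp,
      LinearMap.rTensor_comp, LinearMap.comp_apply, LinearMap.comp_apply, ← pair_assoc]
    rw [← rTensor_lTensor_apply, ← rTensor_lTensor_apply]
  rw [e1, e2]
  refine (rTensor_congr_of_eq₂ (f := front (copOut H.α.toLinearMap) (B ⊗[ℂ] B))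
    (g := behind B (front (copOut H.β) B)) (f' := behind B (front (copOut H.α.toLinearMap) B))
    (g' := behind B (behind B (copOut H.β)))
    (fun w hw hw' => mulE_assoc H hw hw') (rTensor_eq_of_front ?_) (rTensor_eq_of_front ?_)).symm
  · have q1 : front (front (copOut H.α.toLinearMap) (B ⊗[ℂ] B)) _ (pair k (pair k' d) x) =
        (pair k (pair k' d)).lTensor C (front r (E' ⊗[ℂ] T) x) := front_front_pair (by rw [hk])
    have q2 : front (behind B (front (copOut H.β) B)) _ (pair k (pair k' d) x) =
        (pair k (pair k' d)).lTensor C (behind E (front l'' T) x) := by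
      refine front_behind_pair (lTensor_congr_of_eq
        (f := (front (copOut H.β) E' ∘ₗ k').rTensor T) (g := (k'.lTensor C ∘ₗ l'').rTensor T)
        (fun w hw => ?_) hk'l)
      exact front_front_pair hw
    rw [q1, q2, h1]
  · have q1 : front (behind B (front (copOut H.α.toLinearMap) B)) _ (pair k (pair k' d) x) =
        (pair k (pair k' d)).lTensor C (behind E (front r' T) x) := by
      refine front_behind_pair (lTensor_congr_of_eq
        (f := (front (copOut H.α.toLinearMap) E' ∘ₗ k').rTensor T)
        (g := (k'.lTensor C ∘ₗ r').rTensor T) (fun w hw => ?_) hk'r)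
      exact front_front_pair hw
    have q2 : front (behind B (behind B (copOut H.β))) _ (pair k (pair k' d) x) =
        (pair k (pair k' d)).lTensor C (behind E (behind E' l) x) := by
      refine front_behind_pair (lTensor_congr_of_eq
        (f := (front (copOut H.β) T ∘ₗ d).lTensor E') (g := (d.lTensor C ∘ₗ l).lTensor E')
        (fun w hw => ?_) hd)
      exact front_behind_pair hw
    rw [q1, q2, h2]

end Axioms

/-! ### Unit maps and comodule rings -/

section UnitMap

variable {C B : Type*} [AddCommGroup C] [Module ℂ C] [Coalgebra ℂ C]
  [AddCommGroup B] [Module ℂ B] [Coalgebra ℂ B]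

/-- `η(v[-1]) ⊗ v[0]` lies in `E □_C V`. -/
theorem front_unit {E V : Type*} [AddCommGroup E] [Module ℂ E] [AddCommGroup V] [Module ℂ V]
    {r : E →ₗ[ℂ] C ⊗[ℂ] E} {η : C →ₗ[ℂ] E} {l : V →ₗ[ℂ] C ⊗[ℂ] V}
    (hr : r ∘ₗ η = η.lTensor C ∘ₗ (TensorProduct.comm ℂ C C).toLinearMap ∘ₗ Coalgebra.comul)
    {v : V} (hl : TensorProduct.assoc ℂ C C V ((Coalgebra.comul (R := ℂ)).rTensor V (l v)) =
      l.lTensor C (l v)) :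
    front r V (η.rTensor V (l v)) = behind E l (η.rTensor V (l v)) := by
  have h := congrArg ((TensorProduct.leftComm ℂ E C V).toLinearMap ∘ₗ η.rTensor _) hl
  have h1 : front r V (η.rTensor V (l v)) =
      TensorProduct.assoc ℂ C E V ((r ∘ₗ η).rTensor V (l v)) := by
    rw [front, LinearMap.comp_apply, LinearMap.rTensor_comp]; rfl
  rw [h1, hr]
  simp [behind, sum_legs l, sum_legs (Coalgebra.comul (R := ℂ) (A := C)), TensorProduct.sum_tmul,
    TensorProduct.tmul_sum] at h ⊢
  exact h

variable (H : RightBicoalgebroid C B)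

theorem coassoc_copOut_β (b : B) :
    TensorProduct.assoc ℂ C C B ((Coalgebra.comul (R := ℂ)).rTensor B (copOut H.β b)) =
      (copOut H.β).lTensor C (copOut H.β b) := by
  let Φ : B ⊗[ℂ] (B ⊗[ℂ] B) →ₗ[ℂ] C ⊗[ℂ] (C ⊗[ℂ] B) :=
    (TensorProduct.leftComm ℂ C C B).toLinearMap ∘ₗ (TensorProduct.assoc ℂ C C B).toLinearMap ∘ₗ
      (TensorProduct.comm ℂ B (C ⊗[ℂ] C)).toLinearMap ∘ₗ (TensorProduct.map H.β H.β).lTensor B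
  have h1 := congrArg Φ (Coalgebra.coassoc_apply (R := ℂ) b)
  have h2 : (Coalgebra.comul (R := ℂ)) ∘ₗ H.β = (TensorProduct.comm ℂ C C).toLinearMap ∘ₗ
      TensorProduct.map H.β H.β ∘ₗ Coalgebra.comul := LinearMap.ext H.comul_β
  have h3 : TensorProduct.assoc ℂ C C B ((Coalgebra.comul (R := ℂ)).rTensor B (copOut H.β b)) =
      TensorProduct.assoc ℂ C C B (((Coalgebra.comul (R := ℂ)) ∘ₗ H.β).rTensor B
        (TensorProduct.comm ℂ B B (Coalgebra.comul (R := ℂ) b))) := by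
    rw [LinearMap.rTensor_comp]; rfl
  rw [h3, h2]
  simp [Φ, copOut, sum_legs (Coalgebra.comul (R := ℂ) (A := B)), TensorProduct.sum_tmul,
    TensorProduct.tmul_sum] at h1 ⊢
  exact h1.symm

/-- The unit map is right `C`-colinear. -/
theorem copOut_α_η : copOut H.α.toLinearMap ∘ₗ H.η =
    H.η.lTensor C ∘ₗ (TensorProduct.comm ℂ C C).toLinearMap ∘ₗ Coalgebra.comul := by
  ext c
  rw [← comm_right, LinearMap.comp_apply, LinearMap.comp_apply]
  refine (congrArg (TensorProduct.comm ℂ B C) (H.right_η c)).trans ?_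
  simp [sum_legs (Coalgebra.comul (R := ℂ) (A := C))]

/-- `α(η(β(b⁽²⁾))⁽¹⁾) ⊗ η(β(b⁽²⁾))⁽²⁾ b⁽¹⁾ = β(b⁽¹⁾) ⊗ b⁽²⁾`, which follows from the
Takeuchi-type condition on the product and the unit law. -/
theorem unit_coact (b : B) :
    TensorProduct.map H.α.toLinearMap H.mulE (TensorProduct.assoc ℂ B B B
      (((Coalgebra.comul (R := ℂ)) ∘ₗ H.η).rTensor B (copOut H.β b))) =
      H.β.rTensor B (Coalgebra.comul (R := ℂ) b) := by
  have hx : H.η.rTensor B (copOut H.β b) ∈ H.sq :=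
    (mem_sq_iff H).2 (front_unit (copOut_α_η H) (coassoc_copOut_β H b))
  have h := H.takeuchi _ hx
  rw [LinearMap.rTensor_comp, LinearMap.comp_apply, ← h]
  have hu : H.mulE ∘ₗ H.η.rTensor B ∘ₗ copOut H.β = LinearMap.id := LinearMap.ext H.unit_mul
  have h1 : H.β.rTensor B (Coalgebra.comul (R := ℂ) b) =
      TensorProduct.map H.β (H.mulE ∘ₗ H.η.rTensor B ∘ₗ copOut H.β)
        (Coalgebra.comul (R := ℂ) b) := by rw [hu]; rfl
  rw [h1]
  have h2 := congrArg (TensorProduct.map H.β (H.mulE ∘ₗ (H.η ∘ₗ H.β).rTensor B ∘ₗ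
    (TensorProduct.comm ℂ B B).toLinearMap)) (Coalgebra.coassoc_apply (R := ℂ) b)
  simp [copOut, sum_legs (Coalgebra.comul (R := ℂ) (A := B)), TensorProduct.sum_tmul,
    TensorProduct.tmul_sum] at h2 ⊢
  exact h2

end UnitMap

section Ring

variable {C B : Type*} [AddCommGroup C] [Module ℂ C] [Coalgebra ℂ C]
  [AddCommGroup B] [Module ℂ B] [Coalgebra ℂ B] {H : RightHopfCoalgebra C B}
  {A : Type*} [AddCommGroup A] [Module ℂ A] (R : ComoduleRing H A)

/-- `a ↦ a⁽¹⁾ ⊗ a⁽⁰⁾`. -/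
def out : A →ₗ[ℂ] B ⊗[ℂ] A := (TensorProduct.comm ℂ A B).toLinearMap ∘ₗ R.coact

/-- `a ↦ a[1] ⊗ a[0]`. -/
def rightOut : A →ₗ[ℂ] C ⊗[ℂ] A := (TensorProduct.comm ℂ A C).toLinearMap ∘ₗ R.right

theorem rightOut_eq : rightOut R = H.α.toLinearMap.rTensor A ∘ₗ out R := by
  ext a
  have h := congrArg (TensorProduct.comm ℂ A C) (R.right_eq a)
  refine h.trans ?_
  simp [out, sum_legs R.coact]

theorem left_eq_out : R.left = H.β.rTensor A ∘ₗ out R := by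
  ext a
  rw [R.left_eq]
  simp [out, sum_legs R.coact]

theorem out_coassoc (a : A) :
    TensorProduct.assoc ℂ B B A (((TensorProduct.comm ℂ B B).toLinearMap ∘ₗ
      Coalgebra.comul).rTensor A (out R a)) = (out R).lTensor B (out R a) := by
  let Φ : A ⊗[ℂ] (B ⊗[ℂ] B) →ₗ[ℂ] B ⊗[ℂ] (B ⊗[ℂ] A) :=
    (TensorProduct.leftComm ℂ B B A).toLinearMap ∘ₗ (TensorProduct.assoc ℂ B B A).toLinearMap ∘ₗ
      (TensorProduct.comm ℂ A (B ⊗[ℂ] B)).toLinearMap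
  have h := congrArg Φ (R.isRightCoaction_coact.coassoc a)
  simp [Φ, out, sum_legs R.coact, sum_legs (Coalgebra.comul (R := ℂ) (A := B)),
    TensorProduct.sum_tmul, TensorProduct.tmul_sum] at h ⊢
  exact h.symm

/-- The `C`-coaction of `a⁽¹⁾` along its last leg is a `C`-coaction of `a`. -/
theorem front_copOut_out (f : B →ₗ[ℂ] C) :
    front (copOut f) A ∘ₗ out R = (out R).lTensor C ∘ₗ f.rTensor A ∘ₗ out R := by
  ext a
  have h := congrArg (f.rTensor _) (out_coassoc R a)
  simp [front, copOut, sum_legs (out R), sum_legs (Coalgebra.comul (R := ℂ) (A := B)),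
    TensorProduct.sum_tmul, TensorProduct.tmul_sum] at h ⊢
  exact h

theorem front_right_out :
    front (copOut H.α.toLinearMap) A ∘ₗ out R = (out R).lTensor C ∘ₗ rightOut R := by
  rw [front_copOut_out, rightOut_eq]

theorem front_left_out : front (copOut H.β) A ∘ₗ out R = (out R).lTensor C ∘ₗ R.left := by
  rw [front_copOut_out, left_eq_out]

/-- `a ↦ η(a[-1]) ⊗ a[0]`. -/
def split : A →ₗ[ℂ] A ⊗[ℂ] A := R.η.rTensor A ∘ₗ R.left

theorem rightOut_η : rightOut R ∘ₗ R.η =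
    R.η.lTensor C ∘ₗ (TensorProduct.comm ℂ C C).toLinearMap ∘ₗ Coalgebra.comul := by
  ext c
  refine (congrArg (TensorProduct.comm ℂ A C) (R.right_η c)).trans ?_
  simp [sum_legs (Coalgebra.comul (R := ℂ) (A := C))]

/-- The tensor `η(a[-1]) ⊗ a[0]` lies in `A □_C A`. -/
theorem front_split (a : A) : front (rightOut R) A (split R a) = behind A R.left (split R a) :=
  front_unit (rightOut_η R) (R.isLeftCoaction_left.coassoc a)

theorem out_η (c : C) : out R (R.η c) = (R.η ∘ₗ H.α.toLinearMap).lTensor B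
    (TensorProduct.comm ℂ B B (Coalgebra.comul (R := ℂ) (H.η c))) := by
  refine (congrArg (TensorProduct.comm ℂ A B) (R.coact_η c)).trans ?_
  simp [sum_legs (Coalgebra.comul (R := ℂ) (A := B))]

/-- `a ↦ η(a[-1]) ⊗ a[0]` is `B`-colinear. -/
theorem diag_split (a : A) :
    diag H.toRightBicoalgebroid (out R) (out R) (split R a) = (split R).lTensor B (out R a) := by
  -- `f` sends `c ⊗ b` to `η(c)⁽²⁾ b ⊗ η_A(α(η(c)⁽¹⁾))`
  let f : C ⊗[ℂ] B →ₗ[ℂ] C ⊗[ℂ] B :=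
    TensorProduct.map H.α.toLinearMap H.mulE ∘ₗ (TensorProduct.assoc ℂ B B B).toLinearMap ∘ₗ
      ((Coalgebra.comul (R := ℂ)) ∘ₗ H.η).rTensor B
  have hf : f ∘ₗ copOut H.β = H.β.rTensor B ∘ₗ Coalgebra.comul :=
    LinearMap.ext (unit_coact H.toRightBicoalgebroid)
  let Φ : (C ⊗[ℂ] B) ⊗[ℂ] A →ₗ[ℂ] B ⊗[ℂ] (A ⊗[ℂ] A) :=
    (TensorProduct.assoc ℂ B A A).toLinearMap ∘ₗ
      ((TensorProduct.comm ℂ A B).toLinearMap ∘ₗ R.η.rTensor B).rTensor A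
  have h1 : ∀ z : C ⊗[ℂ] A,
      diag H.toRightBicoalgebroid (out R) (out R) (R.η.rTensor A z) =
        Φ (f.rTensor A ((TensorProduct.assoc ℂ C B A).symm ((out R).lTensor C z))) := by
    intro z
    induction z with
    | zero => simp
    | add x y hx hy => simp only [map_add, hx, hy]
    | tmul c a =>
      simp only [diag, pair, LinearMap.comp_apply, LinearMap.rTensor_tmul, TensorProduct.map_tmul,
        out_η]
      simp [Φ, f, sum_legs (out R), sum_legs (Coalgebra.comul (R := ℂ) (A := B)),
        TensorProduct.sum_tmul, TensorProduct.tmul_sum]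
  have h2 : (TensorProduct.assoc ℂ C B A).symm ((out R).lTensor C (R.left a)) =
      (copOut H.β).rTensor A (out R a) := by
    rw [LinearEquiv.symm_apply_eq, ← LinearMap.comp_apply, ← front_left_out]
    rfl
  rw [split, LinearMap.comp_apply, h1, h2, ← LinearMap.comp_apply (f.rTensor A),
    ← LinearMap.rTensor_comp, hf]
  have h3 := congrArg (((R.η ∘ₗ H.β).rTensor A).lTensor B) (out_coassoc R a)
  rw [left_eq_out]
  simp [Φ, sum_legs (out R), sum_legs (Coalgebra.comul (R := ℂ) (A := B)),
        TensorProduct.sum_tmul, TensorProduct.tmul_sum] at h3 ⊢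
  exact h3

theorem ring_mulE_apply {x : A ⊗[ℂ] A} (hx : x ∈ cotensor R.right R.left) :
    R.mulE x = R.mul ⟨x, hx⟩ :=
  ext_apply R.mul ⟨x, hx⟩

/-- The multiplication is `B`-colinear. -/
theorem out_mulE {x : A ⊗[ℂ] A} (hx : front (rightOut R) A x = behind A R.left x) :
    out R (R.mulE x) =
      R.mulE.lTensor B (diag H.toRightBicoalgebroid (out R) (out R) x) := by
  have hx' : x ∈ cotensor R.right R.left := mem_cotensor_iff.2 hx
  rw [ring_mulE_apply R hx']
  refine (congrArg (TensorProduct.comm ℂ A B) (R.coact_mul ⟨x, hx'⟩)).trans ?_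
  simp only
  clear hx hx'
  induction x with
  | zero => simp
  | add x y hx hy => simp only [map_add, hx, hy]
  | tmul v w =>
    simp [diag, pair, out, sum_legs R.coact, TensorProduct.sum_tmul, TensorProduct.tmul_sum]

theorem ring_left_mulE {x : A ⊗[ℂ] A} (hx : front (rightOut R) A x = behind A R.left x) :
    R.left (R.mulE x) = R.mulE.lTensor C (front R.left A x) := by
  have hx' : x ∈ cotensor R.right R.left := mem_cotensor_iff.2 hx
  rw [ring_mulE_apply R hx']
  exact R.left_mul ⟨x, hx'⟩

theorem ring_right_mulE {x : A ⊗[ℂ] A} (hx : front (rightOut R) A x = behind A R.left x) :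
    rightOut R (R.mulE x) = R.mulE.lTensor C (behind A (rightOut R) x) := by
  have hx' : x ∈ cotensor R.right R.left := mem_cotensor_iff.2 hx
  rw [ring_mulE_apply R hx']
  refine (congrArg (TensorProduct.comm ℂ A C) (R.right_mul ⟨x, hx'⟩)).trans ?_
  simp only
  clear hx hx'
  induction x with
  | zero => simp
  | add x y hx hy => simp only [map_add, hx, hy]
  | tmul v w => simp [behind, rightOut, CRing.mulE, sum_legs R.right, TensorProduct.tmul_sum]

end Ring

/-! ### Recursion for words, and the compatibility of the diagonal coaction with the base -/

section Words

variable {C B : Type*} [AddCommGroup C] [Module ℂ C] [Coalgebra ℂ C]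
  [AddCommGroup B] [Module ℂ B] [Coalgebra ℂ B] {H : RightHopfCoalgebra C B}
  {A M : Type u} [AddCommGroup A] [Module ℂ A] [AddCommGroup M] [Module ℂ M]
  {Z : Type*} [AddCommGroup Z] [Module ℂ Z]

-- `TW A M (n + 1)` and `A ⊗ TW A M n` are equal by definition, and `TW.succ` is the identity
theorem lTensor_succ_symm (n : ℕ) (z : Z ⊗[ℂ] (A ⊗[ℂ] TW A M n)) :
    (TW.succ A M n).symm.toLinearMap.lTensor Z z = z :=
  LinearMap.congr_fun (LinearMap.lTensor_id Z (A ⊗[ℂ] TW A M n)) z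

theorem lTensor_succ (n : ℕ) (z : Z ⊗[ℂ] TW A M (n + 1)) :
    (TW.succ A M n).toLinearMap.lTensor Z z = z :=
  LinearMap.congr_fun (LinearMap.lTensor_id Z (A ⊗[ℂ] TW A M n))
    (show Z ⊗[ℂ] (A ⊗[ℂ] TW A M n) from z)

theorem lTensor_zero_symm (z : Z ⊗[ℂ] M) :
    (TW.zero A M).symm.toLinearMap.lTensor Z z = z :=
  LinearMap.congr_fun (LinearMap.lTensor_id Z M) z

theorem coactAt_zero (k : A →ₗ[ℂ] Z ⊗[ℂ] A) (n : ℕ) :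
    coactAt (M := M) k (n + 1) 0 = front k (TW A M n) :=
  LinearMap.ext fun x => lTensor_succ_symm n (front k (TW A M n) x)

theorem coactAt_succ (k : A →ₗ[ℂ] Z ⊗[ℂ] A) (n : ℕ) (i : Fin n) :
    coactAt (M := M) k (n + 1) i.succ = behind A (coactAt k n i) :=
  LinearMap.ext fun x => lTensor_succ_symm n (behind A (coactAt k n i) x)

theorem coactLast_zero (k : M →ₗ[ℂ] Z ⊗[ℂ] M) : coactLast (A := A) k 0 = k :=
  LinearMap.ext fun x => lTensor_zero_symm (k x)

theorem coactLast_succ (k : M →ₗ[ℂ] Z ⊗[ℂ] M) (n : ℕ) :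
    coactLast (A := A) k (n + 1) = behind A (coactLast k n) :=
  LinearMap.ext fun x => lTensor_succ_symm n (behind A (coactLast k n) x)

variable (R : ComoduleRing H A) (S : SAYDModule H M)

theorem coactDiag_zero : coactDiag (M := M) R 0 = front (out R) (TW A M 0) :=
  coactAt_zero _ _

theorem coactDiag_succ (n : ℕ) :
    coactDiag (M := M) R (n + 1) = diag H.toRightBicoalgebroid (out R) (coactDiag R n) :=
  LinearMap.ext fun x => lTensor_succ_symm (n + 1)
    (diag H.toRightBicoalgebroid (out R) (coactDiag R n) x)

theorem faceAt_zero (n : ℕ) : faceAt (M := M) R (n + 1) 0 =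
    (TensorProduct.assoc ℂ A A (TW A M n)).toLinearMap ∘ₗ (split R).rTensor (TW A M n) :=
  LinearMap.ext fun x => lTensor_succ_symm n
    (TensorProduct.assoc ℂ A A (TW A M n) ((split R).rTensor (TW A M n) x))

theorem faceAt_succ (n : ℕ) (i : Fin n) :
    faceAt (M := M) R (n + 1) i.succ = (faceAt R n i).lTensor A := rfl

theorem degeneracyAt_zero (n : ℕ) : degeneracyAt (M := M) R (n + 1) 0 =
    R.mulE.rTensor (TW A M n) ∘ₗ (TensorProduct.assoc ℂ A A (TW A M n)).symm.toLinearMap :=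
  LinearMap.ext fun x => congrArg (fun z => R.mulE.rTensor (TW A M n)
    ((TensorProduct.assoc ℂ A A (TW A M n)).symm z)) (lTensor_succ n x)

theorem degeneracyAt_succ (n : ℕ) (i : Fin n) :
    degeneracyAt (M := M) R (n + 1) i.succ = (degeneracyAt R n i).lTensor A := rfl

/-- The subspace `A^{□_C (n+1)} ⊗ M` of `A^{⊗ (n+1)} ⊗ M`. -/
def chain (M : Type u) [AddCommGroup M] [Module ℂ M] (R : ComoduleRing H A) (n : ℕ) :
    Submodule ℂ (TW A M (n + 1)) :=
  ⨅ i : Fin n, LinearMap.eqLocus (coactAt (M := M) (rightOut R) (n + 1) i.castSucc)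
    (coactAt (M := M) R.left (n + 1) i.succ)

theorem mem_cochains_iff {n : ℕ} {x : TW A M (n + 1)} : x ∈ cochains R S n ↔
    x ∈ chain M R n ∧ coactDiag R n x = coactLast S.coact (n + 1) x := Iff.rfl

theorem mem_chain_iff {n : ℕ} {x : TW A M (n + 1)} : x ∈ chain M R n ↔
    ∀ i : Fin n, coactAt (rightOut R) (n + 1) i.castSucc x = coactAt R.left (n + 1) i.succ x := by
  simp only [chain, Submodule.mem_iInf, LinearMap.mem_eqLocus]

theorem mem_chain_zero (x : TW A M 1) : x ∈ chain M R 0 :=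
  (mem_chain_iff R).2 fun i => i.elim0

/-- A tensor lies in `A^{□_C (n+2)} ⊗ M` when its first two factors satisfy the cotensor condition
and its slices lie in `A^{□_C (n+1)} ⊗ M`; this makes inductions on the number of factors possible.
-/
theorem mem_chain_succ {n : ℕ} {x : A ⊗[ℂ] TW A M (n + 1)} :
    (show TW A M (n + 2) from x) ∈ chain M R (n + 1) ↔
      front (rightOut R) (TW A M (n + 1)) x = behind A (front R.left (TW A M n)) x ∧
      ∀ φ : A →ₗ[ℂ] ℂ, slice φ (TW A M (n + 1)) x ∈ chain M R n := by
  rw [mem_chain_iff]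
  constructor
  · intro h
    refine ⟨?_, fun φ => (mem_chain_iff R).2 fun i => ?_⟩
    · have := h 0
      rwa [Fin.castSucc_zero, coactAt_zero, coactAt_succ, coactAt_zero] at this
    · rw [← slice_lTensor, ← slice_lTensor]
      refine congrArg _ (lTensor_eq_of_behind ?_)
      have := h i.succ
      rwa [Fin.castSucc_succ, coactAt_succ, coactAt_succ] at this
  · rintro ⟨h0, h⟩ i
    refine Fin.cases ?_ (fun i => ?_) i
    · rwa [Fin.castSucc_zero, coactAt_zero, coactAt_succ, coactAt_zero]
    · rw [Fin.castSucc_succ, coactAt_succ, coactAt_succ]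
      exact behind_congr (lTensor_congr (· ∈ chain M R n) h
        fun w hw => (mem_chain_iff R).1 hw i)

variable {R}

/-- On `A^{□_C (n+1)} ⊗ M` the diagonal coaction is compatible with the left coaction of the first
factor. -/
theorem front_left_coactDiag {n : ℕ} {x : TW A M (n + 1)} (hx : x ∈ chain M R n) :
    front (copOut H.β) (TW A M (n + 1)) (coactDiag R n x) =
      (coactDiag R n).lTensor C (front R.left (TW A M n) x) := by
  induction n with
  | zero =>
    rw [coactDiag_zero]
    exact front_front (by rw [front_left_out])
  | succ n ih =>
    obtain ⟨h0, h⟩ := (mem_chain_succ R).1 hx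
    rw [coactDiag_succ]
    refine front_left_diag _ (pair_mem_sq _ (by rw [front_right_out]) ?_ h0)
      (by rw [front_left_out])
    exact lTensor_congr (· ∈ chain M R n) h fun w hw => ih hw

/-- On `A^{□_C (n+2)} ⊗ M` the product `a₀⁽¹⁾ (a₁⁽¹⁾ ⋯)` in the diagonal coaction is formed in
`B □_C B`. -/
theorem pair_coactDiag_mem_sq {n : ℕ} {x : A ⊗[ℂ] TW A M (n + 1)}
    (hx : (show TW A M (n + 2) from x) ∈ chain M R (n + 1)) :
    front (front (copOut H.α.toLinearMap) B) _ (pair (out R) (coactDiag R n) x) =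
      front (behind B (copOut H.β)) _ (pair (out R) (coactDiag R n) x) := by
  obtain ⟨h0, h⟩ := (mem_chain_succ R).1 hx
  refine pair_mem_sq H.toRightBicoalgebroid (by rw [front_right_out]) ?_ h0
  exact lTensor_congr (· ∈ chain M R n) h fun w hw => front_left_coactDiag hw

/-- On `A^{□_C (n+1)} ⊗ M` the diagonal coaction is compatible with the right coaction of the last
factor `A`. -/
theorem front_right_coactDiag {n : ℕ} {x : TW A M (n + 1)} (hx : x ∈ chain M R n) :
    front (copOut H.α.toLinearMap) (TW A M (n + 1)) (coactDiag R n x) =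
      (coactDiag R n).lTensor C (coactAt (rightOut R) (n + 1) (Fin.last n) x) := by
  induction n with
  | zero =>
    rw [coactDiag_zero, Fin.last_zero, coactAt_zero]
    exact front_front (by rw [front_right_out])
  | succ n ih =>
    obtain ⟨h0, h⟩ := (mem_chain_succ R).1 hx
    rw [coactDiag_succ, ← Fin.succ_last, coactAt_succ]
    refine front_right_diag _ (pair_coactDiag_mem_sq hx) ?_
    exact lTensor_congr (· ∈ chain M R n) h fun w hw => ih hw

end Words

/-! ### Source, target and counit of the diagonal coaction -/

section LinearAlgebra

variable {X Y Z V W U T : Type*} [AddCommGroup X] [Module ℂ X] [AddCommGroup Y] [Module ℂ Y]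
  [AddCommGroup Z] [Module ℂ Z] [AddCommGroup V] [Module ℂ V] [AddCommGroup W] [Module ℂ W]
  [AddCommGroup U] [Module ℂ U] [AddCommGroup T] [Module ℂ T]

theorem rTensor_front (f : X →ₗ[ℂ] Y) (k : V →ₗ[ℂ] X ⊗[ℂ] V) (x : V ⊗[ℂ] W) :
    f.rTensor _ (front k W x) = front (f.rTensor V ∘ₗ k) W x := by
  induction x with
  | zero => simp
  | add x y hx hy => simp only [map_add, hx, hy]
  | tmul v w => simp [front, sum_legs k, TensorProduct.sum_tmul]

theorem rTensor_behind (f : X →ₗ[ℂ] Y) (k : W →ₗ[ℂ] X ⊗[ℂ] W) (x : V ⊗[ℂ] W) :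
    f.rTensor _ (behind V k x) = behind V (f.rTensor W ∘ₗ k) x := by
  induction x with
  | zero => simp
  | add x y hx hy => simp only [map_add, hx, hy]
  | tmul v w => simp [behind, sum_legs k, TensorProduct.tmul_sum]

theorem front_assoc (f : V →ₗ[ℂ] Z ⊗[ℂ] V) (x : (V ⊗[ℂ] W) ⊗[ℂ] T) :
    front f (W ⊗[ℂ] T) (TensorProduct.assoc ℂ V W T x) =
      (TensorProduct.assoc ℂ V W T).toLinearMap.lTensor Z (front (front f W) T x) := by
  induction x using TensorProduct.induction_on with
  | zero => simp
  | add x y hx hy => simp only [map_add, hx, hy]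
  | tmul y t =>
    induction y using TensorProduct.induction_on with
    | zero => simp
    | add y z hy hz => simp only [TensorProduct.add_tmul, map_add, hy, hz]
    | tmul v w => simp [front, sum_legs f, TensorProduct.sum_tmul]

theorem behind_front_assoc (f : W →ₗ[ℂ] Z ⊗[ℂ] W) (x : (V ⊗[ℂ] W) ⊗[ℂ] T) :
    behind V (front f T) (TensorProduct.assoc ℂ V W T x) =
      (TensorProduct.assoc ℂ V W T).toLinearMap.lTensor Z (front (behind V f) T x) := by
  induction x using TensorProduct.induction_on with
  | zero => simp
  | add x y hx hy => simp only [map_add, hx, hy]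
  | tmul y t =>
    induction y using TensorProduct.induction_on with
    | zero => simp
    | add y z hy hz => simp only [TensorProduct.add_tmul, map_add, hy, hz]
    | tmul v w =>
      simp [front, behind, sum_legs f, TensorProduct.sum_tmul, TensorProduct.tmul_sum]

theorem behind_behind_assoc (f : T →ₗ[ℂ] Z ⊗[ℂ] T) (x : (V ⊗[ℂ] W) ⊗[ℂ] T) :
    behind V (behind W f) (TensorProduct.assoc ℂ V W T x) =
      (TensorProduct.assoc ℂ V W T).toLinearMap.lTensor Z (behind (V ⊗[ℂ] W) f x) := by
  induction x using TensorProduct.induction_on with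
  | zero => simp
  | add x y hx hy => simp only [map_add, hx, hy]
  | tmul y t =>
    induction y using TensorProduct.induction_on with
    | zero => simp
    | add y z hy hz => simp only [TensorProduct.add_tmul, map_add, hy, hz]
    | tmul v w => simp [behind, sum_legs f, TensorProduct.tmul_sum]

theorem pair_front_assoc (k : V →ₗ[ℂ] X ⊗[ℂ] V) (d : W →ₗ[ℂ] Y ⊗[ℂ] W)
    (x : (V ⊗[ℂ] W) ⊗[ℂ] T) :
    pair k (front d T) (TensorProduct.assoc ℂ V W T x) =
      (TensorProduct.assoc ℂ V W T).toLinearMap.lTensor (X ⊗[ℂ] Y) (front (pair k d) T x) := by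
  induction x using TensorProduct.induction_on with
  | zero => simp
  | add x y hx hy => simp only [map_add, hx, hy]
  | tmul y t =>
    induction y using TensorProduct.induction_on with
    | zero => simp
    | add y z hy hz => simp only [TensorProduct.add_tmul, map_add, hy, hz]
    | tmul v w =>
      simp [front, pair, sum_legs k, sum_legs d, TensorProduct.sum_tmul, TensorProduct.tmul_sum]

/-- All slices of a tensor lie in `S` exactly when it lies in the kernel `V ⊗ S` of
`V ⊗ W → V ⊗ (W / S)`. -/
theorem slice_mem_iff {S : Submodule ℂ W} {x : V ⊗[ℂ] W} :
    (∀ φ : V →ₗ[ℂ] ℂ, slice φ W x ∈ S) ↔ S.mkQ.lTensor V x = 0 := by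
  constructor
  · intro h
    have := lTensor_congr (F := S.mkQ) (G := 0) (· ∈ S) h
      fun w hw => (Submodule.Quotient.mk_eq_zero S).2 hw
    simpa using this
  · intro h φ
    rw [← Submodule.Quotient.mk_eq_zero S, ← Submodule.mkQ_apply, ← slice_lTensor, h, map_zero]

/-- Slices of a tensor in `V ⊗ (W ⊗ S)` by functionals on `V ⊗ W` lie in `S`. -/
theorem slice_assoc_symm_mem {S : Submodule ℂ T} {x : V ⊗[ℂ] (W ⊗[ℂ] T)}
    (h : ∀ (φ : V →ₗ[ℂ] ℂ) (ψ : W →ₗ[ℂ] ℂ), slice ψ T (slice φ (W ⊗[ℂ] T) x) ∈ S)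
    (φ : V ⊗[ℂ] W →ₗ[ℂ] ℂ) :
    slice φ T ((TensorProduct.assoc ℂ V W T).symm x) ∈ S := by
  refine slice_mem_iff.2 ?_ φ
  have h1 : (S.mkQ.lTensor W).lTensor V x = 0 := by
    have := lTensor_congr (F := S.mkQ.lTensor W) (G := 0) (x := x)
      (fun y => ∀ ψ : W →ₗ[ℂ] ℂ, slice ψ T y ∈ S) h fun w hw => slice_mem_iff.1 hw
    simpa using this
  have h2 : S.mkQ.lTensor (V ⊗[ℂ] W) ((TensorProduct.assoc ℂ V W T).symm x) =
      (TensorProduct.assoc ℂ V W _).symm ((S.mkQ.lTensor W).lTensor V x) := by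
    clear h1 h
    induction x using TensorProduct.induction_on with
    | zero => simp
    | add x y hx hy => simp only [map_add, hx, hy]
    | tmul v y =>
      induction y using TensorProduct.induction_on with
      | zero => simp
      | add y z hy hz => simp only [TensorProduct.tmul_add, map_add, hy, hz]
      | tmul w t => simp
  rw [h2, h1, map_zero]

theorem slice_rTensor (φ : U →ₗ[ℂ] ℂ) (g : V →ₗ[ℂ] U) (x : V ⊗[ℂ] W) :
    slice φ W (g.rTensor W x) = slice (φ ∘ₗ g) W x := by
  rw [slice, slice, LinearMap.rTensor_comp]; rfl

theorem slice_assoc (φ : V →ₗ[ℂ] ℂ) (x : (V ⊗[ℂ] W) ⊗[ℂ] T) :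
    slice φ (W ⊗[ℂ] T) (TensorProduct.assoc ℂ V W T x) = (slice φ W).rTensor T x := by
  induction x using TensorProduct.induction_on with
  | zero => simp
  | add x y hx hy => simp only [map_add, hx, hy]
  | tmul y t =>
    induction y using TensorProduct.induction_on with
    | zero => simp
    | add y z hy hz => simp only [TensorProduct.add_tmul, map_add, hy, hz]
    | tmul v w => simp [slice, TensorProduct.smul_tmul']

end LinearAlgebra

section Counits

variable {C B : Type*} [AddCommGroup C] [Module ℂ C]
  [AddCommGroup B] [Module ℂ B] [Coalgebra ℂ B]
  {E T : Type*} [AddCommGroup E] [Module ℂ E] [AddCommGroup T] [Module ℂ T]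

/-- `d ↦ ε(d[-1]) d[0]`. -/
def counitOut (d : T →ₗ[ℂ] B ⊗[ℂ] T) : T →ₗ[ℂ] T :=
  (TensorProduct.lid ℂ T).toLinearMap ∘ₗ (Coalgebra.counit (R := ℂ)).rTensor T ∘ₗ d

theorem counit_left_pair (k : E →ₗ[ℂ] B ⊗[ℂ] E) (d : T →ₗ[ℂ] B ⊗[ℂ] T) (f : B →ₗ[ℂ] C)
    (x : E ⊗[ℂ] T) :
    ((TensorProduct.lid ℂ C).toLinearMap ∘ₗ
      TensorProduct.map (Coalgebra.counit (R := ℂ)) f).rTensor (E ⊗[ℂ] T) (pair k d x) =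
      behind E (f.rTensor T ∘ₗ d) ((counitOut k).rTensor T x) := by
  induction x with
  | zero => simp
  | add x y hx hy => simp only [map_add, hx, hy]
  | tmul e t =>
    simp [pair, behind, counitOut, sum_legs k, sum_legs d, TensorProduct.sum_tmul,
      TensorProduct.tmul_sum, ← TensorProduct.smul_tmul']
    simp only [Finset.sum_comm (t := legs k e), Finset.smul_sum]

theorem counit_right_pair (k : E →ₗ[ℂ] B ⊗[ℂ] E) (d : T →ₗ[ℂ] B ⊗[ℂ] T) (f : B →ₗ[ℂ] C)
    (x : E ⊗[ℂ] T) :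
    ((TensorProduct.rid ℂ C).toLinearMap ∘ₗ
      TensorProduct.map f (Coalgebra.counit (R := ℂ))).rTensor (E ⊗[ℂ] T) (pair k d x) =
      front (f.rTensor E ∘ₗ k) T ((counitOut d).lTensor E x) := by
  induction x with
  | zero => simp
  | add x y hx hy => simp only [map_add, hx, hy]
  | tmul e t =>
    simp [pair, front, counitOut, sum_legs k, sum_legs d, TensorProduct.sum_tmul,
      TensorProduct.tmul_sum, ← TensorProduct.smul_tmul']
    simp only [Finset.sum_comm (t := legs k e), Finset.smul_sum]

theorem counitOut_front (k : E →ₗ[ℂ] B ⊗[ℂ] E) :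
    counitOut (front k T) = (counitOut k).rTensor T := by
  ext e t
  simp [counitOut, front, sum_legs k, TensorProduct.sum_tmul, TensorProduct.smul_tmul']

theorem lid_behind (d : T →ₗ[ℂ] ℂ ⊗[ℂ] T) (x : E ⊗[ℂ] T) :
    TensorProduct.lid ℂ _ (behind E d x) =
      ((TensorProduct.lid ℂ T).toLinearMap ∘ₗ d).lTensor E x := by
  induction x with
  | zero => simp
  | add x y hx hy => simp only [map_add, hx, hy]
  | tmul e t => simp [behind, sum_legs d, TensorProduct.tmul_sum]

theorem counitOut_eq (d : T →ₗ[ℂ] B ⊗[ℂ] T) (t : T) :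
    counitOut d t = TensorProduct.lid ℂ T ((Coalgebra.counit (R := ℂ)).rTensor T (d t)) := rfl

end Counits

section Diag

variable {C B : Type*} [AddCommGroup C] [Module ℂ C] [Coalgebra ℂ C]
  [AddCommGroup B] [Module ℂ B] [Coalgebra ℂ B] (H : RightBicoalgebroid C B)
  {E T : Type*} [AddCommGroup E] [Module ℂ E] [AddCommGroup T] [Module ℂ T]
  {k : E →ₗ[ℂ] B ⊗[ℂ] E} {d : T →ₗ[ℂ] B ⊗[ℂ] T} {x : E ⊗[ℂ] T}

theorem counitOut_diag
    (hx : front (front (copOut H.α.toLinearMap) B) (E ⊗[ℂ] T) (pair k d x) =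
      front (behind B (copOut H.β)) (E ⊗[ℂ] T) (pair k d x))
    (hk : counitOut k = LinearMap.id) (hd : (counitOut d).lTensor E x = x) :
    counitOut (diag H k d) x = x := by
  have h1 := rTensor_congr_sq H (F := Coalgebra.counit (R := ℂ) ∘ₗ H.mulE)
    (G := (TensorProduct.lid ℂ ℂ).toLinearMap ∘ₗ
      TensorProduct.map (Coalgebra.counit (R := ℂ)) (Coalgebra.counit (R := ℂ)))
    (fun x hx => counit_mulE H hx) hx
  rw [counit_left_pair, hk, LinearMap.rTensor_id, LinearMap.rTensor_comp] at h1
  rw [counitOut_eq]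
  refine (congrArg (TensorProduct.lid ℂ _) h1).trans ?_
  rw [lid_behind]
  exact hd

/-- The source of a product coaction sees only the second factor. -/
theorem α_diag
    (hx : front (front (copOut H.α.toLinearMap) B) (E ⊗[ℂ] T) (pair k d x) =
      front (behind B (copOut H.β)) (E ⊗[ℂ] T) (pair k d x))
    (hk : counitOut k = LinearMap.id) :
    H.α.toLinearMap.rTensor _ (diag H k d x) = behind E (H.α.toLinearMap.rTensor T ∘ₗ d) x := by
  have h1 := rTensor_congr_sq H (F := H.α.toLinearMap ∘ₗ H.mulE)
    (G := (TensorProduct.lid ℂ C).toLinearMap ∘ₗ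
      TensorProduct.map (Coalgebra.counit (R := ℂ)) H.α.toLinearMap)
    (fun x hx => α_mulE H hx) hx
  rwa [counit_left_pair, hk, LinearMap.rTensor_id, LinearMap.rTensor_comp] at h1

/-- The target of a product coaction sees only the first factor. -/
theorem β_diag
    (hx : front (front (copOut H.α.toLinearMap) B) (E ⊗[ℂ] T) (pair k d x) =
      front (behind B (copOut H.β)) (E ⊗[ℂ] T) (pair k d x))
    (hd : (counitOut d).lTensor E x = x) :
    H.β.rTensor _ (diag H k d x) = front (H.β.rTensor E ∘ₗ k) T x := by
  have h1 := rTensor_congr_sq H (F := H.β ∘ₗ H.mulE)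
    (G := (TensorProduct.rid ℂ C).toLinearMap ∘ₗ
      TensorProduct.map H.β (Coalgebra.counit (R := ℂ)))
    (fun x hx => β_mulE H hx) hx
  rwa [counit_right_pair, hd, LinearMap.rTensor_comp] at h1

end Diag

section Words

variable {C B : Type*} [AddCommGroup C] [Module ℂ C] [Coalgebra ℂ C]
  [AddCommGroup B] [Module ℂ B] [Coalgebra ℂ B] {H : RightHopfCoalgebra C B}
  {A M : Type u} [AddCommGroup A] [Module ℂ A] [AddCommGroup M] [Module ℂ M]
  {Z : Type*} [AddCommGroup Z] [Module ℂ Z]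
  {R : ComoduleRing H A} {S : SAYDModule H M}

variable (R) in
theorem counitOut_out : counitOut (out R) = LinearMap.id := by
  ext a
  have h := R.isRightCoaction_coact.counit a
  simp [counitOut, out, sum_legs R.coact] at h ⊢
  exact h

/-- The diagonal coaction is counital on `A^{□_C (n+1)} ⊗ M`. -/
theorem counit_coactDiag {n : ℕ} {x : TW A M (n + 1)} (hx : x ∈ chain M R n) :
    counitOut (coactDiag R n) x = x := by
  induction n with
  | zero =>
    rw [coactDiag_zero]
    have h := counitOut_front (T := TW A M 0) (out R)
    rw [counitOut_out, LinearMap.rTensor_id] at h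
    exact LinearMap.congr_fun h x
  | succ n ih =>
    obtain ⟨h0, h⟩ := (mem_chain_succ R).1 hx
    rw [coactDiag_succ]
    refine counitOut_diag _ (pair_coactDiag_mem_sq hx) (counitOut_out R) ?_
    have h2 := lTensor_congr (F := counitOut (coactDiag R n)) (G := LinearMap.id)
      (· ∈ chain M R n) h fun w hw => ih hw
    rwa [LinearMap.lTensor_id] at h2

/-- On `A^{□_C (n+1)} ⊗ M`, the source of the diagonal coaction is the right coaction of the last
factor. -/
theorem α_coactDiag {n : ℕ} {x : TW A M (n + 1)} (hx : x ∈ chain M R n) :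
    H.α.toLinearMap.rTensor _ (coactDiag R n x) =
      coactAt (rightOut R) (n + 1) (Fin.last n) x := by
  induction n with
  | zero =>
    rw [coactDiag_zero, Fin.last_zero, coactAt_zero, rightOut_eq]
    exact rTensor_front _ _ _
  | succ n ih =>
    obtain ⟨h0, h⟩ := (mem_chain_succ R).1 hx
    rw [coactDiag_succ, ← Fin.succ_last, coactAt_succ]
    refine (α_diag _ (pair_coactDiag_mem_sq hx) (counitOut_out R)).trans (behind_congr ?_)
    exact lTensor_congr (· ∈ chain M R n) h fun w hw => ih hw

/-- On `A^{□_C (n+1)} ⊗ M`, the target of the diagonal coaction is the left coaction of the first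
factor. -/
theorem β_coactDiag {n : ℕ} {x : TW A M (n + 1)} (hx : x ∈ chain M R n) :
    H.β.rTensor _ (coactDiag R n x) = front R.left (TW A M n) x := by
  rw [left_eq_out]
  cases n with
  | zero =>
    rw [coactDiag_zero]
    exact rTensor_front _ _ _
  | succ n =>
    obtain ⟨h0, h⟩ := (mem_chain_succ R).1 hx
    rw [coactDiag_succ]
    refine β_diag _ (pair_coactDiag_mem_sq hx) ?_
    have h2 := lTensor_congr (F := counitOut (coactDiag R n)) (G := LinearMap.id)
      (· ∈ chain M R n) h fun w hw => counit_coactDiag hw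
    rwa [LinearMap.lTensor_id] at h2

end Words

/-! ### Cofaces and codegeneracies preserve the cochains -/

section Words

variable {C B : Type*} [AddCommGroup C] [Module ℂ C] [Coalgebra ℂ C]
  [AddCommGroup B] [Module ℂ B] [Coalgebra ℂ B] {H : RightHopfCoalgebra C B}
  {A M : Type u} [AddCommGroup A] [Module ℂ A] [AddCommGroup M] [Module ℂ M]
  {Z : Type*} [AddCommGroup Z] [Module ℂ Z]

section Ring

variable (R : ComoduleRing H A)

theorem left_split : front R.left A ∘ₗ split R = (split R).lTensor C ∘ₗ R.left := by
  ext a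
  have h1 : R.left ∘ₗ R.η = R.η.lTensor C ∘ₗ Coalgebra.comul := LinearMap.ext R.left_η
  have h2 : front R.left A (split R a) =
      TensorProduct.assoc ℂ C A A ((R.left ∘ₗ R.η).rTensor A (R.left a)) := by
    rw [LinearMap.rTensor_comp]; rfl
  have h3 := congrArg ((R.η.rTensor A).lTensor C) (R.isLeftCoaction_left.coassoc a)
  rw [LinearMap.comp_apply, h2, h1]
  simp [split, sum_legs R.left, sum_legs (Coalgebra.comul (R := ℂ) (A := C)),
    TensorProduct.sum_tmul, TensorProduct.tmul_sum] at h3 ⊢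
  exact h3

theorem rightOut_split :
    behind A (rightOut R) ∘ₗ split R = (split R).lTensor C ∘ₗ rightOut R := by
  ext a
  have h := congrArg ((TensorProduct.leftComm ℂ A C A).toLinearMap ∘ₗ
    TensorProduct.map R.η (TensorProduct.comm ℂ A C).toLinearMap) (R.left_right a)
  simp [split, behind, rightOut, sum_legs R.left, sum_legs R.right, TensorProduct.sum_tmul,
    TensorProduct.tmul_sum] at h ⊢
  exact h.symm

variable {T : Type*} [AddCommGroup T] [Module ℂ T]

/-- `a ⊗ t ↦ η(a[-1]) ⊗ a[0] ⊗ t`. -/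
def insert (T : Type*) [AddCommGroup T] [Module ℂ T] : A ⊗[ℂ] T →ₗ[ℂ] A ⊗[ℂ] (A ⊗[ℂ] T) :=
  (TensorProduct.assoc ℂ A A T).toLinearMap ∘ₗ (split R).rTensor T

/-- `a ⊗ a' ⊗ t ↦ a a' ⊗ t`. -/
def merge (T : Type*) [AddCommGroup T] [Module ℂ T] : A ⊗[ℂ] (A ⊗[ℂ] T) →ₗ[ℂ] A ⊗[ℂ] T :=
  R.mulE.rTensor T ∘ₗ (TensorProduct.assoc ℂ A A T).symm.toLinearMap

theorem front_left_insert (x : A ⊗[ℂ] T) : front R.left (A ⊗[ℂ] T) (insert R T x) =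
    (insert R T).lTensor C (front R.left T x) := by
  rw [insert, LinearMap.comp_apply, LinearEquiv.coe_coe, front_assoc,
    front_rTensor (f' := R.left) (by rw [left_split]), LinearMap.lTensor_comp,
    LinearMap.comp_apply]

/-- The first two factors of `η(a[-1]) ⊗ a[0] ⊗ t` satisfy the cotensor condition. -/
theorem front_right_insert (x : A ⊗[ℂ] T) : front (rightOut R) (A ⊗[ℂ] T) (insert R T x) =
    behind A (front R.left T) (insert R T x) := by
  rw [insert, LinearMap.comp_apply, LinearEquiv.coe_coe, front_assoc, behind_front_assoc]
  refine congrArg _ (front_congr ?_)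
  rw [← LinearMap.comp_apply, ← LinearMap.comp_apply, ← LinearMap.rTensor_comp,
    ← LinearMap.rTensor_comp]
  exact congrArg (fun f => LinearMap.rTensor T f x) (LinearMap.ext (front_split R))

theorem behind_front_insert (x : A ⊗[ℂ] T) : behind A (front (rightOut R) T) (insert R T x) =
    (insert R T).lTensor C (front (rightOut R) T x) := by
  rw [insert, LinearMap.comp_apply, LinearEquiv.coe_coe, behind_front_assoc,
    front_rTensor (f' := rightOut R) (by rw [rightOut_split]), LinearMap.lTensor_comp,
    LinearMap.comp_apply]

theorem behind_behind_insert (f : T →ₗ[ℂ] Z ⊗[ℂ] T) (x : A ⊗[ℂ] T) :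
    behind A (behind A f) (insert R T x) = (insert R T).lTensor Z (behind A f x) := by
  rw [insert, LinearMap.comp_apply, LinearEquiv.coe_coe, behind_behind_assoc, behind_rTensor,
    LinearMap.lTensor_comp, LinearMap.comp_apply]

theorem lTensor_lTensor_insert {U : Type*} [AddCommGroup U] [Module ℂ U] (f : T →ₗ[ℂ] U)
    (x : A ⊗[ℂ] T) : (f.lTensor A).lTensor A (insert R T x) = insert R U (f.lTensor A x) := by
  induction x with
  | zero => simp
  | add x y hx hy => simp only [map_add, hx, hy]
  | tmul a t => simp [insert, sum_legs (split R), TensorProduct.sum_tmul]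

theorem slice_slice_insert (φ ψ : A →ₗ[ℂ] ℂ) (x : A ⊗[ℂ] T) :
    slice ψ T (slice φ (A ⊗[ℂ] T) (insert R T x)) = slice (ψ ∘ₗ slice φ A ∘ₗ split R) T x := by
  rw [insert, LinearMap.comp_apply, LinearEquiv.coe_coe, slice_assoc, slice_rTensor, slice_rTensor,
    LinearMap.comp_assoc]

/-- Inserting the unit is colinear for the diagonal coaction, when `t` does not coact. -/
theorem diag_front_insert (x : A ⊗[ℂ] T) :
    diag H.toRightBicoalgebroid (out R) (front (out R) T) (insert R T x) =
      (insert R T).lTensor B (front (out R) T x) := by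
  rw [insert, LinearMap.comp_apply, LinearEquiv.coe_coe, diag, LinearMap.comp_apply,
    pair_front_assoc, rTensor_lTensor_apply, rTensor_front, LinearMap.lTensor_comp,
    LinearMap.comp_apply, ← front_rTensor]
  exact congrArg (fun f => LinearMap.rTensor T f x) (LinearMap.ext (diag_split R))

/-- Inserting the unit is colinear for the diagonal coaction, when `t` coacts by `d`. -/
theorem diag_diag_insert {d : T →ₗ[ℂ] B ⊗[ℂ] T} {l : T →ₗ[ℂ] C ⊗[ℂ] T} {x : A ⊗[ℂ] T}
    (hd : (front (copOut H.β) T ∘ₗ d).lTensor A x = (d.lTensor C ∘ₗ l).lTensor A x)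
    (hx : front (rightOut R) T x = behind A l x) :
    diag H.toRightBicoalgebroid (out R) (diag H.toRightBicoalgebroid (out R) d) (insert R T x) =
      (insert R T).lTensor B (diag H.toRightBicoalgebroid (out R) d x) := by
  rw [← diag_assoc H.toRightBicoalgebroid (r := rightOut R) (r' := rightOut R) (l'' := R.left)
    (l := l) (front_right_out R) (by rw [front_left_out]) (by rw [front_right_out])
    (by rw [lTensor_lTensor_insert, lTensor_lTensor_insert, hd]) (front_right_insert R x)
    (by rw [behind_front_insert, behind_behind_insert, hx]), insert, LinearMap.comp_apply,
    LinearEquiv.coe_coe, LinearEquiv.symm_apply_apply, diag_rTensor, LinearMap.lTensor_comp,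
    LinearMap.comp_apply]
  exact congrArg (fun f => LinearMap.rTensor T f x) (LinearMap.ext (diag_split R))

variable {R} in
theorem front_assoc_symm {x : A ⊗[ℂ] (A ⊗[ℂ] T)}
    (hx : front (rightOut R) (A ⊗[ℂ] T) x = behind A (front R.left T) x) :
    (front (rightOut R) A).rTensor T ((TensorProduct.assoc ℂ A A T).symm x) =
      (behind A R.left).rTensor T ((TensorProduct.assoc ℂ A A T).symm x) := by
  apply rTensor_eq_of_front
  have hi : Function.Injective ((TensorProduct.assoc ℂ A A T).toLinearMap.lTensor C) :=
    (LinearEquiv.lTensor C (TensorProduct.assoc ℂ A A T)).injective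
  apply hi
  rw [← front_assoc, ← behind_front_assoc, LinearEquiv.apply_symm_apply, hx]

variable {R}

theorem lTensor_assoc_symm {U V W X : Type*} [AddCommGroup U] [Module ℂ U] [AddCommGroup V]
    [Module ℂ V] [AddCommGroup W] [Module ℂ W] [AddCommGroup X] [Module ℂ X]
    (z : U ⊗[ℂ] ((V ⊗[ℂ] W) ⊗[ℂ] X)) :
    (TensorProduct.assoc ℂ V W X).symm.toLinearMap.lTensor U
      ((TensorProduct.assoc ℂ V W X).toLinearMap.lTensor U z) = z :=
  (LinearEquiv.lTensor U (TensorProduct.assoc ℂ V W X)).symm_apply_apply z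

theorem front_left_merge {x : A ⊗[ℂ] (A ⊗[ℂ] T)}
    (hx : front (rightOut R) (A ⊗[ℂ] T) x = behind A (front R.left T) x) :
    front R.left T (merge R T x) = (merge R T).lTensor C (front R.left (A ⊗[ℂ] T) x) := by
  have h := rTensor_congr_of_eq (F := R.left ∘ₗ R.mulE)
    (G := R.mulE.lTensor C ∘ₗ front R.left A) (fun w hw => ring_left_mulE R hw)
    (front_assoc_symm hx)
  obtain ⟨y, rfl⟩ := (TensorProduct.assoc ℂ A A T).surjective x
  rw [LinearEquiv.symm_apply_apply] at h
  rw [merge, LinearMap.comp_apply, LinearEquiv.coe_coe, LinearEquiv.symm_apply_apply,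
    front_rTensor h, front_assoc, LinearMap.lTensor_comp, LinearMap.comp_apply,
    lTensor_assoc_symm]

theorem front_right_merge {x : A ⊗[ℂ] (A ⊗[ℂ] T)}
    (hx : front (rightOut R) (A ⊗[ℂ] T) x = behind A (front R.left T) x) :
    front (rightOut R) T (merge R T x) =
      (merge R T).lTensor C (behind A (front (rightOut R) T) x) := by
  have h := rTensor_congr_of_eq (F := rightOut R ∘ₗ R.mulE)
    (G := R.mulE.lTensor C ∘ₗ behind A (rightOut R)) (fun w hw => ring_right_mulE R hw)
    (front_assoc_symm hx)
  obtain ⟨y, rfl⟩ := (TensorProduct.assoc ℂ A A T).surjective x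
  rw [LinearEquiv.symm_apply_apply] at h
  rw [merge, LinearMap.comp_apply, LinearEquiv.coe_coe, LinearEquiv.symm_apply_apply,
    front_rTensor h, behind_front_assoc, LinearMap.lTensor_comp, LinearMap.comp_apply,
    lTensor_assoc_symm]

theorem behind_merge (f : T →ₗ[ℂ] Z ⊗[ℂ] T) (x : A ⊗[ℂ] (A ⊗[ℂ] T)) :
    behind A f (merge R T x) = (merge R T).lTensor Z (behind A (behind A f) x) := by
  obtain ⟨y, rfl⟩ := (TensorProduct.assoc ℂ A A T).surjective x
  rw [merge, LinearMap.comp_apply, LinearEquiv.coe_coe, LinearEquiv.symm_apply_apply,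
    behind_rTensor, behind_behind_assoc, LinearMap.lTensor_comp, LinearMap.comp_apply,
    lTensor_assoc_symm]

/-- Multiplying two factors is colinear for the diagonal coaction, when `t` does not coact. -/
theorem front_out_merge {x : A ⊗[ℂ] (A ⊗[ℂ] T)}
    (hx : front (rightOut R) (A ⊗[ℂ] T) x = behind A (front R.left T) x) :
    front (out R) T (merge R T x) = (merge R T).lTensor B
      (diag H.toRightBicoalgebroid (out R) (front (out R) T) x) := by
  have h := rTensor_congr_of_eq (F := out R ∘ₗ R.mulE)
    (G := R.mulE.lTensor B ∘ₗ diag H.toRightBicoalgebroid (out R) (out R))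
    (fun w hw => out_mulE R hw) (front_assoc_symm hx)
  obtain ⟨y, rfl⟩ := (TensorProduct.assoc ℂ A A T).surjective x
  rw [LinearEquiv.symm_apply_apply] at h
  rw [merge, LinearMap.comp_apply, LinearEquiv.coe_coe, LinearEquiv.symm_apply_apply,
    front_rTensor h, diag, diag, LinearMap.comp_apply, pair_front_assoc, rTensor_lTensor_apply,
    rTensor_front, LinearMap.lTensor_comp, LinearMap.comp_apply, lTensor_assoc_symm]

/-- Multiplying two factors is colinear for the diagonal coaction, when `t` coacts by `d`. -/
theorem diag_merge {d : T →ₗ[ℂ] B ⊗[ℂ] T} {l : T →ₗ[ℂ] C ⊗[ℂ] T} {x : A ⊗[ℂ] (A ⊗[ℂ] T)}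
    (hx : front (rightOut R) (A ⊗[ℂ] T) x = behind A (front R.left T) x)
    (hd : ((front (copOut H.β) T ∘ₗ d).lTensor A).lTensor A x =
      ((d.lTensor C ∘ₗ l).lTensor A).lTensor A x)
    (hx' : behind A (front (rightOut R) T) x = behind A (behind A l) x) :
    diag H.toRightBicoalgebroid (out R) d (merge R T x) = (merge R T).lTensor B
      (diag H.toRightBicoalgebroid (out R) (diag H.toRightBicoalgebroid (out R) d) x) := by
  have h := rTensor_congr_of_eq (F := out R ∘ₗ R.mulE)
    (G := R.mulE.lTensor B ∘ₗ diag H.toRightBicoalgebroid (out R) (out R))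
    (fun w hw => out_mulE R hw) (front_assoc_symm hx)
  rw [← diag_assoc H.toRightBicoalgebroid (r := rightOut R) (r' := rightOut R) (l'' := R.left)
    (l := l) (front_right_out R) (by rw [front_left_out]) (by rw [front_right_out]) hd hx hx',
    merge, LinearMap.comp_apply, LinearEquiv.coe_coe, diag_rTensor _ h, LinearMap.lTensor_comp,
    LinearMap.comp_apply,
    lTensor_assoc_symm]

end Ring

variable {R : ComoduleRing H A} {S : SAYDModule H M}

theorem faceAt_zero' (n : ℕ) : faceAt (M := M) R (n + 1) 0 = insert R (TW A M n) :=
  faceAt_zero R n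

theorem degeneracyAt_zero' (n : ℕ) : degeneracyAt (M := M) R (n + 1) 0 = merge R (TW A M n) :=
  degeneracyAt_zero R n

theorem left_faceAt {n : ℕ} (i : Fin (n + 1)) (x : TW A M (n + 1)) :
    front R.left (TW A M (n + 1)) (faceAt R (n + 1) i x) =
      (faceAt R (n + 1) i).lTensor C (front R.left (TW A M n) x) := by
  refine Fin.cases ?_ (fun i => ?_) i
  · rw [faceAt_zero']
    exact front_left_insert R _
  · rw [faceAt_succ]
    exact front_lTensor _ _ _

theorem faceAt_mem_chain {n : ℕ} (i : Fin (n + 1)) {x : TW A M (n + 1)} (hx : x ∈ chain M R n) :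
    faceAt R (n + 1) i x ∈ chain M R (n + 1) := by
  induction n with
  | zero =>
    rw [Fin.fin_one_eq_zero i, faceAt_zero']
    exact (mem_chain_succ R).2 ⟨front_right_insert R _, fun φ => mem_chain_zero R _⟩
  | succ n ih =>
    obtain ⟨h0, h⟩ := (mem_chain_succ R).1 hx
    refine Fin.cases ?_ (fun i => ?_) i
    · rw [faceAt_zero']
      refine (mem_chain_succ R).2 ⟨front_right_insert R _, fun φ =>
        (mem_chain_succ R).2 ⟨?_, fun ψ => ?_⟩⟩
      · have h1 := (behind_front_insert R (T := TW A M (n + 1)) x).trans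
          ((congrArg _ h0).trans (behind_behind_insert R _ x).symm)
        have h2 := congrArg (slice φ _) (lTensor_eq_of_behind h1)
        exact (slice_lTensor _ _ _).symm.trans (h2.trans (slice_lTensor _ _ _))
      · have h1 := h (ψ ∘ₗ slice φ A ∘ₗ split R)
        exact (slice_slice_insert R φ ψ x).symm ▸ h1
    · rw [faceAt_succ]
      refine (mem_chain_succ R).2 ⟨?_, fun φ => ?_⟩
      · refine (front_lTensor _ _ _).trans ((congrArg _ h0).trans ?_)
        symm
        refine behind_lTensor ?_
        exact congrArg (fun f => LinearMap.lTensor A f x) (LinearMap.ext (left_faceAt i))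
      · have h1 := ih i (h φ)
        have h2 := slice_lTensor φ (faceAt R (n + 1) i) x
        rwa [← h2] at h1

theorem coactDiag_faceAt {n : ℕ} (i : Fin (n + 1)) {x : TW A M (n + 1)} (hx : x ∈ chain M R n) :
    coactDiag R (n + 1) (faceAt R (n + 1) i x) =
      (faceAt R (n + 1) i).lTensor B (coactDiag R n x) := by
  induction n with
  | zero =>
    rw [Fin.fin_one_eq_zero i, faceAt_zero', coactDiag_succ R 0, coactDiag_zero]
    exact diag_front_insert R _
  | succ n ih =>
    obtain ⟨h0, h⟩ := (mem_chain_succ R).1 hx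
    refine Fin.cases ?_ (fun i => ?_) i
    · rw [faceAt_zero', coactDiag_succ R (n + 1), coactDiag_succ R n]
      refine diag_diag_insert R ?_ h0
      exact lTensor_congr (· ∈ chain M R n) h fun w hw => front_left_coactDiag hw
    · rw [faceAt_succ, coactDiag_succ R (n + 1)]
      conv_rhs => rw [coactDiag_succ R n]
      refine diag_lTensor _ ?_
      exact lTensor_congr (· ∈ chain M R n) h fun w hw => ih i hw

theorem coactLast_faceAt (f : M →ₗ[ℂ] Z ⊗[ℂ] M) {n : ℕ} (i : Fin n) (x : TW A M n) :
    coactLast f (n + 1) (faceAt R n i x) = (faceAt R n i).lTensor Z (coactLast f n x) := by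
  induction n with
  | zero => exact i.elim0
  | succ n ih =>
    refine Fin.cases ?_ (fun i => ?_) i
    · rw [faceAt_zero', coactLast_succ, coactLast_succ]
      exact behind_behind_insert R _ _
    · rw [faceAt_succ, coactLast_succ f (n + 1)]
      conv_rhs => rw [coactLast_succ f n]
      refine behind_lTensor ?_
      exact congrArg (fun f => LinearMap.lTensor A f x) (LinearMap.ext (ih i))

theorem faceAt_mem_cochains {n : ℕ} (i : Fin (n + 1)) {x : TW A M (n + 1)}
    (hx : x ∈ cochains R S n) : faceAt R (n + 1) i x ∈ cochains R S (n + 1) := by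
  obtain ⟨h, hE⟩ := (mem_cochains_iff R S).1 hx
  refine (mem_cochains_iff R S).2 ⟨faceAt_mem_chain i h, ?_⟩
  rw [coactDiag_faceAt i h, hE, coactLast_faceAt]

theorem left_degeneracyAt {n : ℕ} (i : Fin (n + 1)) {x : TW A M (n + 2)}
    (hx : x ∈ chain M R (n + 1)) :
    front R.left (TW A M n) (degeneracyAt R (n + 1) i x) =
      (degeneracyAt R (n + 1) i).lTensor C (front R.left (TW A M (n + 1)) x) := by
  obtain ⟨h0, h⟩ := (mem_chain_succ R).1 hx
  refine Fin.cases ?_ (fun i => ?_) i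
  · rw [degeneracyAt_zero']
    exact front_left_merge h0
  · rw [degeneracyAt_succ]
    exact front_lTensor _ _ _

theorem degeneracyAt_mem_chain {n : ℕ} (i : Fin (n + 1)) {x : TW A M (n + 2)}
    (hx : x ∈ chain M R (n + 1)) : degeneracyAt R (n + 1) i x ∈ chain M R n := by
  induction n with
  | zero => exact mem_chain_zero R _
  | succ n ih =>
    obtain ⟨h0, h⟩ := (mem_chain_succ R).1 hx
    refine Fin.cases ?_ (fun i => ?_) i
    · rw [degeneracyAt_zero']
      refine (mem_chain_succ R).2 ⟨?_, fun φ => ?_⟩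
      · have h1 : behind A (front (rightOut R) (TW A M (n + 1))) x =
            behind A (behind A (front R.left (TW A M n))) x :=
          behind_congr (lTensor_congr (· ∈ chain M R (n + 1)) h
            fun w hw => ((mem_chain_succ R).1 hw).1)
        refine (front_right_merge h0).trans ((congrArg _ h1).trans ?_)
        exact (behind_merge _ _).symm
      · have h1 := slice_rTensor φ R.mulE ((TensorProduct.assoc ℂ A A (TW A M (n + 1))).symm x)
        exact h1 ▸ slice_assoc_symm_mem (S := chain M R n)
          (fun φ ψ => ((mem_chain_succ R).1 (h φ)).2 ψ) (φ ∘ₗ R.mulE)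
    · rw [degeneracyAt_succ]
      refine (mem_chain_succ R).2 ⟨?_, fun φ => ?_⟩
      · refine (front_lTensor _ _ _).trans ((congrArg _ h0).trans ?_)
        symm
        refine behind_lTensor ?_
        exact lTensor_congr (· ∈ chain M R (n + 1)) h fun w hw => left_degeneracyAt i hw
      · have h1 := ih i (h φ)
        have h2 := slice_lTensor φ (degeneracyAt R (n + 1) i) x
        rwa [← h2] at h1

theorem coactDiag_degeneracyAt {n : ℕ} (i : Fin (n + 1)) {x : TW A M (n + 2)}
    (hx : x ∈ chain M R (n + 1)) :
    coactDiag R n (degeneracyAt R (n + 1) i x) =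
      (degeneracyAt R (n + 1) i).lTensor B (coactDiag R (n + 1) x) := by
  induction n with
  | zero =>
    obtain ⟨h0, h⟩ := (mem_chain_succ R).1 hx
    rw [Fin.fin_one_eq_zero i, degeneracyAt_zero', coactDiag_succ R 0, coactDiag_zero]
    exact front_out_merge h0
  | succ n ih =>
    obtain ⟨h0, h⟩ := (mem_chain_succ R).1 hx
    refine Fin.cases ?_ (fun i => ?_) i
    · rw [degeneracyAt_zero', coactDiag_succ R (n + 1), coactDiag_succ R n]
      refine diag_merge (l := front R.left (TW A M n)) h0 ?_ ?_
      · refine lTensor_congr (· ∈ chain M R (n + 1)) h fun w hw => ?_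
        exact lTensor_congr (· ∈ chain M R n) ((mem_chain_succ R).1 hw).2
          fun w hw => front_left_coactDiag hw
      · exact behind_congr (lTensor_congr (· ∈ chain M R (n + 1)) h
            fun w hw => ((mem_chain_succ R).1 hw).1)
    · rw [degeneracyAt_succ, coactDiag_succ R (n + 1)]
      conv_lhs => rw [coactDiag_succ R n]
      refine diag_lTensor _ ?_
      exact lTensor_congr (· ∈ chain M R (n + 1)) h fun w hw => ih i hw

theorem coactLast_degeneracyAt (f : M →ₗ[ℂ] Z ⊗[ℂ] M) {n : ℕ} (i : Fin n) (x : TW A M (n + 1)) :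
    coactLast f n (degeneracyAt R n i x) =
      (degeneracyAt R n i).lTensor Z (coactLast f (n + 1) x) := by
  induction n with
  | zero => exact i.elim0
  | succ n ih =>
    refine Fin.cases ?_ (fun i => ?_) i
    · rw [degeneracyAt_zero', coactLast_succ, coactLast_succ f (n + 1), coactLast_succ]
      exact behind_merge _ _
    · rw [degeneracyAt_succ, coactLast_succ, coactLast_succ f (n + 1)]
      refine behind_lTensor ?_
      exact congrArg (fun f => LinearMap.lTensor A f x) (LinearMap.ext (ih i))

theorem degeneracyAt_mem_cochains {n : ℕ} (i : Fin (n + 1)) {x : TW A M (n + 2)}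
    (hx : x ∈ cochains R S (n + 1)) : degeneracyAt R (n + 1) i x ∈ cochains R S n := by
  obtain ⟨h, hE⟩ := (mem_cochains_iff R S).1 hx
  refine (mem_cochains_iff R S).2 ⟨degeneracyAt_mem_chain i h, ?_⟩
  rw [coactDiag_degeneracyAt i h, hE, coactLast_degeneracyAt]

end Words

/-! ### Evaluation of the middle factor -/

section LinearAlgebra

variable {X Y Z V W U : Type*} [AddCommGroup X] [Module ℂ X] [AddCommGroup Y] [Module ℂ Y]
  [AddCommGroup Z] [Module ℂ Z] [AddCommGroup V] [Module ℂ V] [AddCommGroup W] [Module ℂ W]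
  [AddCommGroup U] [Module ℂ U]

theorem front_comm (f : V →ₗ[ℂ] Z ⊗[ℂ] V) (x : W ⊗[ℂ] V) :
    front f W (TensorProduct.comm ℂ W V x) =
      (TensorProduct.comm ℂ W V).toLinearMap.lTensor Z (behind W f x) := by
  induction x with
  | zero => simp
  | add x y hx hy => simp only [map_add, hx, hy]
  | tmul v w => simp [front, behind, sum_legs f, TensorProduct.sum_tmul, TensorProduct.tmul_sum]

theorem behind_comm (f : W →ₗ[ℂ] Z ⊗[ℂ] W) (x : W ⊗[ℂ] V) :
    behind V f (TensorProduct.comm ℂ W V x) =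
      (TensorProduct.comm ℂ W V).toLinearMap.lTensor Z (front f V x) := by
  induction x with
  | zero => simp
  | add x y hx hy => simp only [map_add, hx, hy]
  | tmul v w => simp [front, behind, sum_legs f, TensorProduct.sum_tmul, TensorProduct.tmul_sum]

/-- A tensor in `Z ⊗ (V ⊗ W)` is determined by its evaluations at functionals on `V`. -/
theorem eq_of_lTensor_slice {x y : Z ⊗[ℂ] (V ⊗[ℂ] W)}
    (h : ∀ φ : V →ₗ[ℂ] ℂ, (slice φ W).lTensor Z x = (slice φ W).lTensor Z y) : x = y := by
  apply (TensorProduct.leftComm ℂ Z V W).injective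
  refine eq_of_slice fun φ => ?_
  have key : ∀ x : Z ⊗[ℂ] (V ⊗[ℂ] W), slice φ (Z ⊗[ℂ] W) (TensorProduct.leftComm ℂ Z V W x) =
      (slice φ W).lTensor Z x := by
    intro x
    induction x using TensorProduct.induction_on with
    | zero => simp
    | add x y hx hy => simp only [map_add, hx, hy]
    | tmul z y =>
      induction y using TensorProduct.induction_on with
      | zero => simp
      | add x y hx hy => simp only [TensorProduct.tmul_add, map_add, hx, hy]
      | tmul v w => simp [slice]
  rw [key, key, h]

theorem lTensor_lTensor_apply (f : V →ₗ[ℂ] W) (g : W →ₗ[ℂ] U) (x : Z ⊗[ℂ] V) :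
    g.lTensor Z (f.lTensor Z x) = (g ∘ₗ f).lTensor Z x := by
  rw [LinearMap.lTensor_comp]; rfl

theorem rTensor_rTensor_apply (f : V →ₗ[ℂ] W) (g : W →ₗ[ℂ] U) (x : V ⊗[ℂ] Z) :
    g.rTensor Z (f.rTensor Z x) = (g ∘ₗ f).rTensor Z x := by
  rw [LinearMap.rTensor_comp]; rfl

end LinearAlgebra

/-! ### Stable anti Yetter–Drinfeld structures -/

section SAYD

variable {C B : Type*} [AddCommGroup C] [Module ℂ C] [Coalgebra ℂ C]
  [AddCommGroup B] [Module ℂ B] [Coalgebra ℂ B]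
  {T T' : Type*} [AddCommGroup T] [Module ℂ T] [AddCommGroup T'] [Module ℂ T']

/-- `u ⊗ (b ⊗ t) ↦ ν⁺(b⁽²⁾, u) b⁽¹⁾ ⊗ t ◁ ν⁻(b⁽²⁾, u)`. -/
def hopfAct (H : RightHopfCoalgebra C B) (act : B ⊗[ℂ] T →ₗ[ℂ] T) :
    B ⊗[ℂ] (B ⊗[ℂ] T) →ₗ[ℂ] B ⊗[ℂ] T :=
  TensorProduct.map H.mulE act ∘ₗ
  (TensorProduct.tensorTensorTensorComm ℂ B B B T).toLinearMap ∘ₗ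
  ((TensorProduct.comm ℂ B B).toLinearMap ∘ₗ H.nuInvE).rTensor (B ⊗[ℂ] T) ∘ₗ
  (TensorProduct.tensorTensorTensorComm ℂ B B B T).toLinearMap ∘ₗ
  ((TensorProduct.comm ℂ B B).toLinearMap ∘ₗ Coalgebra.comul).rTensor (B ⊗[ℂ] T) ∘ₗ
  (TensorProduct.leftComm ℂ B B T).toLinearMap

/-- The laws of a stable anti Yetter–Drinfeld module, for an action `b ⊗ t ↦ t ◁ b` with the acting
factor in front and a coaction `K`; the right `C`-coaction, and with it the domain of the action,
is the one induced by `K`. -/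
structure IsSAYD (H : RightHopfCoalgebra C B) (act : B ⊗[ℂ] T →ₗ[ℂ] T)
    (K : T →ₗ[ℂ] B ⊗[ℂ] T) : Prop where
  left_eq : ∀ t, H.α.toLinearMap.rTensor T (K t) =
    TensorProduct.map H.α.toLinearMap act (TensorProduct.assoc ℂ B B T
      (((Coalgebra.comul (R := ℂ)) ∘ₗ H.η ∘ₗ H.β).rTensor T (K t)))
  act_assoc : ∀ p : (B ⊗[ℂ] B) ⊗[ℂ] T,
    front (front (copOut H.α.toLinearMap) B) T p = front (behind B (copOut H.β)) T p →
    front (front (copOut H.β) B) T p = behind (B ⊗[ℂ] B) (H.β.rTensor T ∘ₗ K) p →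
    act (H.mulE.rTensor T p) = act (act.lTensor B (TensorProduct.assoc ℂ B B T
      ((TensorProduct.comm ℂ B B).toLinearMap.rTensor T p)))
  right_act : ∀ z : B ⊗[ℂ] T, front (copOut H.β) T z = behind B (H.β.rTensor T ∘ₗ K) z →
    H.β.rTensor T (K (act z)) = act.lTensor C (front (copOut H.α.toLinearMap) T z)
  ayd : ∀ z : B ⊗[ℂ] T, front (copOut H.β) T z = behind B (H.β.rTensor T ∘ₗ K) z →
    K (act z) = hopfAct H act (behind B K z)
  stable : ∀ t, act (K t) = t

/-- The action of `B` on `M` with the acting factor in front. -/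
def SAYDModule.actFront {H : RightHopfCoalgebra C B} {M : Type*} [AddCommGroup M] [Module ℂ M]
    (S : SAYDModule H M) : B ⊗[ℂ] M →ₗ[ℂ] M :=
  S.actE ∘ₗ (TensorProduct.comm ℂ B M).toLinearMap

theorem comm_comp_right {H : RightHopfCoalgebra C B} {M : Type*} [AddCommGroup M] [Module ℂ M]
    (S : SAYDModule H M) : (TensorProduct.comm ℂ M C).toLinearMap ∘ₗ S.right =
      H.β.rTensor M ∘ₗ S.coact := by
  ext m
  rw [LinearMap.comp_apply, S.right_eq]
  exact (TensorProduct.comm ℂ C M).symm_apply_apply _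

theorem SAYDModule.isSAYD {H : RightHopfCoalgebra C B} {M : Type*} [AddCommGroup M] [Module ℂ M]
    (S : SAYDModule H M) : IsSAYD H S.actFront S.coact where
  left_eq m := by
    rw [S.left_eq, S.right_eq]
    generalize S.coact m = z
    generalize H.α.toLinearMap = a
    induction z with
    | zero => simp
    | add x y hx hy => simp only [map_add, hx, hy]
    | tmul b m =>
      simp [SAYDModule.actFront, sum_legs (Coalgebra.comul (R := ℂ) (A := B)),
        TensorProduct.sum_tmul, TensorProduct.tmul_sum]
  act_assoc p h1 h2 := by
    have hx : TensorProduct.comm ℂ (B ⊗[ℂ] B) M p ∈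
        cotensor₃ S.right H.left H.right H.left := by
      refine ⟨mem_cotensor_iff.2 ?_, lTensor_viaRight_eq_iff.2 ?_⟩
      · rw [comm_comp_right, front_comm]
        refine (congrArg _ h2.symm).trans (behind_comm _ _).symm
      · rw [comm_right, ← comm_rTensor, rTensor_eq_of_front h1, comm_rTensor]
        rfl
    have h := S.act_assoc _ hx
    rw [← comm_rTensor] at h
    refine h.trans ?_
    clear h hx h1 h2
    induction p using TensorProduct.induction_on with
    | zero => simp
    | add x y hx hy => simp only [map_add, hx, hy]
    | tmul y m =>
      induction y using TensorProduct.induction_on with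
      | zero => simp
      | add x y hx hy => simp only [TensorProduct.add_tmul, map_add, hx, hy]
      | tmul b b' => rfl
  right_act z hz := by
    have hx : TensorProduct.comm ℂ B M z ∈ cotensor S.right H.left := by
      refine mem_cotensor_iff.2 ?_
      rw [comm_comp_right, front_comm]
      exact (congrArg _ hz.symm).trans (behind_comm _ _).symm
    have h := congrArg (TensorProduct.comm ℂ M C) (S.right_act ⟨_, hx⟩)
    rw [← ext_apply S.act ⟨_, hx⟩] at h
    refine (LinearMap.congr_fun (comm_comp_right S) _).symm.trans (h.trans ?_)
    rw [comm_rTensor, ← comm_right]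
    simp only
    clear h hx hz
    induction z with
    | zero => simp
    | add x y hx hy => simp only [map_add, hx, hy]
    | tmul b m =>
      simp [front, SAYDModule.actFront, RightModule.actE, sum_legs H.right,
        TensorProduct.sum_tmul, TensorProduct.tmul_sum]
  ayd z hz := by
    have hx : TensorProduct.comm ℂ B M z ∈ cotensor S.right H.left := by
      refine mem_cotensor_iff.2 ?_
      rw [comm_comp_right, front_comm]
      exact (congrArg _ hz.symm).trans (behind_comm _ _).symm
    have h := S.ayd ⟨_, hx⟩
    rw [← ext_apply S.act ⟨_, hx⟩] at h
    refine h.trans ?_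
    simp only [aydMap, hopfAct, behind, LinearMap.comp_apply, LinearEquiv.coe_coe,
      leftComm_leftComm]
    have hz' : TensorProduct.comm ℂ M B (TensorProduct.comm ℂ B M z) = z :=
      (TensorProduct.comm ℂ B M).symm_apply_apply z
    rw [hz', ← LinearMap.comp_apply (LinearMap.rTensor _ _) (LinearMap.lTensor _ _),
      LinearMap.rTensor_comp_lTensor]
    rfl
  stable := S.stable

variable {H : RightHopfCoalgebra C B}

theorem lTensor_hopfAct {act : B ⊗[ℂ] T →ₗ[ℂ] T} {act' : B ⊗[ℂ] T' →ₗ[ℂ] T'} {p : T' →ₗ[ℂ] T}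
    (h : p ∘ₗ act' = act ∘ₗ p.lTensor B) (z : B ⊗[ℂ] (B ⊗[ℂ] T')) :
    p.lTensor B (hopfAct H act' z) = hopfAct H act ((p.lTensor B).lTensor B z) := by
  induction z using TensorProduct.induction_on with
  | zero => simp
  | add x y hx hy => simp only [map_add, hx, hy]
  | tmul u y =>
    induction y using TensorProduct.induction_on with
    | zero => simp
    | add x y hx hy => simp only [TensorProduct.tmul_add, map_add, hx, hy]
    | tmul b t =>
      have h' : ∀ b t, p (act' (b ⊗ₜ t)) = act (b ⊗ₜ p t) := fun b t => by
        simpa using LinearMap.congr_fun h (b ⊗ₜ t)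
      simp [hopfAct, sum_legs (Coalgebra.comul (R := ℂ) (A := B)), sum_legs H.nuInvE,
        TensorProduct.sum_tmul, h']

/-- The laws of a stable anti Yetter–Drinfeld module may be tested on a jointly injective family of
morphisms. -/
theorem IsSAYD.of_family {act : B ⊗[ℂ] T →ₗ[ℂ] T} {K : T →ₗ[ℂ] B ⊗[ℂ] T} (hT : IsSAYD H act K)
    {act' : B ⊗[ℂ] T' →ₗ[ℂ] T'} {K' : T' →ₗ[ℂ] B ⊗[ℂ] T'} {ι : Type*} (p : ι → T' →ₗ[ℂ] T)
    (hp : ∀ x y : T', (∀ i, p i x = p i y) → x = y)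
    (hB : ∀ x y : B ⊗[ℂ] T', (∀ i, (p i).lTensor B x = (p i).lTensor B y) → x = y)
    (hC : ∀ x y : C ⊗[ℂ] T', (∀ i, (p i).lTensor C x = (p i).lTensor C y) → x = y)
    (hact : ∀ i, p i ∘ₗ act' = act ∘ₗ (p i).lTensor B)
    (hK : ∀ i, K ∘ₗ p i = (p i).lTensor B ∘ₗ K') : IsSAYD H act' K' := by
  have hact' : ∀ i z, p i (act' z) = act ((p i).lTensor B z) := fun i z =>
    LinearMap.congr_fun (hact i) z
  have hK' : ∀ i z, (p i).lTensor B (K' z) = K (p i z) := fun i z =>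
    (LinearMap.congr_fun (hK i) z).symm
  have hβ : ∀ i, (H.β.rTensor T ∘ₗ K) ∘ₗ p i = (p i).lTensor C ∘ₗ H.β.rTensor T' ∘ₗ K' := by
    intro i
    rw [LinearMap.comp_assoc, hK, ← LinearMap.comp_assoc, ← LinearMap.comp_assoc,
      LinearMap.rTensor_comp_lTensor, LinearMap.lTensor_comp_rTensor]
  refine ⟨fun t => hC _ _ fun i => ?_, fun q h1 h2 => hp _ _ fun i => ?_,
    fun z hz => hC _ _ fun i => ?_, fun z hz => hB _ _ fun i => ?_, fun t => hp _ _ fun i => ?_⟩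
  · rw [← rTensor_lTensor_apply, hK', hT.left_eq, ← hK']
    generalize K' t = z
    generalize H.α.toLinearMap = a
    induction z with
    | zero => simp
    | add x y hx hy => simp only [map_add, hx, hy]
    | tmul b m =>
      simp [sum_legs (Coalgebra.comul (R := ℂ) (A := B)), TensorProduct.sum_tmul, hact']
  · rw [hact', ← rTensor_lTensor_apply, hT.act_assoc]
    · rw [hact', lTensor_lTensor_apply, hact]
      clear h1 h2
      induction q using TensorProduct.induction_on with
      | zero => simp
      | add x y hx hy => simp only [map_add, hx, hy]
      | tmul y m =>
        induction y using TensorProduct.induction_on with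
        | zero => simp
        | add x y hx hy => simp only [TensorProduct.add_tmul, map_add, hx, hy]
        | tmul b b' => rfl
    · rw [front_lTensor, front_lTensor, h1]
    · rw [front_lTensor, h2, behind_lTensor]
      rw [hβ]
  · rw [← rTensor_lTensor_apply, hK', hact', hT.right_act, front_lTensor, lTensor_lTensor_apply,
      lTensor_lTensor_apply, hact]
    rw [front_lTensor, hz, behind_lTensor]
    rw [hβ]
  · rw [hK', hact', hT.ayd, lTensor_hopfAct (hact i)]
    · congr 1
      exact behind_lTensor (by rw [hK])
    · rw [front_lTensor, hz, behind_lTensor]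
      rw [hβ]
  · rw [hact', hK', hT.stable]

/-- The action of `B` on the second factor of `A ⊗ T`. -/
def shiftAct (A : Type*) [AddCommGroup A] [Module ℂ A] (act : B ⊗[ℂ] T →ₗ[ℂ] T) :
    B ⊗[ℂ] (A ⊗[ℂ] T) →ₗ[ℂ] A ⊗[ℂ] T :=
  act.lTensor A ∘ₗ (TensorProduct.leftComm ℂ B A T).toLinearMap

variable {A : Type*} [AddCommGroup A] [Module ℂ A]

/-- Tensoring with a spectator `A` in front preserves the laws: the slices by functionals on `A`
form a jointly injective family of morphisms `A ⊗ T → T`. -/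
theorem IsSAYD.shift {act : B ⊗[ℂ] T →ₗ[ℂ] T} {K : T →ₗ[ℂ] B ⊗[ℂ] T} (hT : IsSAYD H act K) :
    IsSAYD H (shiftAct A act) (behind A K) := by
  refine hT.of_family (fun φ : A →ₗ[ℂ] ℂ => slice φ T) (fun x y => eq_of_slice)
    (fun x y => eq_of_lTensor_slice) (fun x y => eq_of_lTensor_slice) (fun φ => ?_) fun φ => ?_
  · ext b a t
    simp [shiftAct, slice]
  · ext a t
    simp [behind, slice, sum_legs K t, TensorProduct.tmul_sum, Finset.smul_sum]

end SAYD

/-! ### The right action and the two base coactions -/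

section Unit

variable {C B : Type*} [AddCommGroup C] [Module ℂ C] [Coalgebra ℂ C]
  [AddCommGroup B] [Module ℂ B] [Coalgebra ℂ B] (H : RightBicoalgebroid C B)

omit [Coalgebra ℂ C] in
theorem comul_copOut (f : B →ₗ[ℂ] C) (b : B) : (copOut f).lTensor B (Coalgebra.comul (R := ℂ) b) =
    TensorProduct.leftComm ℂ C B B ((Coalgebra.comul (R := ℂ)).lTensor C (copOut f b)) := by
  have h := congrArg (((f.rTensor B).comp (TensorProduct.comm ℂ B B).toLinearMap).lTensor B)
    (Coalgebra.coassoc_apply (R := ℂ) b)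
  simp [copOut, sum_legs (Coalgebra.comul (R := ℂ) (A := B)), TensorProduct.sum_tmul,
    TensorProduct.tmul_sum] at h ⊢
  exact h.symm

/-- `c ↦ α(η(c)⁽¹⁾) ⊗ η(c)⁽²⁾`. -/
def unitOut : C →ₗ[ℂ] C ⊗[ℂ] B := H.α.toLinearMap.rTensor B ∘ₗ Coalgebra.comul ∘ₗ H.η

theorem copOut_unitOut {f : B →ₗ[ℂ] C} {g : C →ₗ[ℂ] C ⊗[ℂ] C}
    (h : copOut f ∘ₗ H.η = H.η.lTensor C ∘ₗ g) (c : C) :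
    (copOut f).lTensor C (unitOut H c) =
      TensorProduct.leftComm ℂ C C B ((unitOut H).lTensor C (g c)) := by
  have h1 := congrArg (H.α.toLinearMap.rTensor _) (comul_copOut f (H.η c))
  rw [← LinearMap.comp_apply (copOut f), h, LinearMap.comp_apply] at h1
  rw [unitOut, LinearMap.comp_apply, ← rTensor_lTensor_apply]
  refine h1.trans ?_
  generalize H.α.toLinearMap = a
  simp [sum_legs g, sum_legs (Coalgebra.comul (R := ℂ) (A := B)), TensorProduct.tmul_sum]

/-- `b ↦ α(η(β(b⁽²⁾))⁽¹⁾) ⊗ (η(β(b⁽²⁾))⁽²⁾ ⊗ b⁽¹⁾)`. -/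
def unitPair : B →ₗ[ℂ] C ⊗[ℂ] (B ⊗[ℂ] B) :=
  (TensorProduct.assoc ℂ C B B).toLinearMap ∘ₗ (unitOut H).rTensor B ∘ₗ copOut H.β

theorem mulE_unitPair : H.mulE.lTensor C ∘ₗ unitPair H = H.β.rTensor B ∘ₗ Coalgebra.comul := by
  ext b
  refine Eq.trans ?_ (unit_coact H b)
  rw [LinearMap.comp_apply, unitPair, LinearMap.comp_apply, LinearMap.comp_apply]
  generalize copOut H.β b = z
  unfold unitOut
  generalize H.α.toLinearMap = a
  induction z with
  | zero => simp
  | add x y hx hy => simp only [map_add, hx, hy]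
  | tmul c b => simp [sum_legs (Coalgebra.comul (R := ℂ) (A := B)), TensorProduct.sum_tmul]

theorem front_assoc_unitOut {f : B →ₗ[ℂ] C ⊗[ℂ] B} {g : C →ₗ[ℂ] C ⊗[ℂ] C}
    (h : ∀ c, f.lTensor C (unitOut H c) =
      TensorProduct.leftComm ℂ C C B ((unitOut H).lTensor C (g c))) (w : C ⊗[ℂ] B) :
    (front f B).lTensor C (TensorProduct.assoc ℂ C B B ((unitOut H).rTensor B w)) =
      TensorProduct.leftComm ℂ C C (B ⊗[ℂ] B)
        (((TensorProduct.assoc ℂ C B B).toLinearMap ∘ₗ (unitOut H).rTensor B).lTensor C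
          (TensorProduct.assoc ℂ C C B (g.rTensor B w))) := by
  induction w with
  | zero => simp
  | add x y hx hy => simp only [map_add, hx, hy]
  | tmul c b =>
    have h1 := congrArg (fun z => (TensorProduct.assoc ℂ C B B).toLinearMap.lTensor C
      (TensorProduct.assoc ℂ C (C ⊗[ℂ] B) B (z ⊗ₜ b))) (h c)
    simp [front, sum_legs (unitOut H), sum_legs g, TensorProduct.sum_tmul,
      TensorProduct.tmul_sum] at h1 ⊢
    exact h1

/-- The `β`-coaction of the left factor `η(β(b⁽²⁾))⁽²⁾` in `unitPair` is that of `b`. -/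
theorem front_unitPair_left (b : B) : (front (copOut H.β) B).lTensor C (unitPair H b) =
    TensorProduct.leftComm ℂ C C (B ⊗[ℂ] B) ((unitPair H).lTensor C (copOut H.β b)) := by
  have h := front_assoc_unitOut H (copOut_unitOut H (f := H.β)
    (g := Coalgebra.comul) (LinearMap.ext H.left_η)) (copOut H.β b)
  rw [coassoc_copOut_β, lTensor_lTensor_apply] at h
  exact h

/-- The two factors `η(β(b⁽²⁾))⁽²⁾ ⊗ b⁽¹⁾` of `unitPair` lie in `B □_C B`, so that they can be
multiplied. -/
theorem front_unitPair_right (b : B) :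
    (front (copOut H.α.toLinearMap) B).lTensor C (unitPair H b) =
      (behind B (copOut H.β)).lTensor C (unitPair H b) := by
  have h := front_assoc_unitOut H (copOut_unitOut H (copOut_α_η H)) (copOut H.β b)
  have h1 := coassoc_copOut_β H b
  refine h.trans ?_
  have h2 := congrArg (fun z => TensorProduct.leftComm ℂ C C (B ⊗[ℂ] B)
        (((TensorProduct.assoc ℂ C B B).toLinearMap ∘ₗ (unitOut H).rTensor B).lTensor C
          (TensorProduct.leftComm ℂ C C B z))) h1
  simp [unitPair, behind, sum_legs (copOut H.β), sum_legs (unitOut H),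
    sum_legs (Coalgebra.comul (R := ℂ) (A := C)), TensorProduct.sum_tmul,
    TensorProduct.tmul_sum] at h2 ⊢
  refine h2.trans ?_
  simp only [Finset.sum_comm (t := legs (unitOut H) _)]

end Unit

section SAYD

variable {C B : Type*} [AddCommGroup C] [Module ℂ C] [Coalgebra ℂ C]
  [AddCommGroup B] [Module ℂ B] [Coalgebra ℂ B] {H : RightHopfCoalgebra C B}
  {T : Type*} [AddCommGroup T] [Module ℂ T] {act : B ⊗[ℂ] T →ₗ[ℂ] T} {K : T →ₗ[ℂ] B ⊗[ℂ] T}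

/-- `b ⊗ t ↦ α(η(β(b⁽²⁾))⁽¹⁾) ⊗ ((η(β(b⁽²⁾))⁽²⁾ ⊗ b⁽¹⁾) ⊗ t)`. -/
def unitPairFront (H : RightHopfCoalgebra C B) (T : Type*) [AddCommGroup T] [Module ℂ T] :
    B ⊗[ℂ] T →ₗ[ℂ] C ⊗[ℂ] ((B ⊗[ℂ] B) ⊗[ℂ] T) :=
  (TensorProduct.assoc ℂ C (B ⊗[ℂ] B) T).toLinearMap ∘ₗ
    (unitPair H.toRightBicoalgebroid).rTensor T

theorem front_unitPairFront_right (z : B ⊗[ℂ] T) :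
    (front (front (copOut H.α.toLinearMap) B) T).lTensor C (unitPairFront H T z) =
      (front (behind B (copOut H.β)) T).lTensor C (unitPairFront H T z) := by
  induction z with
  | zero => simp
  | add x y hx hy => simp only [map_add, hx, hy]
  | tmul b t =>
    have key : ∀ F : B ⊗[ℂ] B →ₗ[ℂ] C ⊗[ℂ] (B ⊗[ℂ] B),
        (front F T).lTensor C (unitPairFront H T (b ⊗ₜ t)) =
        (TensorProduct.assoc ℂ C (B ⊗[ℂ] B) T).toLinearMap.lTensor C
          (TensorProduct.assoc ℂ C (C ⊗[ℂ] (B ⊗[ℂ] B)) T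
            (F.lTensor C (unitPair H.toRightBicoalgebroid b) ⊗ₜ t)) := by
      intro F
      simp [unitPairFront, front, sum_legs (unitPair H.toRightBicoalgebroid),
        TensorProduct.sum_tmul]
    rw [key, key, front_unitPair_right]

theorem front_unitPairFront_left (z : B ⊗[ℂ] T) :
    (front (front (copOut H.β) B) T).lTensor C (unitPairFront H T z) =
      TensorProduct.leftComm ℂ C C _
        ((unitPairFront H T).lTensor C (front (copOut H.β) T z)) := by
  induction z with
  | zero => simp
  | add x y hx hy => simp only [map_add, hx, hy]
  | tmul b t =>
    have h := congrArg (fun w => (TensorProduct.assoc ℂ C (B ⊗[ℂ] B) T).toLinearMap.lTensor C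
          (TensorProduct.assoc ℂ C (C ⊗[ℂ] (B ⊗[ℂ] B)) T (w ⊗ₜ t)))
      (front_unitPair_left H.toRightBicoalgebroid b)
    simp [unitPairFront, front, sum_legs (unitPair H.toRightBicoalgebroid), sum_legs (copOut H.β),
        TensorProduct.sum_tmul, TensorProduct.tmul_sum] at h ⊢
    exact h

theorem behind_unitPairFront {Z : Type*} [AddCommGroup Z] [Module ℂ Z] (l : T →ₗ[ℂ] Z ⊗[ℂ] T)
    (z : B ⊗[ℂ] T) :
    (behind (B ⊗[ℂ] B) l).lTensor C (unitPairFront H T z) =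
      TensorProduct.leftComm ℂ Z C _ ((unitPairFront H T).lTensor Z (behind B l z)) := by
  induction z with
  | zero => simp
  | add x y hx hy => simp only [map_add, hx, hy]
  | tmul b t =>
    simp [unitPairFront, behind, sum_legs (unitPair H.toRightBicoalgebroid), sum_legs l,
        TensorProduct.sum_tmul, TensorProduct.tmul_sum]
    simp only [Finset.sum_comm (t := legs l _)]

/-- `α(t⁽⁻¹⁾) ⊗ t⁽⁰⁾ ◁ b = β(b⁽¹⁾) ⊗ t ◁ b⁽²⁾` for `t ⊗ b` in the domain of the action: the analogue
for the action of the Takeuchi-type condition on the product. -/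
theorem IsSAYD.takeuchi (hT : IsSAYD H act K) {z : B ⊗[ℂ] T}
    (hz : front (copOut H.β) T z = behind B (H.β.rTensor T ∘ₗ K) z) :
    act.lTensor C (behind B (H.α.toLinearMap.rTensor T ∘ₗ K) z) =
      act.lTensor C (TensorProduct.assoc ℂ C B T
        ((H.β.rTensor B ∘ₗ Coalgebra.comul).rTensor T z)) := by
  have e1 : H.α.toLinearMap.rTensor T ∘ₗ K = act.lTensor C ∘ₗ
      (TensorProduct.assoc ℂ C B T).toLinearMap ∘ₗ (unitOut H.toRightBicoalgebroid).rTensor T ∘ₗ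
        (H.β.rTensor T ∘ₗ K) := by
    ext t
    rw [LinearMap.comp_apply, hT.left_eq]
    simp only [LinearMap.comp_apply]
    generalize K t = z
    unfold unitOut
    generalize H.α.toLinearMap = a
    induction z with
    | zero => simp
    | add x y hx hy => simp only [map_add, hx, hy]
    | tmul b t => simp [sum_legs (Coalgebra.comul (R := ℂ) (A := B)), TensorProduct.sum_tmul]
  -- the product of the two acting factors may be formed before they act
  have e2 : (act ∘ₗ H.mulE.rTensor T).lTensor C (unitPairFront H T z) =
      (act ∘ₗ act.lTensor B ∘ₗ (TensorProduct.assoc ℂ B B T).toLinearMap ∘ₗ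
        (TensorProduct.comm ℂ B B).toLinearMap.rTensor T).lTensor C (unitPairFront H T z) := by
    refine lTensor_congr (fun p =>
      front (front (copOut H.α.toLinearMap) B) T p = front (behind B (copOut H.β)) T p ∧
      front (front (copOut H.β) B) T p = behind (B ⊗[ℂ] B) (H.β.rTensor T ∘ₗ K) p)
      (fun φ => ⟨?_, ?_⟩) fun p hp => hT.act_assoc p hp.1 hp.2
    · rw [← slice_lTensor, front_unitPairFront_right, slice_lTensor]
    · rw [← slice_lTensor, front_unitPairFront_left, hz, ← behind_unitPairFront, slice_lTensor]
  have e3 : ∀ z : B ⊗[ℂ] T, act.lTensor C (TensorProduct.assoc ℂ C B T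
      ((H.β.rTensor B ∘ₗ Coalgebra.comul).rTensor T z)) =
      (act ∘ₗ H.mulE.rTensor T).lTensor C (unitPairFront H T z) := by
    intro z
    rw [← mulE_unitPair]
    induction z with
    | zero => simp
    | add x y hx hy => simp only [map_add, hx, hy]
    | tmul b t =>
      simp [unitPairFront, sum_legs (unitPair H.toRightBicoalgebroid), TensorProduct.sum_tmul]
  let Ξ : C ⊗[ℂ] (B ⊗[ℂ] T) →ₗ[ℂ] C ⊗[ℂ] T :=
    (act ∘ₗ act.lTensor B).lTensor C ∘ₗ (TensorProduct.leftComm ℂ B C (B ⊗[ℂ] T)).toLinearMap ∘ₗ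
      ((TensorProduct.assoc ℂ C B T).toLinearMap ∘ₗ
        (unitOut H.toRightBicoalgebroid).rTensor T).lTensor B ∘ₗ
      (TensorProduct.leftComm ℂ C B T).toLinearMap
  have e4 : ∀ (l : T →ₗ[ℂ] C ⊗[ℂ] T) (z : B ⊗[ℂ] T), act.lTensor C (behind B (act.lTensor C ∘ₗ
      (TensorProduct.assoc ℂ C B T).toLinearMap ∘ₗ (unitOut H.toRightBicoalgebroid).rTensor T ∘ₗ
        l) z) = Ξ (behind B l z) := by
    intro l z
    induction z with
    | zero => simp
    | add x y hx hy => simp only [map_add, hx, hy]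
    | tmul b t =>
      simp [Ξ, behind, sum_legs l, sum_legs (unitOut H.toRightBicoalgebroid),
        TensorProduct.sum_tmul, TensorProduct.tmul_sum]
  have e5 : ∀ z : B ⊗[ℂ] T, Ξ (front (copOut H.β) T z) =
      (act ∘ₗ act.lTensor B ∘ₗ (TensorProduct.assoc ℂ B B T).toLinearMap ∘ₗ
        (TensorProduct.comm ℂ B B).toLinearMap.rTensor T).lTensor C (unitPairFront H T z) := by
    intro z
    induction z with
    | zero => simp
    | add x y hx hy => simp only [map_add, hx, hy]
    | tmul b t =>
      simp [Ξ, front, unitPairFront, unitPair, sum_legs (copOut H.β),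
        sum_legs (unitOut H.toRightBicoalgebroid),
        TensorProduct.sum_tmul, TensorProduct.tmul_sum]
  rw [e3, e2, e1, e4, ← hz, e5]

end SAYD

/-! ### The action of the coaction of the first factor -/

section LinearAlgebra

variable {X Y Z V W U : Type*} [AddCommGroup X] [Module ℂ X] [AddCommGroup Y] [Module ℂ Y]
  [AddCommGroup Z] [Module ℂ Z] [AddCommGroup V] [Module ℂ V] [AddCommGroup W] [Module ℂ W]
  [AddCommGroup U] [Module ℂ U]

theorem behind_behind_front (k : V →ₗ[ℂ] X ⊗[ℂ] V) (g : W →ₗ[ℂ] Z ⊗[ℂ] W) (x : V ⊗[ℂ] W) :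
    behind X (behind V g) (front k W x) = (front k W).lTensor Z (behind V g x) :=
  (front_lTensor_behind k g x).symm

theorem rTensor_comp_behind (f : X →ₗ[ℂ] Y) (k : W →ₗ[ℂ] X ⊗[ℂ] W) :
    f.rTensor (V ⊗[ℂ] W) ∘ₗ behind V k = behind V (f.rTensor W ∘ₗ k) :=
  LinearMap.ext fun x => rTensor_behind f k x

theorem behind_behind_pair {k : V →ₗ[ℂ] X ⊗[ℂ] V} {d : W →ₗ[ℂ] Y ⊗[ℂ] W} {g : W →ₗ[ℂ] Z ⊗[ℂ] W}
    (h : g.lTensor Y ∘ₗ d = (TensorProduct.leftComm ℂ Z Y W).toLinearMap ∘ₗ d.lTensor Z ∘ₗ g)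
    (x : V ⊗[ℂ] W) :
    behind (X ⊗[ℂ] Y) (behind V g) (pair k d x) = (pair k d).lTensor Z (behind V g x) := by
  induction x with
  | zero => simp
  | add x y hx hy => simp only [map_add, hx, hy]
  | tmul v w =>
    have h1 := congrArg (fun z => (TensorProduct.leftComm ℂ (X ⊗[ℂ] Y) Z (V ⊗[ℂ] W))
      (((TensorProduct.leftComm ℂ V Z W).toLinearMap.lTensor (X ⊗[ℂ] Y))
        (TensorProduct.tensorTensorTensorComm ℂ X V Y (Z ⊗[ℂ] W) (k v ⊗ₜ z))))
      (LinearMap.congr_fun h w)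
    simp [behind, pair, sum_legs k, sum_legs d, sum_legs g, TensorProduct.sum_tmul,
      TensorProduct.tmul_sum] at h1 ⊢
    simp only [Finset.sum_comm (t := legs k _)] at h1 ⊢
    exact h1

end LinearAlgebra

section Theta

variable {C B : Type*} [AddCommGroup C] [Module ℂ C] [Coalgebra ℂ C]
  [AddCommGroup B] [Module ℂ B] [Coalgebra ℂ B] {H : RightHopfCoalgebra C B}
  {A : Type*} [AddCommGroup A] [Module ℂ A] (R : ComoduleRing H A)
  {T : Type*} [AddCommGroup T] [Module ℂ T] {act : B ⊗[ℂ] T →ₗ[ℂ] T} {K : T →ₗ[ℂ] B ⊗[ℂ] T}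
  {D : T →ₗ[ℂ] B ⊗[ℂ] T}

/-- `a ⊗ t ↦ a⁽⁰⁾ ⊗ t ◁ a⁽¹⁾`. -/
def theta (act : B ⊗[ℂ] T →ₗ[ℂ] T) : A ⊗[ℂ] T →ₗ[ℂ] A ⊗[ℂ] T :=
  shiftAct A act ∘ₗ front (out R) T

/-- The tensors of `A ⊗ T` for which `a ⊗ t ↦ a⁽⁰⁾ ⊗ t ◁ a⁽¹⁾` is defined: those with
`a[-1] ⊗ (a[0] ⊗ t) = t[1] ⊗ (a ⊗ t[0])`. -/
def Balanced (K : T →ₗ[ℂ] B ⊗[ℂ] T) (x : A ⊗[ℂ] T) : Prop :=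
  front R.left T x = behind A (H.β.rTensor T ∘ₗ K) x

variable {R}

theorem Balanced.dom {x : A ⊗[ℂ] T} (hx : Balanced R K x) :
    front (copOut H.β) (A ⊗[ℂ] T) (front (out R) T x) =
      behind B (H.β.rTensor _ ∘ₗ behind A K) (front (out R) T x) := by
  rw [front_front (r := R.left) (by rw [front_left_out]), rTensor_comp_behind,
    behind_behind_front, hx]

/-- If `x` is balanced, the left `C`-coaction of `a⁽⁰⁾ ⊗ t ◁ a⁽¹⁾` on its first factor is the left
`C`-coaction of `a ⊗ t` on its last factor. -/
theorem front_left_theta (hT : IsSAYD H act K) {x : A ⊗[ℂ] T} (hx : Balanced R K x) :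
    front R.left T (theta R act x) =
      (theta R act).lTensor C (behind A (H.α.toLinearMap.rTensor T ∘ₗ K) x) := by
  have h := hT.shift.takeuchi hx.dom
  rw [rTensor_comp_behind, behind_behind_front, lTensor_lTensor_apply] at h
  refine Eq.trans ?_ h.symm
  rw [left_eq_out]
  clear h hx
  induction x with
  | zero => simp
  | add x y hx hy => simp only [map_add, hx, hy]
  | tmul a t =>
    have h1 := congrArg (fun z => (shiftAct A act).lTensor C
      ((TensorProduct.leftComm ℂ B C _) ((H.β.rTensor (A ⊗[ℂ] T)).lTensor B
        (((TensorProduct.assoc ℂ B A T).toLinearMap).lTensor B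
          (TensorProduct.assoc ℂ B (B ⊗[ℂ] A) T (z ⊗ₜ t)))))) (out_coassoc R a)
    simp [theta, front, shiftAct, sum_legs (out R), sum_legs (Coalgebra.comul (R := ℂ) (A := B)),
      TensorProduct.sum_tmul, TensorProduct.tmul_sum] at h1 ⊢
    exact h1.symm

theorem nuInvE_nu (H : RightHopfCoalgebra C B) {w : B ⊗[ℂ] B} (hw : w ∈ H.sq) :
    H.nuInvE (H.nu w) = w := by
  have h1 : H.nuInvE (H.nu w) = H.nuInv ⟨H.nu w, H.nu_mem w hw⟩ :=
    ext_apply (H.sq.subtype ∘ₗ H.nuInv) ⟨H.nu w, H.nu_mem w hw⟩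
  rw [h1]
  exact congrArg Subtype.val
    ((LinearEquiv.ofBijective (H.nu.restrict H.nu_mem) H.nu_bijective).symm_apply_apply ⟨w, hw⟩)

/-- `(ν⁻ ⊗ ν⁺) ⊗ (b ⊗ t) ↦ ν⁺ b ⊗ t ◁ ν⁻`. -/
def mulAct (H : RightHopfCoalgebra C B) (act : B ⊗[ℂ] T →ₗ[ℂ] T) :
    (B ⊗[ℂ] B) ⊗[ℂ] (B ⊗[ℂ] T) →ₗ[ℂ] B ⊗[ℂ] T :=
  TensorProduct.map H.mulE act ∘ₗ (TensorProduct.tensorTensorTensorComm ℂ B B B T).toLinearMap ∘ₗ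
    (TensorProduct.comm ℂ B B).toLinearMap.rTensor (B ⊗[ℂ] T)

/-- `u ⊗ (b ⊗ t) ↦ (b⁽²⁾ ⊗ u) ⊗ (b⁽¹⁾ ⊗ t)`. -/
def comulOut (B T : Type*) [AddCommGroup B] [Module ℂ B] [Coalgebra ℂ B] [AddCommGroup T]
    [Module ℂ T] : B ⊗[ℂ] (B ⊗[ℂ] T) →ₗ[ℂ] (B ⊗[ℂ] B) ⊗[ℂ] (B ⊗[ℂ] T) :=
  (TensorProduct.tensorTensorTensorComm ℂ B B B T).toLinearMap ∘ₗ
  ((TensorProduct.comm ℂ B B).toLinearMap ∘ₗ Coalgebra.comul).rTensor (B ⊗[ℂ] T) ∘ₗ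
  (TensorProduct.leftComm ℂ B B T).toLinearMap

theorem hopfAct_eq (z : B ⊗[ℂ] (B ⊗[ℂ] T)) :
    hopfAct H act z = mulAct H act (H.nuInvE.rTensor _ (comulOut B T z)) := by
  rw [hopfAct, LinearMap.rTensor_comp]; rfl

/-- Both sides are the threefold coaction of `a`, with its legs permuted. -/
theorem out_out_comul (a : A) :
    (TensorProduct.tensorTensorTensorComm ℂ B B B A)
      (((TensorProduct.comm ℂ B B).toLinearMap ∘ₗ Coalgebra.comul).rTensor (B ⊗[ℂ] A)
        ((TensorProduct.leftComm ℂ B B A) ((out R).lTensor B (out R a)))) =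
      (Coalgebra.comul (R := ℂ)).rTensor (B ⊗[ℂ] A) ((out R).lTensor B (out R a)) := by
  rw [← out_coassoc]
  generalize out R a = z
  induction z with
  | zero => simp
  | add x y hx hy => simp only [map_add, hx, hy]
  | tmul b a =>
    have h := congrArg ((TensorProduct.assoc ℂ (B ⊗[ℂ] B) B A).toLinearMap ∘ₗ
      ((TensorProduct.comm ℂ B (B ⊗[ℂ] B)).toLinearMap.rTensor A))
      (congrArg (fun w => w ⊗ₜ[ℂ] a) (Coalgebra.coassoc_apply (R := ℂ) b))
    simp [sum_legs (Coalgebra.comul (R := ℂ) (A := B)), TensorProduct.sum_tmul,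
      TensorProduct.tmul_sum] at h ⊢
    exact h

/-- The tensor `a⁽²⁾ ⊗ a⁽³⁾ t⁽¹⁾`, to which `ν⁻¹` is applied when `a⁽¹⁾` acts on a tensor with
coaction `a⁽¹⁾ t⁽¹⁾`, is the value of `ν` at `a⁽²⁾ ⊗ t⁽¹⁾`. -/
theorem nu_out (D : T →ₗ[ℂ] B ⊗[ℂ] T) (x : A ⊗[ℂ] T) :
    comulOut B (A ⊗[ℂ] T) ((front (out R) T).lTensor B (diag H.toRightBicoalgebroid (out R) D x)) =
      H.nu.rTensor _ ((front (out R) T).lTensor (B ⊗[ℂ] B) (pair (out R) D x)) := by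
  induction x with
  | zero => simp
  | add x y hx hy => simp only [map_add, hx, hy]
  | tmul a t =>
    have h := congrArg (fun z => TensorProduct.map
        (H.mulE.lTensor B ∘ₗ (TensorProduct.assoc ℂ B B B).toLinearMap)
        (TensorProduct.assoc ℂ B A T).toLinearMap
      (TensorProduct.tensorTensorTensorComm ℂ (B ⊗[ℂ] B) (B ⊗[ℂ] A) B T (z ⊗ₜ D t)))
      (out_out_comul (R := R) a)
    simp [comulOut, BicoalgebroidData.nu, diag, pair, front, sum_legs (out R), sum_legs D,
      sum_legs (Coalgebra.comul (R := ℂ) (A := B)), TensorProduct.sum_tmul,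
      TensorProduct.tmul_sum] at h ⊢
    exact h

/-- The action of `a⁽¹⁾` commutes with coactions on the other factors. -/
theorem theta_coact {D : T →ₗ[ℂ] B ⊗[ℂ] T} (hD : D ∘ₗ act = act.lTensor B ∘ₗ behind B D)
    (x : A ⊗[ℂ] T) : mulAct H (shiftAct A act)
      ((front (out R) T).lTensor (B ⊗[ℂ] B) (pair (out R) D x)) =
    (H.mulE ∘ₗ (TensorProduct.comm ℂ B B).toLinearMap).rTensor (A ⊗[ℂ] T)
      (pair (out R) D (theta R act x)) := by
  have hD' : ∀ b t, D (act (b ⊗ₜ t)) = act.lTensor B (behind B D (b ⊗ₜ t)) := fun b t =>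
    LinearMap.congr_fun hD (b ⊗ₜ t)
  induction x with
  | zero => simp
  | add x y hx hy => simp only [map_add, hx, hy]
  | tmul a t =>
    have h1 : theta R act (a ⊗ₜ t) = ∑ p ∈ legs (out R) a, p.2 ⊗ₜ act (p.1 ⊗ₜ t) := by
      simp [theta, front, shiftAct, sum_legs (out R) a, TensorProduct.sum_tmul]
    rw [h1]
    simp only [map_sum]
    simp [mulAct, shiftAct, pair, front, behind, hD', sum_legs (out R), sum_legs D t,
      TensorProduct.sum_tmul, TensorProduct.tmul_sum]
    simp only [Finset.sum_comm (t := legs D _)]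

/-- If the coaction of `a ⊗ t` is `a⁽¹⁾ t⁽¹⁾ ⊗ (a⁽⁰⁾ ⊗ t⁽⁰⁾)` then that of `a⁽⁰⁾ ⊗ t ◁ a⁽¹⁾` is
`t⁽¹⁾ a⁽¹⁾ ⊗ (a⁽⁰⁾ ⊗ t⁽⁰⁾)`: by the anti Yetter–Drinfeld condition the coaction involves
`ν⁻¹(a⁽²⁾ ⊗ a⁽³⁾ t⁽¹⁾) = a⁽²⁾ ⊗ t⁽¹⁾`. -/
theorem behind_theta (hT : IsSAYD H act K) {x : A ⊗[ℂ] T} (hx : Balanced R K x)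
    (hD : D ∘ₗ act = act.lTensor B ∘ₗ behind B D)
    (hsq : front (front (copOut H.α.toLinearMap) B) (A ⊗[ℂ] T) (pair (out R) D x) =
      front (behind B (copOut H.β)) (A ⊗[ℂ] T) (pair (out R) D x))
    (hE : diag H.toRightBicoalgebroid (out R) D x = behind A K x) :
    (H.mulE ∘ₗ (TensorProduct.comm ℂ B B).toLinearMap).rTensor (A ⊗[ℂ] T)
      (pair (out R) D (theta R act x)) = behind A K (theta R act x) := by
  have h1 := hT.shift.ayd _ hx.dom
  rw [behind_behind_front, ← hE, hopfAct_eq, nu_out] at h1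
  have h2 := rTensor_congr_sq H.toRightBicoalgebroid (F := H.nuInvE ∘ₗ H.nu) (G := LinearMap.id)
    (fun w hw => nuInvE_nu H hw)
    (y := (front (out R) T).lTensor (B ⊗[ℂ] B) (pair (out R) D x))
    (by rw [front_lTensor, front_lTensor, hsq])
  rw [LinearMap.rTensor_id, ← rTensor_rTensor_apply] at h2
  rw [← theta_coact hD]
  refine Eq.trans ?_ h1.symm
  exact (congrArg (mulAct H (shiftAct A act)) h2).symm

/-- `ν⁻¹(b⁽¹⁾ ⊗ b⁽²⁾) = b⁽¹⁾ ⊗ η(α(b⁽²⁾))`. -/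
theorem nuInvE_comul (H : RightHopfCoalgebra C B) (b : B) :
    H.nuInvE (Coalgebra.comul (R := ℂ) b) = H.η.lTensor B (H.right b) := by
  have hsq : H.η.lTensor B (H.right b) ∈ H.sq := by
    refine (mem_sq_iff H.toRightBicoalgebroid).2 ?_
    have h1 : copOut H.β ∘ₗ H.η = H.η.lTensor C ∘ₗ Coalgebra.comul := LinearMap.ext H.left_η
    have h2 : Coalgebra.comul (R := ℂ) ∘ₗ H.α.toLinearMap =
        TensorProduct.map H.α.toLinearMap H.α.toLinearMap ∘ₗ Coalgebra.comul :=
      (CoalgHomClass.map_comp_comul H.α).symm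
    have h3 : ∀ w : B ⊗[ℂ] C, behind B (copOut H.β) (H.η.lTensor B w) =
        (TensorProduct.leftComm ℂ B C B) ((copOut H.β ∘ₗ H.η).lTensor B w) := by
      intro w
      rw [← lTensor_lTensor_apply]; rfl
    have h4 := congrArg ((TensorProduct.leftComm ℂ B C B).toLinearMap ∘ₗ (TensorProduct.map
      H.α.toLinearMap (H.η ∘ₗ H.α.toLinearMap)).lTensor B) (Coalgebra.coassoc_apply (R := ℂ) b)
    have h5 : H.right b = H.α.toLinearMap.lTensor B (Coalgebra.comul (R := ℂ) b) := rfl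
    rw [h3, h1, LinearMap.lTensor_comp, LinearMap.comp_apply, h5, lTensor_lTensor_apply
      H.α.toLinearMap (Coalgebra.comul (R := ℂ) (A := C)), h2]
    generalize H.α.toLinearMap = a at h4 ⊢
    simp [copOut, front, sum_legs (Coalgebra.comul (R := ℂ) (A := B)), TensorProduct.sum_tmul,
      TensorProduct.tmul_sum] at h4 ⊢
    exact h4
  have h : H.nu (H.η.lTensor B (H.right b)) = Coalgebra.comul (R := ℂ) b := by
    have h1 : H.mulE ∘ₗ H.η.lTensor B ∘ₗ H.right = LinearMap.id := LinearMap.ext H.mul_unit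
    have h2 := congrArg ((H.mulE ∘ₗ H.η.lTensor B).lTensor B ∘ₗ
      (H.α.toLinearMap.lTensor B).lTensor B) (Coalgebra.coassoc_apply (R := ℂ) b)
    have h3 := congrArg (fun f => f.lTensor B (Coalgebra.comul (R := ℂ) b)) h1
    simp [BicoalgebroidData.nu, BicoalgebroidData.right, baseRight,
      sum_legs (Coalgebra.comul (R := ℂ) (A := B)), TensorProduct.sum_tmul,
      TensorProduct.tmul_sum] at h2 h3 ⊢
    rw [h2, h3]
  rw [← h, nuInvE_nu H hsq]

end Theta

section Theta

variable {C B : Type*} [AddCommGroup C] [Module ℂ C] [Coalgebra ℂ C]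
  [AddCommGroup B] [Module ℂ B] [Coalgebra ℂ B] {H : RightHopfCoalgebra C B}
  {A : Type*} [AddCommGroup A] [Module ℂ A] {R : ComoduleRing H A}
  {T : Type*} [AddCommGroup T] [Module ℂ T] {act : B ⊗[ℂ] T →ₗ[ℂ] T} {K : T →ₗ[ℂ] B ⊗[ℂ] T}
  {D : T →ₗ[ℂ] B ⊗[ℂ] T}

theorem comulOut_out (x : A ⊗[ℂ] T) :
    comulOut B (A ⊗[ℂ] T) ((front (out R) T).lTensor B (front (out R) T x)) =
      (Coalgebra.comul (R := ℂ)).rTensor _ ((front (out R) T).lTensor B (front (out R) T x)) := by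
  induction x with
  | zero => simp
  | add x y hx hy => simp only [map_add, hx, hy]
  | tmul a t =>
    have h := congrArg (fun z => ((TensorProduct.assoc ℂ B A T).toLinearMap.lTensor (B ⊗[ℂ] B))
      (TensorProduct.assoc ℂ (B ⊗[ℂ] B) (B ⊗[ℂ] A) T (z ⊗ₜ t))) (out_out_comul (R := R) a)
    simp [comulOut, front, sum_legs (out R), sum_legs (Coalgebra.comul (R := ℂ) (A := B)),
      TensorProduct.sum_tmul, TensorProduct.tmul_sum] at h ⊢
    exact h

/-- `c ⊗ (b ⊗ t) ↦ η(c) b ⊗ t`. -/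
def unitMul (H : RightHopfCoalgebra C B) (T : Type*) [AddCommGroup T] [Module ℂ T] :
    C ⊗[ℂ] (B ⊗[ℂ] T) →ₗ[ℂ] B ⊗[ℂ] T :=
  (H.mulE ∘ₗ H.η.rTensor B).rTensor T ∘ₗ (TensorProduct.assoc ℂ C B T).symm.toLinearMap

/-- The left unit law of `B`. -/
theorem unitMul_front (z : B ⊗[ℂ] T) : unitMul H T (front (copOut H.β) T z) = z := by
  have h : (H.mulE ∘ₗ H.η.rTensor B) ∘ₗ copOut H.β = LinearMap.id := LinearMap.ext H.unit_mul
  rw [unitMul, LinearMap.comp_apply, front, LinearMap.comp_apply, LinearEquiv.coe_coe,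
    LinearEquiv.coe_coe, LinearEquiv.symm_apply_apply, rTensor_rTensor_apply, h,
    LinearMap.rTensor_id]
  rfl

theorem mulAct_unit_out (x : A ⊗[ℂ] T) :
    mulAct H (shiftAct A act) ((H.η.lTensor B ∘ₗ H.right).rTensor _
        ((front (out R) T).lTensor B (front (out R) T x))) =
      unitMul H _ ((front (out R) T ∘ₗ theta R act).lTensor C
        (H.α.toLinearMap.rTensor _ (front (out R) T x))) := by
  induction x with
  | zero => simp
  | add x y hx hy => simp only [map_add, hx, hy]
  | tmul a t =>
    -- `f` sends `b ⊗ (b' ⊗ (b'' ⊗ a))` to `η(α(b)) b'' ⊗ (a ⊗ t ◁ b')`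
    let f : B ⊗[ℂ] (B ⊗[ℂ] (B ⊗[ℂ] A)) →ₗ[ℂ] B ⊗[ℂ] (A ⊗[ℂ] T) :=
      (unitMul H (A ⊗[ℂ] T)) ∘ₗ TensorProduct.map H.α.toLinearMap
        ((TensorProduct.assoc ℂ B A T).toLinearMap ∘ₗ
          (TensorProduct.comm ℂ T (B ⊗[ℂ] A)).toLinearMap ∘ₗ
          (act ∘ₗ (TensorProduct.mk ℂ B T).flip t).rTensor (B ⊗[ℂ] A))
    have h := congrArg (fun z => f (((out R).lTensor B).lTensor B z)) (out_coassoc R a)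
    simp [f, mulAct, unitMul, theta, shiftAct, BicoalgebroidData.right, baseRight, front,
      sum_legs (out R), sum_legs (Coalgebra.comul (R := ℂ) (A := B)), TensorProduct.sum_tmul,
      TensorProduct.tmul_sum] at h ⊢
    simp only [Finset.sum_comm (t := legs (Coalgebra.comul (R := ℂ) (A := B)) _)]
    exact h

/-- The case of a single factor `A`, where `ν⁻¹(a⁽²⁾ ⊗ a⁽³⁾) = a⁽²⁾ ⊗ η(α(a⁽³⁾))`. -/
theorem behind_theta_of_out (hT : IsSAYD H act K) {x : A ⊗[ℂ] T} (hx : Balanced R K x)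
    (hE : front (out R) T x = behind A K x) :
    front (out R) T (theta R act x) = behind A K (theta R act x) := by
  have h1 := hT.shift.ayd _ hx.dom
  have h2 : H.nuInvE ∘ₗ Coalgebra.comul = H.η.lTensor B ∘ₗ H.right :=
    LinearMap.ext (nuInvE_comul H)
  rw [behind_behind_front, ← hE, hopfAct_eq, comulOut_out, rTensor_rTensor_apply, h2,
    mulAct_unit_out, hE, rTensor_behind, ← lTensor_lTensor_apply, ← front_left_theta hT hx,
    ← front_front (f := copOut H.β) (by rw [front_left_out]), unitMul_front] at h1
  rw [← hE] at h1
  exact h1.symm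

/-- Acting by the coaction of `a⁽⁰⁾ ⊗ t ◁ a⁽¹⁾` on the second factor is acting by
`a⁽¹⁾ t⁽¹⁾`. -/
theorem act_theta (hT : IsSAYD H act K) {x : A ⊗[ℂ] T} (hx : Balanced R K x)
    (hD : D ∘ₗ act = act.lTensor B ∘ₗ behind B D)
    (hK : (H.β.rTensor T ∘ₗ K).lTensor B ∘ₗ D = (TensorProduct.leftComm ℂ C B T).toLinearMap ∘ₗ
      D.lTensor C ∘ₗ (H.β.rTensor T ∘ₗ K))
    (hsq : front (front (copOut H.α.toLinearMap) B) (A ⊗[ℂ] T) (pair (out R) D x) =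
      front (behind B (copOut H.β)) (A ⊗[ℂ] T) (pair (out R) D x)) :
    (act ∘ₗ D).lTensor A (theta R act x) =
      shiftAct A act (diag H.toRightBicoalgebroid (out R) D x) := by
  have h := hT.shift.act_assoc (pair (out R) D x) hsq (by
    rw [front_front_pair (r := R.left) (by rw [front_left_out]), rTensor_comp_behind,
      behind_behind_pair hK, hx])
  refine Eq.trans ?_ h.symm
  have hD' : ∀ b t, D (act (b ⊗ₜ t)) = act.lTensor B (behind B D (b ⊗ₜ t)) := fun b t =>
    LinearMap.congr_fun hD (b ⊗ₜ t)
  clear h hsq hx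
  induction x with
  | zero => simp
  | add x y hx hy => simp only [map_add, hx, hy]
  | tmul a t =>
    simp [theta, shiftAct, pair, front, behind, hD', sum_legs (out R), sum_legs D t,
      TensorProduct.sum_tmul, TensorProduct.tmul_sum]
    simp only [Finset.sum_comm (t := legs D _)]

end Theta

/-! ### Permuted coactions -/

section LinearAlgebra

variable {X Y Z V W U : Type*} [AddCommGroup X] [Module ℂ X] [AddCommGroup Y] [Module ℂ Y]
  [AddCommGroup Z] [Module ℂ Z] [AddCommGroup V] [Module ℂ V] [AddCommGroup W] [Module ℂ W]
  [AddCommGroup U] [Module ℂ U]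

theorem front_leftComm (f : V →ₗ[ℂ] Z ⊗[ℂ] V) (x : U ⊗[ℂ] (V ⊗[ℂ] W)) :
    front f (U ⊗[ℂ] W) (TensorProduct.leftComm ℂ U V W x) =
      (TensorProduct.leftComm ℂ U V W).toLinearMap.lTensor Z (behind U (front f W) x) := by
  induction x using TensorProduct.induction_on with
  | zero => simp
  | add x y hx hy => simp only [map_add, hx, hy]
  | tmul u y =>
    induction y using TensorProduct.induction_on with
    | zero => simp
    | add x y hx hy => simp only [TensorProduct.tmul_add, map_add, hx, hy]
    | tmul v w =>
      simp [front, behind, sum_legs f, TensorProduct.sum_tmul, TensorProduct.tmul_sum]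

theorem behind_front_leftComm (f : U →ₗ[ℂ] Z ⊗[ℂ] U) (x : U ⊗[ℂ] (V ⊗[ℂ] W)) :
    behind V (front f W) (TensorProduct.leftComm ℂ U V W x) =
      (TensorProduct.leftComm ℂ U V W).toLinearMap.lTensor Z (front f (V ⊗[ℂ] W) x) := by
  induction x using TensorProduct.induction_on with
  | zero => simp
  | add x y hx hy => simp only [map_add, hx, hy]
  | tmul u y =>
    induction y using TensorProduct.induction_on with
    | zero => simp
    | add x y hx hy => simp only [TensorProduct.tmul_add, map_add, hx, hy]
    | tmul v w =>
      simp [front, behind, sum_legs f, TensorProduct.sum_tmul, TensorProduct.tmul_sum]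

theorem behind_behind_leftComm (f : W →ₗ[ℂ] Z ⊗[ℂ] W) (x : U ⊗[ℂ] (V ⊗[ℂ] W)) :
    behind V (behind U f) (TensorProduct.leftComm ℂ U V W x) =
      (TensorProduct.leftComm ℂ U V W).toLinearMap.lTensor Z (behind U (behind V f) x) := by
  induction x using TensorProduct.induction_on with
  | zero => simp
  | add x y hx hy => simp only [map_add, hx, hy]
  | tmul u y =>
    induction y using TensorProduct.induction_on with
    | zero => simp
    | add x y hx hy => simp only [TensorProduct.tmul_add, map_add, hx, hy]
    | tmul v w => simp [behind, sum_legs f, TensorProduct.tmul_sum]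

theorem pair_leftComm (k : V →ₗ[ℂ] X ⊗[ℂ] V) (k' : U →ₗ[ℂ] Y ⊗[ℂ] U) (d : W →ₗ[ℂ] Z ⊗[ℂ] W)
    (x : V ⊗[ℂ] (U ⊗[ℂ] W)) :
    pair k' (pair k d) (TensorProduct.leftComm ℂ V U W x) =
      (TensorProduct.leftComm ℂ X Y Z).toLinearMap.rTensor _
        ((TensorProduct.leftComm ℂ V U W).toLinearMap.lTensor _ (pair k (pair k' d) x)) := by
  induction x using TensorProduct.induction_on with
  | zero => simp
  | add x y hx hy => simp only [map_add, hx, hy]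
  | tmul v y =>
    induction y using TensorProduct.induction_on with
    | zero => simp
    | add x y hx hy => simp only [TensorProduct.tmul_add, map_add, hx, hy]
    | tmul u w =>
      simp [pair, sum_legs k, sum_legs k', sum_legs d, TensorProduct.sum_tmul,
        TensorProduct.tmul_sum]
      simp only [Finset.sum_comm (t := legs k _)]

theorem lTensor_eq_self {f : V →ₗ[ℂ] V} (h : ∀ v, f v = v) (z : Z ⊗[ℂ] V) :
    f.lTensor Z z = z := by
  rw [show f = LinearMap.id from LinearMap.ext h, LinearMap.lTensor_id]
  rfl

theorem slice_slice_leftComm (φ : V →ₗ[ℂ] ℂ) (ψ : U →ₗ[ℂ] ℂ) (x : U ⊗[ℂ] (V ⊗[ℂ] W)) :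
    slice ψ W (slice φ (U ⊗[ℂ] W) (TensorProduct.leftComm ℂ U V W x)) =
      slice φ W (slice ψ (V ⊗[ℂ] W) x) := by
  induction x using TensorProduct.induction_on with
  | zero => simp
  | add x y hx hy => simp only [map_add, hx, hy]
  | tmul u y =>
    induction y using TensorProduct.induction_on with
    | zero => simp
    | add x y hx hy => simp only [TensorProduct.tmul_add, map_add, hx, hy]
    | tmul v w => simpa [slice] using smul_comm _ _ _

end LinearAlgebra

/-! ### Moving the first factor to the end -/

section Op

variable {C B : Type*} [AddCommGroup C] [Module ℂ C] [Coalgebra ℂ C]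
  [AddCommGroup B] [Module ℂ B] [Coalgebra ℂ B] (H : RightBicoalgebroid C B)
  {E E' T : Type*} [AddCommGroup E] [Module ℂ E] [AddCommGroup E'] [Module ℂ E']
  [AddCommGroup T] [Module ℂ T]

/-- `e ⊗ t ↦ t⁽¹⁾ e⁽¹⁾ ⊗ (e⁽⁰⁾ ⊗ t⁽⁰⁾)`. -/
def opDiag (k : E →ₗ[ℂ] B ⊗[ℂ] E) (d : T →ₗ[ℂ] B ⊗[ℂ] T) : E ⊗[ℂ] T →ₗ[ℂ] B ⊗[ℂ] (E ⊗[ℂ] T) :=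
  (H.mulE ∘ₗ (TensorProduct.comm ℂ B B).toLinearMap).rTensor (E ⊗[ℂ] T) ∘ₗ pair k d

variable {k : E →ₗ[ℂ] B ⊗[ℂ] E} {k' : E' →ₗ[ℂ] B ⊗[ℂ] E'} {d : T →ₗ[ℂ] B ⊗[ℂ] T}
  {r : E →ₗ[ℂ] C ⊗[ℂ] E} {l r' : T →ₗ[ℂ] C ⊗[ℂ] T} {l' : E' →ₗ[ℂ] C ⊗[ℂ] E'}

/-- Associativity `e (t e') = (e t) e'` of the product of coactions. -/
theorem diag_opDiag {x : E ⊗[ℂ] (E' ⊗[ℂ] T)}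
    (hk : front (copOut H.α.toLinearMap) E ∘ₗ k = k.lTensor C ∘ₗ r)
    (hk' : front (copOut H.β) E' ∘ₗ k' = k'.lTensor C ∘ₗ l')
    (hl : ((front (copOut H.β) T ∘ₗ d).lTensor E').lTensor E x =
      ((d.lTensor C ∘ₗ l).lTensor E').lTensor E x)
    (hr : ((front (copOut H.α.toLinearMap) T ∘ₗ d).lTensor E').lTensor E x =
      ((d.lTensor C ∘ₗ r').lTensor E').lTensor E x)
    (h1 : front r (E' ⊗[ℂ] T) x = behind E (behind E' l) x)
    (h2 : behind E (behind E' r') x = behind E (front l' T) x) :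
    (TensorProduct.leftComm ℂ E E' T).toLinearMap.lTensor B (diag H k (opDiag H k' d) x) =
      opDiag H k' (diag H k d) (TensorProduct.leftComm ℂ E E' T x) := by
  have e1 : diag H k (opDiag H k' d) x =
      (H.mulE ∘ₗ (H.mulE ∘ₗ (TensorProduct.comm ℂ B B).toLinearMap).lTensor B).rTensor _
        (pair k (pair k' d) x) := by
    rw [diag, opDiag, LinearMap.comp_apply, pair_rTensor_comp, rTensor_rTensor_apply]
  have e2 : opDiag H k' (diag H k d) (TensorProduct.leftComm ℂ E E' T x) =
      (TensorProduct.leftComm ℂ E E' T).toLinearMap.lTensor B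
        ((H.mulE ∘ₗ H.mulE.rTensor B ∘ₗ (TensorProduct.assoc ℂ B B B).symm.toLinearMap ∘ₗ
          (TensorProduct.comm ℂ B B).toLinearMap.lTensor B).rTensor _
          (pair k (pair k' d) x)) := by
    rw [diag, opDiag, LinearMap.comp_apply, pair_rTensor_comp, rTensor_rTensor_apply,
      pair_leftComm, rTensor_rTensor_apply, rTensor_lTensor_apply]
    congr 2
    refine congrArg (fun f => LinearMap.rTensor _ f) ?_
    ext b b' b''
    simp
  rw [e1, e2]
  refine congrArg _ ?_
  refine rTensor_congr_of_eq₂ (f := front (copOut H.α.toLinearMap) (B ⊗[ℂ] B))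
    (g := behind B (behind B (copOut H.β))) (f' := behind B (behind B (copOut H.α.toLinearMap)))
    (g' := behind B (front (copOut H.β) B))
    (fun w hw hw' => ?_) (rTensor_eq_of_front ?_) (rTensor_eq_of_front ?_)
  · have hf : ∀ f : B →ₗ[ℂ] C ⊗[ℂ] B, front f B ∘ₗ (TensorProduct.comm ℂ B B).toLinearMap =
        (TensorProduct.comm ℂ B B).toLinearMap.lTensor C ∘ₗ behind B f :=
      fun f => LinearMap.ext fun x => front_comm f x
    have hb : ∀ f : B →ₗ[ℂ] C ⊗[ℂ] B, behind B f ∘ₗ (TensorProduct.comm ℂ B B).toLinearMap =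
        (TensorProduct.comm ℂ B B).toLinearMap.lTensor C ∘ₗ front f B :=
      fun f => LinearMap.ext fun x => behind_comm f x
    rw [LinearMap.lTensor_comp]
    refine mulE_assoc H (x := (TensorProduct.comm ℂ B B).toLinearMap.lTensor B w) ?_ ?_
    · rw [front_lTensor, hw, behind_lTensor (by rw [hf])]
    · rw [behind_lTensor (by rw [hf]), hw', behind_lTensor (by rw [hb])]
  · have q1 : front (front (copOut H.α.toLinearMap) (B ⊗[ℂ] B)) _ (pair k (pair k' d) x) =
        (pair k (pair k' d)).lTensor C (front r (E' ⊗[ℂ] T) x) := front_front_pair (by rw [hk])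
    have q2 : front (behind B (behind B (copOut H.β))) _ (pair k (pair k' d) x) =
        (pair k (pair k' d)).lTensor C (behind E (behind E' l) x) :=
      front_behind_pair (lTensor_congr_of_eq (fun w hw => front_behind_pair hw) hl)
    rw [q1, q2, h1]
  · have q1 : front (behind B (behind B (copOut H.α.toLinearMap))) _ (pair k (pair k' d) x) =
        (pair k (pair k' d)).lTensor C (behind E (behind E' r') x) :=
      front_behind_pair (lTensor_congr_of_eq (fun w hw => front_behind_pair hw) hr)
    have q2 : front (behind B (front (copOut H.β) B)) _ (pair k (pair k' d) x) =
        (pair k (pair k' d)).lTensor C (behind E (front l' T) x) := by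
      refine front_behind_pair (congrArg (fun f => LinearMap.lTensor E f x) ?_)
      exact LinearMap.ext fun w => front_front_pair (by rw [hk'])
    rw [q1, q2, h2]

theorem diag_front_leftComm (k' : E' →ₗ[ℂ] B ⊗[ℂ] E') (k : E →ₗ[ℂ] B ⊗[ℂ] E)
    (x : E' ⊗[ℂ] (E ⊗[ℂ] T)) :
    diag H k (front k' T) (TensorProduct.leftComm ℂ E' E T x) =
      (TensorProduct.leftComm ℂ E' E T).toLinearMap.lTensor B (opDiag H k' (front k T) x) := by
  induction x using TensorProduct.induction_on with
  | zero => simp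
  | add x y hx hy => simp only [map_add, hx, hy]
  | tmul e' y =>
    induction y using TensorProduct.induction_on with
    | zero => simp
    | add x y hx hy => simp only [TensorProduct.tmul_add, map_add, hx, hy]
    | tmul e t =>
      simp [opDiag, diag, pair, front, sum_legs k, sum_legs k', TensorProduct.sum_tmul,
        TensorProduct.tmul_sum]
      simp only [Finset.sum_comm (t := legs k _)]

end Op

section Words

variable {C B : Type*} [AddCommGroup C] [Module ℂ C] [Coalgebra ℂ C]
  [AddCommGroup B] [Module ℂ B] [Coalgebra ℂ B] {H : RightHopfCoalgebra C B}
  {A M : Type u} [AddCommGroup A] [Module ℂ A] [AddCommGroup M] [Module ℂ M]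
  {Z : Type*} [AddCommGroup Z] [Module ℂ Z]

variable (A M) in
/-- `a ⊗ (a₁ ⊗ ⋯ ⊗ aₙ ⊗ m) ↦ a₁ ⊗ ⋯ ⊗ aₙ ⊗ a ⊗ m`. -/
def rotate : (n : ℕ) → (A ⊗[ℂ] TW A M n →ₗ[ℂ] TW A M (n + 1))
  | 0 => (TW.succ A M 0).symm.toLinearMap
  | n + 1 => (TW.succ A M (n + 1)).symm.toLinearMap ∘ₗ (rotate n).lTensor A ∘ₗ
      (TensorProduct.leftComm ℂ A A (TW A M n)).toLinearMap ∘ₗ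
      (TW.succ A M n).toLinearMap.lTensor A

theorem rotate_succ (n : ℕ) : rotate A M (n + 1) = (rotate A M n).lTensor A ∘ₗ
    (TensorProduct.leftComm ℂ A A (TW A M n)).toLinearMap :=
  LinearMap.ext fun x => congrArg (fun z => (rotate A M n).lTensor A
    (TensorProduct.leftComm ℂ A A (TW A M n) z)) (lTensor_succ n x)

theorem lTensor_rotate_zero (z : Z ⊗[ℂ] (A ⊗[ℂ] TW A M 0)) :
    (rotate A M 0).lTensor Z z = z :=
  LinearMap.congr_fun (LinearMap.lTensor_id Z (A ⊗[ℂ] TW A M 0)) z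

theorem lTensor_rotate_succ (n : ℕ) (z : Z ⊗[ℂ] (A ⊗[ℂ] (A ⊗[ℂ] TW A M n))) :
    (rotate A M (n + 1)).lTensor Z z = ((rotate A M n).lTensor A).lTensor Z
      ((TensorProduct.leftComm ℂ A A (TW A M n)).toLinearMap.lTensor Z z) :=
  (congrArg (fun f => LinearMap.lTensor Z f z) (rotate_succ n)).trans
    (LinearMap.congr_fun (LinearMap.lTensor_comp _ _ _) z)

theorem coactAt_rotate_castSucc (k : A →ₗ[ℂ] Z ⊗[ℂ] A) {n : ℕ} (i : Fin n) (y : A ⊗[ℂ] TW A M n) :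
    coactAt k (n + 1) i.castSucc (rotate A M n y) =
      (rotate A M n).lTensor Z (behind A (coactAt k n i) y) := by
  induction n with
  | zero => exact i.elim0
  | succ n ih =>
    refine Eq.trans ?_ (lTensor_rotate_succ n _).symm
    rw [rotate_succ]
    refine Fin.cases ?_ (fun i => ?_) i
    · rw [Fin.castSucc_zero, coactAt_zero, coactAt_zero]
      exact (front_lTensor _ _ _).trans (congrArg _ (front_leftComm k y))
    · rw [Fin.castSucc_succ, coactAt_succ, coactAt_succ]
      refine (behind_lTensor ?_).trans (congrArg _ (behind_behind_leftComm (coactAt k n i) y))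
      exact congrArg (fun f => LinearMap.lTensor A f _) (LinearMap.ext (ih i))

theorem coactAt_rotate_last (k : A →ₗ[ℂ] Z ⊗[ℂ] A) {n : ℕ} (y : A ⊗[ℂ] TW A M n) :
    coactAt k (n + 1) (Fin.last n) (rotate A M n y) =
      (rotate A M n).lTensor Z (front k (TW A M n) y) := by
  induction n with
  | zero =>
    rw [Fin.last_zero, coactAt_zero]
    exact (lTensor_rotate_zero _).symm
  | succ n ih =>
    refine Eq.trans ?_ (lTensor_rotate_succ n _).symm
    rw [rotate_succ, ← Fin.succ_last, coactAt_succ]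
    refine (behind_lTensor ?_).trans (congrArg _ (behind_front_leftComm k y))
    exact congrArg (fun f => LinearMap.lTensor A f _) (LinearMap.ext ih)

theorem coactLast_rotate (f : M →ₗ[ℂ] Z ⊗[ℂ] M) {n : ℕ} (y : A ⊗[ℂ] TW A M n) :
    coactLast f (n + 1) (rotate A M n y) =
      (rotate A M n).lTensor Z (behind A (coactLast f n) y) := by
  induction n with
  | zero =>
    rw [coactLast_succ]
    exact (lTensor_rotate_zero _).symm
  | succ n ih =>
    refine Eq.trans ?_ (lTensor_rotate_succ n _).symm
    rw [rotate_succ, coactLast_succ f (n + 1)]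
    conv_rhs => rw [coactLast_succ f n]
    refine (behind_lTensor ?_).trans (congrArg _ (behind_behind_leftComm (coactLast f n) y))
    exact congrArg (fun f => LinearMap.lTensor A f _) (LinearMap.ext ih)

variable {R : ComoduleRing H A}

/-- Rotation preserves the cotensor conditions, if the factor that is moved satisfies the condition
with its new left neighbour. -/
theorem rotate_mem_chain {m : ℕ} {y : A ⊗[ℂ] TW A M (m + 1)}
    (hy : ∀ φ : A →ₗ[ℂ] ℂ, slice φ (TW A M (m + 1)) y ∈ chain M R m)
    (hc : behind A (coactAt (rightOut R) (m + 1) (Fin.last m)) y =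
      front R.left (TW A M (m + 1)) y) :
    rotate A M (m + 1) y ∈ chain M R (m + 1) := by
  refine (mem_chain_iff R).2 fun i => ?_
  refine Fin.lastCases ?_ (fun i => ?_) i
  · rw [Fin.succ_last, coactAt_rotate_last, coactAt_rotate_castSucc, hc]
  · rw [coactAt_rotate_castSucc, Fin.succ_castSucc, coactAt_rotate_castSucc]
    refine congrArg _ (behind_congr ?_)
    exact lTensor_congr (· ∈ chain M R m) hy fun w hw => (mem_chain_iff R).1 hw i

/-- The diagonal coaction of the rotated tensor. -/
theorem coactDiag_rotate {m : ℕ} {y : A ⊗[ℂ] TW A M (m + 1)}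
    (hy : ∀ φ : A →ₗ[ℂ] ℂ, slice φ (TW A M (m + 1)) y ∈ chain M R m)
    (hc : behind A (coactAt (rightOut R) (m + 1) (Fin.last m)) y =
      front R.left (TW A M (m + 1)) y) :
    coactDiag R (m + 1) (rotate A M (m + 1) y) = (rotate A M (m + 1)).lTensor B
      (opDiag H.toRightBicoalgebroid (out R) (coactDiag R m) y) := by
  induction m with
  | zero =>
    rw [coactDiag_succ, coactDiag_zero]
    refine Eq.trans ?_ (lTensor_rotate_succ 0 _).symm
    refine Eq.trans ?_ (congrArg _ (diag_front_leftComm H.toRightBicoalgebroid (out R) (out R)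
      (T := TW A M 0) y))
    rw [rotate_succ]
    refine Eq.trans ?_ (lTensor_eq_self (f := (rotate A M 0).lTensor A)
      (fun z => lTensor_rotate_zero z) _).symm
    exact congrArg _ (lTensor_rotate_zero (TensorProduct.leftComm ℂ A A (TW A M 0) y))
  | succ m ih =>
    let x : A ⊗[ℂ] (A ⊗[ℂ] TW A M (m + 1)) := TensorProduct.leftComm ℂ A A (TW A M (m + 1)) y
    have hx : TensorProduct.leftComm ℂ A A (TW A M (m + 1)) x = y := leftComm_leftComm _
    have hs : ∀ φ ψ : A →ₗ[ℂ] ℂ, slice ψ (TW A M (m + 1)) (slice φ (A ⊗[ℂ] TW A M (m + 1)) x) ∈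
        chain M R m := by
      intro φ ψ
      have h1 := slice_slice_leftComm φ ψ (W := TW A M (m + 1)) y
      exact h1 ▸ ((mem_chain_succ R).1 (hy ψ)).2 φ
    have hc' : behind A (behind A (coactAt (rightOut R) (m + 1) (Fin.last m))) x =
        behind A (front R.left (TW A M (m + 1))) x := by
      rw [← Fin.succ_last, coactAt_succ] at hc
      exact (behind_behind_leftComm (coactAt (rightOut R) (m + 1) (Fin.last m)) y).trans
        ((congrArg _ hc).trans (behind_front_leftComm R.left (W := TW A M (m + 1)) y).symm)
    have h1 : front (rightOut R) (A ⊗[ℂ] TW A M (m + 1)) x =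
        behind A (behind A (front R.left (TW A M m))) x := by
      have h2 : behind A (front (rightOut R) (TW A M (m + 1))) y =
          behind A (behind A (front R.left (TW A M m))) y :=
        behind_congr (lTensor_congr (· ∈ chain M R (m + 1)) hy
          fun w hw => ((mem_chain_succ R).1 hw).1)
      exact (front_leftComm (rightOut R) (W := TW A M (m + 1)) y).trans ((congrArg _ h2).trans
        (behind_behind_leftComm (front R.left (TW A M m)) y).symm)
    have h3 := diag_opDiag H.toRightBicoalgebroid (k := out R) (k' := out R) (d := coactDiag R m)
      (r' := coactAt (rightOut R) (m + 1) (Fin.last m)) (x := x) (front_right_out R)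
      (front_left_out R)
      (lTensor_congr (fun w => ∀ ψ : A →ₗ[ℂ] ℂ, slice ψ (TW A M (m + 1)) w ∈ chain M R m) hs
        fun w hw => lTensor_congr (· ∈ chain M R m) hw fun w hw => front_left_coactDiag hw)
      (lTensor_congr (fun w => ∀ ψ : A →ₗ[ℂ] ℂ, slice ψ (TW A M (m + 1)) w ∈ chain M R m) hs
        fun w hw => lTensor_congr (· ∈ chain M R m) hw fun w hw => front_right_coactDiag hw)
      h1 hc'
    rw [hx] at h3
    have h4 : diag H.toRightBicoalgebroid (out R) (coactDiag R (m + 1))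
        ((rotate A M (m + 1)).lTensor A x) = ((rotate A M (m + 1)).lTensor A).lTensor B
          (diag H.toRightBicoalgebroid (out R)
            (opDiag H.toRightBicoalgebroid (out R) (coactDiag R m)) x) := by
      refine diag_lTensor _ ?_
      refine lTensor_congr (fun w =>
        (∀ ψ : A →ₗ[ℂ] ℂ, slice ψ (TW A M (m + 1)) w ∈ chain M R m) ∧
        behind A (coactAt (rightOut R) (m + 1) (Fin.last m)) w =
          front R.left (TW A M (m + 1)) w)
        (fun φ => ⟨hs φ, ?_⟩) fun w hw => ih hw.1 hw.2
      rw [← slice_lTensor, lTensor_eq_of_behind hc', slice_lTensor]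
    rw [coactDiag_succ R (m + 1)]
    refine Eq.trans ?_ (lTensor_rotate_succ (m + 1) _).symm
    rw [rotate_succ]
    refine h4.trans ?_
    have h5 : diag H.toRightBicoalgebroid (out R)
          (opDiag H.toRightBicoalgebroid (out R) (coactDiag R m)) x =
        (TensorProduct.leftComm ℂ A A (TW A M (m + 1))).toLinearMap.lTensor B
          (opDiag H.toRightBicoalgebroid (out R)
            (diag H.toRightBicoalgebroid (out R) (coactDiag R m)) y) := by
      rw [← h3, lTensor_lTensor_apply]
      have h6 : (TensorProduct.leftComm ℂ A A (TW A M (m + 1))).toLinearMap ∘ₗ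
          (TensorProduct.leftComm ℂ A A (TW A M (m + 1))).toLinearMap = LinearMap.id :=
        LinearMap.ext leftComm_leftComm
      rw [h6, LinearMap.lTensor_id]
      rfl
    rw [h5, coactDiag_succ R m]
    rfl

end Words

/-! ### The cyclic operator preserves the cochains -/

theorem leftComm_rTensor {X Y Z V : Type*} [AddCommGroup X] [Module ℂ X] [AddCommGroup Y]
    [Module ℂ Y] [AddCommGroup Z] [Module ℂ Z] [AddCommGroup V] [Module ℂ V] (f : X →ₗ[ℂ] Y)
    (z : Z ⊗[ℂ] (X ⊗[ℂ] V)) : TensorProduct.leftComm ℂ Z Y V ((f.rTensor V).lTensor Z z) =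
      f.rTensor (Z ⊗[ℂ] V) (TensorProduct.leftComm ℂ Z X V z) := by
  induction z using TensorProduct.induction_on with
  | zero => simp
  | add x y hx hy => simp only [map_add, hx, hy]
  | tmul u y =>
    induction y using TensorProduct.induction_on with
    | zero => simp
    | add x y hx hy => simp only [TensorProduct.tmul_add, map_add, hx, hy]
    | tmul v w => simp

section Shift

variable {C B : Type*} [AddCommGroup C] [Module ℂ C] [Coalgebra ℂ C]
  [AddCommGroup B] [Module ℂ B] [Coalgebra ℂ B] {H : RightHopfCoalgebra C B}
  {A : Type*} [AddCommGroup A] [Module ℂ A] {R : ComoduleRing H A}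
  {T T' : Type*} [AddCommGroup T] [Module ℂ T] [AddCommGroup T'] [Module ℂ T']
  {act : B ⊗[ℂ] T →ₗ[ℂ] T} {act' : B ⊗[ℂ] T' →ₗ[ℂ] T'}
  {Z : Type*} [AddCommGroup Z] [Module ℂ Z]

theorem front_shiftAct (k : A →ₗ[ℂ] Z ⊗[ℂ] A) :
    front k T ∘ₗ shiftAct A act = (shiftAct A act).lTensor Z ∘ₗ behind B (front k T) := by
  ext b a t
  simp [front, behind, shiftAct, sum_legs k, TensorProduct.sum_tmul, TensorProduct.tmul_sum]

theorem behind_shiftAct {f : T →ₗ[ℂ] Z ⊗[ℂ] T} (h : f ∘ₗ act = act.lTensor Z ∘ₗ behind B f) :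
    behind A f ∘ₗ shiftAct A act = (shiftAct A act).lTensor Z ∘ₗ behind B (behind A f) := by
  ext b a t
  have h' : f (act (b ⊗ₜ t)) = act.lTensor Z (behind B f (b ⊗ₜ t)) :=
    LinearMap.congr_fun h (b ⊗ₜ t)
  simp [behind, shiftAct, h', sum_legs f t, TensorProduct.tmul_sum]

theorem diag_shiftAct {D : T →ₗ[ℂ] B ⊗[ℂ] T} (h : D ∘ₗ act = act.lTensor B ∘ₗ behind B D) :
    diag H.toRightBicoalgebroid (out R) D ∘ₗ shiftAct A act =
      (shiftAct A act).lTensor B ∘ₗ behind B (diag H.toRightBicoalgebroid (out R) D) := by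
  ext b a t
  have h' : D (act (b ⊗ₜ t)) = act.lTensor B (behind B D (b ⊗ₜ t)) :=
    LinearMap.congr_fun h (b ⊗ₜ t)
  simp [diag, pair, behind, shiftAct, h', sum_legs D t, sum_legs (out R), TensorProduct.sum_tmul,
    TensorProduct.tmul_sum]

theorem lTensor_shiftAct {g : T →ₗ[ℂ] T'} (h : g ∘ₗ act = act' ∘ₗ g.lTensor B) :
    g.lTensor A ∘ₗ shiftAct A act = shiftAct A act' ∘ₗ (g.lTensor A).lTensor B := by
  ext b a t
  have h' : g (act (b ⊗ₜ t)) = act' (b ⊗ₜ g t) := LinearMap.congr_fun h (b ⊗ₜ t)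
  simp [shiftAct, h']

/-- Maps of the second factor that commute with the action commute with `theta`. -/
theorem theta_lTensor {g : T →ₗ[ℂ] T'} (h : g ∘ₗ act = act' ∘ₗ g.lTensor B) (x : A ⊗[ℂ] T) :
    theta R act' (g.lTensor A x) = g.lTensor A (theta R act x) := by
  rw [theta, LinearMap.comp_apply, front_lTensor, ← LinearMap.comp_apply, ← lTensor_shiftAct h]
  rfl

/-- A factor `A` between the acting one and `T` is a spectator. -/
theorem theta_shift (y : A ⊗[ℂ] (A ⊗[ℂ] T)) :
    TensorProduct.leftComm ℂ A A T (theta R (shiftAct A act) y) =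
      (theta R act).lTensor A (TensorProduct.leftComm ℂ A A T y) := by
  induction y using TensorProduct.induction_on with
  | zero => simp
  | add x y hx hy => simp only [map_add, hx, hy]
  | tmul a z =>
    induction z using TensorProduct.induction_on with
    | zero => simp
    | add x y hx hy => simp only [TensorProduct.tmul_add, map_add, hx, hy]
    | tmul a' t =>
      simp [theta, shiftAct, front, sum_legs (out R), TensorProduct.sum_tmul,
        TensorProduct.tmul_sum]

/-- Coactions on the second factor that commute with the action commute with `theta`. -/
theorem behind_theta_of_comm {f : T →ₗ[ℂ] Z ⊗[ℂ] T} (h : f ∘ₗ act = act.lTensor Z ∘ₗ behind B f)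
    (x : A ⊗[ℂ] T) :
    behind A f (theta R act x) = (theta R act).lTensor Z (behind A f x) := by
  rw [theta, LinearMap.comp_apply, ← LinearMap.comp_apply, behind_shiftAct h,
    LinearMap.comp_apply, behind_behind_front, lTensor_lTensor_apply]

theorem lTensor_behind_diag {D : T →ₗ[ℂ] B ⊗[ℂ] T} {g : T →ₗ[ℂ] Z ⊗[ℂ] T}
    (h : g.lTensor B ∘ₗ D = (TensorProduct.leftComm ℂ Z B T).toLinearMap ∘ₗ D.lTensor Z ∘ₗ g) :
    (behind A g).lTensor B ∘ₗ diag H.toRightBicoalgebroid (out R) D =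
      (TensorProduct.leftComm ℂ Z B (A ⊗[ℂ] T)).toLinearMap ∘ₗ
        (diag H.toRightBicoalgebroid (out R) D).lTensor Z ∘ₗ behind A g := by
  refine LinearMap.ext fun x => ?_
  have h1 := congrArg (fun z => H.mulE.rTensor _ (TensorProduct.leftComm ℂ Z (B ⊗[ℂ] B) _ z))
    (behind_behind_pair (k := out R) h x)
  simp only [behind, LinearMap.comp_apply, LinearEquiv.coe_coe, leftComm_leftComm] at h1
  rw [rTensor_lTensor_apply, ← leftComm_rTensor, lTensor_lTensor_apply] at h1
  exact h1

end Shift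

section Words

variable {C B : Type*} [AddCommGroup C] [Module ℂ C] [Coalgebra ℂ C]
  [AddCommGroup B] [Module ℂ B] [Coalgebra ℂ B] {H : RightHopfCoalgebra C B}
  {A M : Type u} [AddCommGroup A] [Module ℂ A] [AddCommGroup M] [Module ℂ M]
  {Z : Type*} [AddCommGroup Z] [Module ℂ Z] {R : ComoduleRing H A}

/-- The action of `B` on the factor `M` of `A^{⊗ n} ⊗ M`. -/
def actAt (A : Type u) [AddCommGroup A] [Module ℂ A] (S : SAYDModule H M) :
    (n : ℕ) → (B ⊗[ℂ] TW A M n →ₗ[ℂ] TW A M n)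
  | 0 => S.actFront
  | n + 1 => shiftAct A (actAt A S n)

variable (S : SAYDModule H M)

/-- All factors `A` are spectators for the action on, and the coaction of, `M`. -/
theorem isSAYD_actAt (n : ℕ) : IsSAYD H (actAt A S n) (coactLast S.coact n) := by
  induction n with
  | zero =>
    rw [coactLast_zero]
    exact S.isSAYD
  | succ n ih =>
    rw [coactLast_succ]
    exact ih.shift

/-- Moving `a` past the other factors and letting `a⁽¹⁾` act on `M` at the end is the same as
letting `a⁽¹⁾` act first and then rotating. -/
theorem push_eq (n : ℕ) : push R S n = rotate A M n ∘ₗ theta R (actAt A S n) := by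
  induction n with
  | zero =>
    have h : ∀ x : A ⊗[ℂ] M, S.actFront.lTensor A (TensorProduct.assoc ℂ A B M
        (R.coact.rTensor M x)) = theta R S.actFront x := by
      intro x
      induction x with
      | zero => simp
      | add x y hx hy => simp only [map_add, hx, hy]
      | tmul a m => simp [theta, shiftAct, front, out, sum_legs R.coact, TensorProduct.sum_tmul]
    refine LinearMap.ext fun x => Eq.trans ?_ (h x)
    have e : ∀ z : A ⊗[ℂ] M, (TW.zero A M).toLinearMap.lTensor A z = z := fun z =>
      lTensor_eq_self (f := (TW.zero A M).toLinearMap) (fun _ => rfl) z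
    have e' : ∀ z : A ⊗[ℂ] M, (TW.zero A M).symm.toLinearMap.lTensor A z = z := fun z =>
      lTensor_eq_self (f := (TW.zero A M).symm.toLinearMap) (fun _ => rfl) z
    refine (e' _).trans ?_
    exact congrArg (fun z => S.actFront.lTensor A (TensorProduct.assoc ℂ A B M
        (R.coact.rTensor M z))) (e x)
  | succ n ih =>
    refine LinearMap.ext fun x => ?_
    have h1 : push R S (n + 1) x = (push R S n).lTensor A
        (TensorProduct.leftComm ℂ A A (TW A M n) x) :=
      congrArg (fun z => (push R S n).lTensor A (TensorProduct.leftComm ℂ A A (TW A M n) z))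
        (lTensor_succ n x)
    refine h1.trans ?_
    rw [ih, rotate_succ]
    refine (LinearMap.lTensor_comp_apply _ _ _ _).trans ?_
    exact congrArg _ (theta_shift (R := R) (act := actAt A S n) x).symm

theorem coactAt_actAt (k : A →ₗ[ℂ] Z ⊗[ℂ] A) (n : ℕ) (i : Fin n) :
    coactAt k n i ∘ₗ actAt A S n = (actAt A S n).lTensor Z ∘ₗ behind B (coactAt k n i) := by
  induction n with
  | zero => exact i.elim0
  | succ n ih =>
    refine Fin.cases ?_ (fun i => ?_) i
    · rw [coactAt_zero]
      exact front_shiftAct k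
    · rw [coactAt_succ]
      exact behind_shiftAct (ih i)

/-- The action on `M` does not affect the diagonal coaction of the factors `A`. -/
theorem coactDiag_actAt (n : ℕ) : coactDiag R n ∘ₗ actAt A S (n + 1) =
    (actAt A S (n + 1)).lTensor B ∘ₗ behind B (coactDiag R n) := by
  induction n with
  | zero =>
    rw [coactDiag_zero]
    exact front_shiftAct (out R)
  | succ n ih =>
    rw [coactDiag_succ]
    exact diag_shiftAct ih

/-- The diagonal coaction of the factors `A` commutes with coactions of `M`. -/
theorem coactLast_coactDiag (g : M →ₗ[ℂ] Z ⊗[ℂ] M) (n : ℕ) :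
    (coactLast g (n + 1)).lTensor B ∘ₗ coactDiag R n =
      (TensorProduct.leftComm ℂ Z B (TW A M (n + 1))).toLinearMap ∘ₗ
        (coactDiag R n).lTensor Z ∘ₗ coactLast g (n + 1) := by
  induction n with
  | zero =>
    rw [coactDiag_zero, coactLast_succ]
    refine LinearMap.ext fun x => ?_
    have h := front_lTensor_behind (out R) (coactLast (A := A) g 0) x
    have h' := congrArg (TensorProduct.leftComm ℂ Z B _) h
    rw [leftComm_leftComm] at h'
    exact h'.symm
  | succ n ih =>
    rw [coactDiag_succ, coactLast_succ g (n + 1)]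
    exact lTensor_behind_diag ih

theorem rTensor_coactLast (f : B →ₗ[ℂ] C) (g : M →ₗ[ℂ] B ⊗[ℂ] M) (n : ℕ) :
    f.rTensor (TW A M n) ∘ₗ coactLast g n = coactLast (f.rTensor M ∘ₗ g) n := by
  induction n with
  | zero => rw [coactLast_zero, coactLast_zero]; rfl
  | succ n ih =>
    rw [coactLast_succ, coactLast_succ, ← ih]
    exact rTensor_comp_behind f (coactLast g n)

variable {S}

/-- On a cochain, the left `C`-coaction of the first factor is the right `C`-coaction of `M`. -/
theorem balanced_of_mem_cochains {n : ℕ} {x : TW A M (n + 1)} (hx : x ∈ cochains R S n) :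
    Balanced (T := TW A M n) R (coactLast S.coact n) x := by
  obtain ⟨h, hE⟩ := (mem_cochains_iff R S).1 hx
  have h1 := β_coactDiag h
  rw [hE, coactLast_succ] at h1
  exact h1.symm.trans (rTensor_behind _ _ _)

/-- On a cochain, the right `C`-coaction of the last factor `A` is the left `C`-coaction of
`M`. -/
theorem coactAt_last_of_mem_cochains {n : ℕ} {x : TW A M (n + 1)} (hx : x ∈ cochains R S n) :
    coactAt (rightOut R) (n + 1) (Fin.last n) x =
      behind A (H.α.toLinearMap.rTensor (TW A M n) ∘ₗ coactLast S.coact n) x := by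
  obtain ⟨h, hE⟩ := (mem_cochains_iff R S).1 hx
  have h1 := α_coactDiag h
  rw [hE, coactLast_succ] at h1
  exact h1.symm.trans (rTensor_behind _ _ _)

theorem theta_slice_mem_chain {n : ℕ} {x : A ⊗[ℂ] TW A M (n + 1)}
    (hx : (show TW A M (n + 2) from x) ∈ chain M R (n + 1))
    (φ : A →ₗ[ℂ] ℂ) :
    slice φ (TW A M (n + 1)) (theta R (actAt A S (n + 1)) x) ∈
      chain M R n := by
  refine (mem_chain_iff R).2 fun i => ?_
  rw [← slice_lTensor, ← slice_lTensor]
  refine congrArg _ (lTensor_eq_of_behind ?_)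
  rw [behind_theta_of_comm (coactAt_actAt S _ _ _), behind_theta_of_comm (coactAt_actAt S _ _ _)]
  refine congrArg _ (behind_congr ?_)
  exact lTensor_congr (· ∈ chain M R n) ((mem_chain_succ R).1 hx).2
    fun w hw => (mem_chain_iff R).1 hw i

/-- After `a₀⁽¹⁾` has acted on `m`, the factor `a₀⁽⁰⁾` satisfies the cotensor condition with the
last factor `A`, behind which it is to be moved. -/
theorem coactAt_last_theta {n : ℕ} {x : A ⊗[ℂ] TW A M (n + 1)}
    (hx : (show TW A M (n + 2) from x) ∈ cochains R S (n + 1)) :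
    behind A (coactAt (rightOut R) (n + 1) (Fin.last n))
        (theta R (actAt A S (n + 1)) x) =
      front R.left (TW A M (n + 1)) (theta R (actAt A S (n + 1)) x) := by
  have h1 := coactAt_last_of_mem_cochains hx
  rw [← Fin.succ_last, coactAt_succ] at h1
  rw [behind_theta_of_comm (coactAt_actAt S _ _ _),
    front_left_theta (isSAYD_actAt S (n + 1)) (balanced_of_mem_cochains hx)]
  exact congrArg _ h1

theorem cyclicOp_eq (n : ℕ) (x : TW A M (n + 1)) :
    cyclicOp R S n x = rotate A M n (theta (T := TW A M n) R (actAt A S n) x) :=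
  LinearMap.congr_fun (push_eq S n) x

/-- The cotensor conditions hold by `coactAt_last_theta`, and the condition over `B` by the anti
Yetter–Drinfeld law in the form `behind_theta`. -/
theorem cyclicOp_mem_cochains {n : ℕ} {x : TW A M (n + 1)} (hx : x ∈ cochains R S n) :
    cyclicOp R S n x ∈ cochains R S n := by
  obtain ⟨h, hE⟩ := (mem_cochains_iff R S).1 hx
  have hb := balanced_of_mem_cochains hx
  rw [cyclicOp_eq]
  cases n with
  | zero =>
    refine (mem_cochains_iff R S).2 ⟨mem_chain_zero R _, ?_⟩
    rw [coactLast_succ]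
    rw [coactDiag_zero, coactLast_succ] at hE
    rw [coactDiag_zero]
    exact behind_theta_of_out (isSAYD_actAt S 0) hb hE
  | succ n =>
    refine (mem_cochains_iff R S).2 ⟨rotate_mem_chain (theta_slice_mem_chain h)
      (coactAt_last_theta hx), ?_⟩
    rw [coactDiag_rotate (theta_slice_mem_chain h) (coactAt_last_theta hx), coactLast_rotate]
    refine congrArg _ ?_
    rw [coactDiag_succ, coactLast_succ] at hE
    exact behind_theta (isSAYD_actAt S (n + 1)) hb (coactDiag_actAt S n)
      (pair_coactDiag_mem_sq h) hE

end Words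

/-! ### The cosimplicial identities of the inner operators -/

section Ring

variable {C B : Type*} [AddCommGroup C] [Module ℂ C] [Coalgebra ℂ C]
  [AddCommGroup B] [Module ℂ B] [Coalgebra ℂ B] {H : RightHopfCoalgebra C B}
  {A : Type*} [AddCommGroup A] [Module ℂ A] (R : ComoduleRing H A)
  {T U : Type*} [AddCommGroup T] [Module ℂ T] [AddCommGroup U] [Module ℂ U]

theorem ring_mulE_assoc {x : A ⊗[ℂ] (A ⊗[ℂ] A)}
    (h1 : front (rightOut R) (A ⊗[ℂ] A) x = behind A (front R.left A) x)
    (h2 : behind A (front (rightOut R) A) x = behind A (behind A R.left) x) :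
    R.mulE (R.mulE.lTensor A x) =
      R.mulE (R.mulE.rTensor A ((TensorProduct.assoc ℂ A A A).symm x)) :=
  R.mul_assoc x ⟨mem_cotensor_iff.2 h1, lTensor_viaRight_eq_iff.2 (lTensor_eq_of_behind h2)⟩

theorem insert_eq (x : A ⊗[ℂ] T) : insert R T x = R.η.rTensor (A ⊗[ℂ] T) (front R.left T x) := by
  induction x with
  | zero => simp
  | add x y hx hy => simp only [map_add, hx, hy]
  | tmul a t => simp [insert, split, front, sum_legs R.left, TensorProduct.sum_tmul]

theorem lTensor_insert_insert (x : A ⊗[ℂ] T) :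
    (insert R T).lTensor A (insert R T x) = insert R (A ⊗[ℂ] T) (insert R T x) := by
  rw [insert_eq R (insert R T x), front_left_insert, rTensor_lTensor_apply, ← insert_eq]

theorem lTensor_merge (f : T →ₗ[ℂ] U) (x : A ⊗[ℂ] (A ⊗[ℂ] T)) :
    f.lTensor A (merge R T x) = merge R U ((f.lTensor A).lTensor A x) := by
  induction x using TensorProduct.induction_on with
  | zero => simp
  | add x y hx hy => simp only [map_add, hx, hy]
  | tmul a y =>
    induction y using TensorProduct.induction_on with
    | zero => simp
    | add x y hx hy => simp only [TensorProduct.tmul_add, map_add, hx, hy]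
    | tmul a' t => simp [merge]

variable {R} in
/-- Associativity of the multiplication, with a spectator factor. -/
theorem merge_lTensor_merge {x : A ⊗[ℂ] (A ⊗[ℂ] (A ⊗[ℂ] T))}
    (h1 : front (rightOut R) (A ⊗[ℂ] (A ⊗[ℂ] T)) x = behind A (front R.left (A ⊗[ℂ] T)) x)
    (h2 : behind A (front (rightOut R) (A ⊗[ℂ] T)) x = behind A (behind A (front R.left T)) x) :
    merge R T ((merge R T).lTensor A x) = merge R T (merge R (A ⊗[ℂ] T) x) := by
  let E : (A ⊗[ℂ] (A ⊗[ℂ] A)) ⊗[ℂ] T ≃ₗ[ℂ] A ⊗[ℂ] (A ⊗[ℂ] (A ⊗[ℂ] T)) :=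
    TensorProduct.assoc ℂ A (A ⊗[ℂ] A) T ≪≫ₗ (TensorProduct.assoc ℂ A A T).lTensor A
  obtain ⟨y, rfl⟩ := E.surjective x
  have hi : Function.Injective (E.toLinearMap.lTensor C) := (E.lTensor C).injective
  have hE : ∀ z, E.toLinearMap.lTensor C z =
      ((TensorProduct.assoc ℂ A A T).toLinearMap.lTensor A).lTensor C
        ((TensorProduct.assoc ℂ A (A ⊗[ℂ] A) T).toLinearMap.lTensor C z) := fun z =>
    LinearMap.congr_fun (LinearMap.lTensor_comp C
      ((TensorProduct.assoc ℂ A A T).toLinearMap.lTensor A)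
      (TensorProduct.assoc ℂ A (A ⊗[ℂ] A) T).toLinearMap) z
  have e1 : ∀ f : A →ₗ[ℂ] C ⊗[ℂ] A, front f _ (E y) =
      E.toLinearMap.lTensor C (front (front f (A ⊗[ℂ] A)) T y) := fun f => by
    rw [hE, ← front_assoc]
    exact front_lTensor _ _ _
  have e2 : ∀ f : A →ₗ[ℂ] C ⊗[ℂ] A, behind A (front f _) (E y) =
      E.toLinearMap.lTensor C (front (behind A (front f A)) T y) := fun f => by
    rw [hE, ← behind_front_assoc]
    exact behind_lTensor (congrArg (fun g => LinearMap.lTensor A g _)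
      (LinearMap.ext fun z => front_assoc f z))
  have e3 : ∀ f : A →ₗ[ℂ] C ⊗[ℂ] A, behind A (behind A (front f _)) (E y) =
      E.toLinearMap.lTensor C (front (behind A (behind A f)) T y) := fun f => by
    rw [hE, ← behind_front_assoc]
    exact behind_lTensor (congrArg (fun g => LinearMap.lTensor A g _)
      (LinearMap.ext fun z => behind_front_assoc f z))
  rw [e1, e2] at h1
  rw [e2, e3] at h2
  have h := rTensor_congr_of_eq₂ (F := R.mulE ∘ₗ R.mulE.lTensor A)
    (G := R.mulE ∘ₗ R.mulE.rTensor A ∘ₗ (TensorProduct.assoc ℂ A A A).symm.toLinearMap)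
    (fun w hw hw' => ring_mulE_assoc R hw hw')
    (rTensor_eq_of_front (hi h1)) (rTensor_eq_of_front (hi h2))
  clear h1 h2 e1 e2 e3
  have e4 : ∀ y, merge R T ((merge R T).lTensor A (E y)) =
      (R.mulE ∘ₗ R.mulE.lTensor A).rTensor T y := by
    intro y
    induction y using TensorProduct.induction_on with
    | zero => simp
    | add x y hx hy => simp only [map_add, hx, hy]
    | tmul y t =>
      induction y using TensorProduct.induction_on with
      | zero => simp
      | add x y hx hy => simp only [TensorProduct.add_tmul, map_add, hx, hy]
      | tmul a y =>
        induction y using TensorProduct.induction_on with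
        | zero => simp
        | add x y hx hy =>
          simp only [TensorProduct.tmul_add, TensorProduct.add_tmul, map_add, hx, hy]
        | tmul a' a'' => simp [E, merge]
  have e5 : ∀ y, merge R T (merge R (A ⊗[ℂ] T) (E y)) =
      (R.mulE ∘ₗ R.mulE.rTensor A ∘ₗ
        (TensorProduct.assoc ℂ A A A).symm.toLinearMap).rTensor T y := by
    intro y
    induction y using TensorProduct.induction_on with
    | zero => simp
    | add x y hx hy => simp only [map_add, hx, hy]
    | tmul y t =>
      induction y using TensorProduct.induction_on with
      | zero => simp
      | add x y hx hy => simp only [TensorProduct.add_tmul, map_add, hx, hy]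
      | tmul a y =>
        induction y using TensorProduct.induction_on with
        | zero => simp
        | add x y hx hy =>
          simp only [TensorProduct.tmul_add, TensorProduct.add_tmul, map_add, hx, hy]
        | tmul a' a'' => simp [E, merge]
  rw [e4, e5, h]

variable {R} in
/-- The multiplication is left `C`-colinear, so it commutes with inserting a unit in front. -/
theorem lTensor_merge_insert {x : A ⊗[ℂ] (A ⊗[ℂ] T)}
    (hx : front (rightOut R) (A ⊗[ℂ] T) x = behind A (front R.left T) x) :
    (merge R T).lTensor A (insert R (A ⊗[ℂ] T) x) = insert R T (merge R T x) := by
  rw [insert_eq, insert_eq, front_left_merge hx, rTensor_lTensor_apply]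

/-- The left unit law, with a spectator factor. -/
theorem merge_insert (x : A ⊗[ℂ] T) : merge R T (insert R T x) = x := by
  have h : R.mulE ∘ₗ split R = LinearMap.id := LinearMap.ext R.unit_mul
  rw [insert, merge, LinearMap.comp_apply, LinearMap.comp_apply, LinearEquiv.coe_coe,
    LinearEquiv.coe_coe, LinearEquiv.symm_apply_apply, rTensor_rTensor_apply, h,
    LinearMap.rTensor_id]
  rfl

/-- The right unit law, with the factor `C` of the coaction in front. -/
theorem merge_unit_rightOut (x : A ⊗[ℂ] T) :
    merge R T (TensorProduct.leftComm ℂ A A T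
      (R.η.rTensor (A ⊗[ℂ] T) (front (rightOut R) T x))) = x := by
  induction x with
  | zero => simp
  | add x y hx hy => simp only [map_add, hx, hy]
  | tmul a t =>
    have h := congrArg (fun z => z ⊗ₜ[ℂ] t) (R.mul_unit a)
    simp [merge, front, rightOut, CRing.mulE, sum_legs R.right, TensorProduct.sum_tmul] at h ⊢
    exact h

variable {R} in
/-- The right unit law: by the cotensor condition, `a ⊗ η(a₁[-1]) ⊗ a₁[0] = a[0] ⊗ η(a[1]) ⊗ a₁`. -/
theorem merge_lTensor_insert {x : A ⊗[ℂ] (A ⊗[ℂ] T)}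
    (hx : front (rightOut R) (A ⊗[ℂ] T) x = behind A (front R.left T) x) :
    merge R (A ⊗[ℂ] T) ((insert R T).lTensor A x) = x := by
  refine Eq.trans ?_ (merge_unit_rightOut R x)
  have h : insert R T = R.η.rTensor (A ⊗[ℂ] T) ∘ₗ front R.left T :=
    LinearMap.ext fun x => insert_eq R x
  rw [hx, h, behind, LinearMap.comp_apply, LinearEquiv.coe_coe, ← leftComm_rTensor,
    leftComm_leftComm, lTensor_lTensor_apply]

end Ring

section Words

variable {C B : Type*} [AddCommGroup C] [Module ℂ C] [Coalgebra ℂ C]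
  [AddCommGroup B] [Module ℂ B] [Coalgebra ℂ B] {H : RightHopfCoalgebra C B}
  {A M : Type u} [AddCommGroup A] [Module ℂ A] [AddCommGroup M] [Module ℂ M]
  (R : ComoduleRing H A)

theorem faceAt_faceAt {n : ℕ} {i j : Fin n} (hij : i ≤ j) (x : TW A M n) :
    faceAt R (n + 1) j.succ (faceAt R n i x) = faceAt R (n + 1) i.castSucc (faceAt R n j x) := by
  induction n with
  | zero => exact i.elim0
  | succ n ih =>
    induction i using Fin.cases with
    | zero =>
      rw [Fin.castSucc_zero, faceAt_succ, faceAt_zero', faceAt_zero']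
      induction j using Fin.cases with
      | zero =>
        rw [faceAt_zero']
        exact lTensor_insert_insert R _
      | succ j => exact lTensor_lTensor_insert R _ _
    | succ i =>
      induction j using Fin.cases with
      | zero => simp at hij
      | succ j =>
        rw [Fin.castSucc_succ, faceAt_succ, faceAt_succ, faceAt_succ, faceAt_succ]
        refine (lTensor_lTensor_apply _ _ _).trans
          (Eq.trans ?_ (lTensor_lTensor_apply _ _ _).symm)
        exact congrArg (fun f => LinearMap.lTensor A f _)
          (LinearMap.ext (ih (Fin.succ_le_succ_iff.1 hij)))

theorem degeneracyAt_degeneracyAt {n : ℕ} {i j : Fin n} (hij : i ≤ j) {x : TW A M (n + 2)}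
    (hx : x ∈ chain M R (n + 1)) :
    degeneracyAt R n j (degeneracyAt R (n + 1) i.castSucc x) =
      degeneracyAt R n i (degeneracyAt R (n + 1) j.succ x) := by
  induction n with
  | zero => exact i.elim0
  | succ n ih =>
    obtain ⟨h0, h⟩ := (mem_chain_succ R).1 hx
    induction i using Fin.cases with
    | zero =>
      rw [Fin.castSucc_zero, degeneracyAt_succ, degeneracyAt_zero', degeneracyAt_zero']
      induction j using Fin.cases with
      | zero =>
        rw [degeneracyAt_zero']
        refine (merge_lTensor_merge h0 ?_).symm
        exact behind_congr (lTensor_congr (· ∈ chain M R (n + 1)) h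
          fun w hw => ((mem_chain_succ R).1 hw).1)
      | succ j => exact lTensor_merge R _ _
    | succ i =>
      induction j using Fin.cases with
      | zero => simp at hij
      | succ j =>
        rw [Fin.castSucc_succ, degeneracyAt_succ, degeneracyAt_succ, degeneracyAt_succ,
          degeneracyAt_succ]
        refine (lTensor_lTensor_apply _ _ _).trans
          (Eq.trans ?_ (lTensor_lTensor_apply _ _ _).symm)
        exact lTensor_congr (· ∈ chain M R (n + 1)) h
          fun w hw => ih (Fin.succ_le_succ_iff.1 hij) hw

theorem degeneracyAt_faceAt_of_le {n : ℕ} {i j : Fin n} (hij : i ≤ j) {x : TW A M (n + 1)}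
    (hx : x ∈ chain M R n) :
    degeneracyAt R (n + 1) j.succ (faceAt R (n + 1) i.castSucc x) =
      faceAt R n i (degeneracyAt R n j x) := by
  induction n with
  | zero => exact i.elim0
  | succ n ih =>
    obtain ⟨h0, h⟩ := (mem_chain_succ R).1 hx
    induction i using Fin.cases with
    | zero =>
      rw [Fin.castSucc_zero, degeneracyAt_succ, faceAt_zero', faceAt_zero']
      induction j using Fin.cases with
      | zero =>
        rw [degeneracyAt_zero']
        exact lTensor_merge_insert h0
      | succ j => exact lTensor_lTensor_insert R _ _
    | succ i =>
      induction j using Fin.cases with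
      | zero => simp at hij
      | succ j =>
        rw [Fin.castSucc_succ, degeneracyAt_succ, degeneracyAt_succ, faceAt_succ, faceAt_succ]
        refine (lTensor_lTensor_apply _ _ _).trans
          (Eq.trans ?_ (lTensor_lTensor_apply _ _ _).symm)
        exact lTensor_congr (· ∈ chain M R n) h
          fun w hw => ih (Fin.succ_le_succ_iff.1 hij) hw

theorem degeneracyAt_faceAt_self {n : ℕ} (i : Fin n) (x : TW A M n) :
    degeneracyAt R n i (faceAt R n i x) = x := by
  induction n with
  | zero => exact i.elim0
  | succ n ih =>
    induction i using Fin.cases with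
    | zero =>
      rw [degeneracyAt_zero', faceAt_zero']
      exact merge_insert R _
    | succ i =>
      rw [degeneracyAt_succ, faceAt_succ]
      exact (lTensor_lTensor_apply _ _ _).trans
        (lTensor_eq_self (f := degeneracyAt R n i ∘ₗ faceAt R n i) (ih i) _)

theorem degeneracyAt_faceAt_succ {n : ℕ} (i : Fin n) {x : TW A M (n + 1)}
    (hx : x ∈ chain M R n) :
    degeneracyAt R (n + 1) i.castSucc (faceAt R (n + 1) i.succ x) = x := by
  induction n with
  | zero => exact i.elim0
  | succ n ih =>
    obtain ⟨h0, h⟩ := (mem_chain_succ R).1 hx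
    induction i using Fin.cases with
    | zero =>
      rw [Fin.castSucc_zero, degeneracyAt_zero', faceAt_succ, faceAt_zero']
      exact merge_lTensor_insert h0
    | succ i =>
      rw [Fin.castSucc_succ, degeneracyAt_succ, faceAt_succ]
      refine (lTensor_lTensor_apply _ _ _).trans ?_
      refine Eq.trans ?_ (LinearMap.congr_fun (LinearMap.lTensor_id A (TW A M (n + 1))) _)
      exact lTensor_congr (· ∈ chain M R n) h fun w hw => ih i hw

theorem degeneracyAt_faceAt_of_gt {n : ℕ} {i j : Fin n} (hij : j < i) (x : TW A M (n + 1)) :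
    degeneracyAt R (n + 1) j.castSucc (faceAt R (n + 1) i.succ x) =
      faceAt R n i (degeneracyAt R n j x) := by
  induction n with
  | zero => exact i.elim0
  | succ n ih =>
    induction i using Fin.cases with
    | zero => simp at hij
    | succ i =>
      induction j using Fin.cases with
      | zero =>
        rw [Fin.castSucc_zero, degeneracyAt_zero', degeneracyAt_zero', faceAt_succ, faceAt_succ]
        exact (lTensor_merge R _ _).symm
      | succ j =>
        rw [Fin.castSucc_succ, degeneracyAt_succ, degeneracyAt_succ, faceAt_succ, faceAt_succ]
        refine (lTensor_lTensor_apply _ _ _).trans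
          (Eq.trans ?_ (lTensor_lTensor_apply _ _ _).symm)
        exact congrArg (fun f => LinearMap.lTensor A f _)
          (LinearMap.ext (ih (Fin.succ_lt_succ_iff.1 hij)))

end Words

/-! ### Rotations of the inner operators -/

section Ring

variable {C B : Type*} [AddCommGroup C] [Module ℂ C] [Coalgebra ℂ C]
  [AddCommGroup B] [Module ℂ B] [Coalgebra ℂ B] {H : RightHopfCoalgebra C B}
  {A : Type*} [AddCommGroup A] [Module ℂ A] (R : ComoduleRing H A)
  {T U : Type*} [AddCommGroup T] [Module ℂ T] [AddCommGroup U] [Module ℂ U]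

/-- `a ⊗ a' ⊗ a'' ⊗ t ↦ a'' ⊗ a ⊗ a' ⊗ t`. -/
def moveThird (A T : Type*) [AddCommGroup A] [Module ℂ A] [AddCommGroup T] [Module ℂ T] :
    A ⊗[ℂ] (A ⊗[ℂ] (A ⊗[ℂ] T)) →ₗ[ℂ] A ⊗[ℂ] (A ⊗[ℂ] (A ⊗[ℂ] T)) :=
  (TensorProduct.leftComm ℂ A A (A ⊗[ℂ] T)).toLinearMap ∘ₗ
    (TensorProduct.leftComm ℂ A A T).toLinearMap.lTensor A

theorem leftComm_lTensor_leftComm (r : A ⊗[ℂ] T →ₗ[ℂ] U) (x : A ⊗[ℂ] (A ⊗[ℂ] (A ⊗[ℂ] T))) :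
    TensorProduct.leftComm ℂ A A U ((r.lTensor A ∘ₗ
      (TensorProduct.leftComm ℂ A A T).toLinearMap).lTensor A
        (TensorProduct.leftComm ℂ A A (A ⊗[ℂ] T) x)) =
      (r.lTensor A ∘ₗ (TensorProduct.leftComm ℂ A A T).toLinearMap).lTensor A (moveThird A T x) :=
      by
  induction x using TensorProduct.induction_on with
  | zero => simp
  | add x y hx hy => simp only [map_add, hx, hy]
  | tmul a y =>
    induction y using TensorProduct.induction_on with
    | zero => simp
    | add x y hx hy => simp only [TensorProduct.tmul_add, map_add, hx, hy]
    | tmul a' y =>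
      induction y using TensorProduct.induction_on with
      | zero => simp
      | add x y hx hy => simp only [TensorProduct.tmul_add, map_add, hx, hy]
      | tmul a'' t => simp [moveThird]

theorem leftComm_lTensor_lTensor (f : T →ₗ[ℂ] U) (x : A ⊗[ℂ] (A ⊗[ℂ] T)) :
    TensorProduct.leftComm ℂ A A U ((f.lTensor A).lTensor A x) =
      (f.lTensor A).lTensor A (TensorProduct.leftComm ℂ A A T x) := by
  induction x using TensorProduct.induction_on with
  | zero => simp
  | add x y hx hy => simp only [map_add, hx, hy]
  | tmul a y =>
    induction y using TensorProduct.induction_on with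
    | zero => simp
    | add x y hx hy => simp only [TensorProduct.tmul_add, map_add, hx, hy]
    | tmul a' t => simp

theorem lTensor_merge_moveThird (x : A ⊗[ℂ] (A ⊗[ℂ] (A ⊗[ℂ] T))) :
    (merge R T).lTensor A (moveThird A T x) =
      TensorProduct.leftComm ℂ A A T (merge R (A ⊗[ℂ] T) x) := by
  induction x using TensorProduct.induction_on with
  | zero => simp
  | add x y hx hy => simp only [map_add, hx, hy]
  | tmul a y =>
    induction y using TensorProduct.induction_on with
    | zero => simp
    | add x y hx hy => simp only [TensorProduct.tmul_add, map_add, hx, hy]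
    | tmul a' y =>
      induction y using TensorProduct.induction_on with
      | zero => simp
      | add x y hx hy => simp only [TensorProduct.tmul_add, map_add, hx, hy]
      | tmul a'' t => simp [merge, moveThird]

theorem moveThird_insert (x : A ⊗[ℂ] (A ⊗[ℂ] T)) :
    moveThird A T (insert R (A ⊗[ℂ] T) x) =
      (insert R T).lTensor A (TensorProduct.leftComm ℂ A A T x) := by
  induction x using TensorProduct.induction_on with
  | zero => simp
  | add x y hx hy => simp only [map_add, hx, hy]
  | tmul a y =>
    induction y using TensorProduct.induction_on with
    | zero => simp
    | add x y hx hy => simp only [TensorProduct.tmul_add, map_add, hx, hy]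
    | tmul a' t =>
      simp [insert, moveThird, sum_legs (split R), TensorProduct.sum_tmul, TensorProduct.tmul_sum]

theorem leftComm_lTensor_insert (x : A ⊗[ℂ] (A ⊗[ℂ] T)) :
    (TensorProduct.leftComm ℂ A A T).toLinearMap.lTensor A
        (TensorProduct.leftComm ℂ A A (A ⊗[ℂ] T) ((insert R T).lTensor A x)) =
      insert R (A ⊗[ℂ] T) (TensorProduct.leftComm ℂ A A T x) := by
  induction x using TensorProduct.induction_on with
  | zero => simp
  | add x y hx hy => simp only [map_add, hx, hy]
  | tmul a y =>
    induction y using TensorProduct.induction_on with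
    | zero => simp
    | add x y hx hy => simp only [TensorProduct.tmul_add, map_add, hx, hy]
    | tmul a' t =>
      simp [insert, sum_legs (split R), TensorProduct.sum_tmul, TensorProduct.tmul_sum]

theorem merge_lTensor_leftComm (x : A ⊗[ℂ] (A ⊗[ℂ] (A ⊗[ℂ] T))) :
    merge R (A ⊗[ℂ] T) ((TensorProduct.leftComm ℂ A A T).toLinearMap.lTensor A
        (TensorProduct.leftComm ℂ A A (A ⊗[ℂ] T) x)) =
      TensorProduct.leftComm ℂ A A T ((merge R T).lTensor A x) := by
  induction x using TensorProduct.induction_on with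
  | zero => simp
  | add x y hx hy => simp only [map_add, hx, hy]
  | tmul a y =>
    induction y using TensorProduct.induction_on with
    | zero => simp
    | add x y hx hy => simp only [TensorProduct.tmul_add, map_add, hx, hy]
    | tmul a' y =>
      induction y using TensorProduct.induction_on with
      | zero => simp
      | add x y hx hy => simp only [TensorProduct.tmul_add, map_add, hx, hy]
      | tmul a'' t => simp [merge]

theorem leftComm_rTensor_behind (f : C →ₗ[ℂ] U) (k : T →ₗ[ℂ] C ⊗[ℂ] T) (x : A ⊗[ℂ] T) :
    TensorProduct.leftComm ℂ U A T (f.rTensor (A ⊗[ℂ] T) (behind A k x)) =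
      (f.rTensor T ∘ₗ k).lTensor A x := by
  rw [behind, LinearMap.comp_apply, LinearEquiv.coe_coe, ← leftComm_rTensor, leftComm_leftComm,
    lTensor_lTensor_apply]

variable {act : B ⊗[ℂ] T →ₗ[ℂ] T}

theorem insert_shiftAct : insert R T ∘ₗ shiftAct A act =
    shiftAct A (shiftAct A act) ∘ₗ (insert R T).lTensor B := by
  ext b a t
  simp [insert, shiftAct, sum_legs (split R), TensorProduct.sum_tmul, TensorProduct.tmul_sum]

theorem merge_shiftAct : merge R T ∘ₗ shiftAct A (shiftAct A act) =
    shiftAct A act ∘ₗ (merge R T).lTensor B := by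
  ext b a a' t
  simp [merge, shiftAct]

theorem leftComm_shiftAct : (TensorProduct.leftComm ℂ A A T).toLinearMap ∘ₗ
    shiftAct A (shiftAct A act) = shiftAct A (shiftAct A act) ∘ₗ
      (TensorProduct.leftComm ℂ A A T).toLinearMap.lTensor B := by
  ext b a a' t
  simp [shiftAct]

end Ring

section Words

variable {C B : Type*} [AddCommGroup C] [Module ℂ C] [Coalgebra ℂ C]
  [AddCommGroup B] [Module ℂ B] [Coalgebra ℂ B] {H : RightHopfCoalgebra C B}
  {A M : Type u} [AddCommGroup A] [Module ℂ A] [AddCommGroup M] [Module ℂ M]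
  (R : ComoduleRing H A) (S : SAYDModule H M)

theorem faceAt_actAt (n : ℕ) (i : Fin n) : faceAt R n i ∘ₗ actAt A S n =
    actAt A S (n + 1) ∘ₗ (faceAt R n i).lTensor B := by
  induction n with
  | zero => exact i.elim0
  | succ n ih =>
    refine Fin.cases ?_ (fun i => ?_) i
    · rw [faceAt_zero']
      exact insert_shiftAct R
    · rw [faceAt_succ]
      exact lTensor_shiftAct (ih i)

theorem degeneracyAt_actAt (n : ℕ) (i : Fin n) : degeneracyAt R n i ∘ₗ actAt A S (n + 1) =
    actAt A S n ∘ₗ (degeneracyAt R n i).lTensor B := by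
  induction n with
  | zero => exact i.elim0
  | succ n ih =>
    refine Fin.cases ?_ (fun i => ?_) i
    · rw [degeneracyAt_zero']
      exact merge_shiftAct R
    · rw [degeneracyAt_succ]
      exact lTensor_shiftAct (ih i)

theorem rotate_actAt (n : ℕ) : rotate A M n ∘ₗ shiftAct A (actAt A S n) =
    actAt A S (n + 1) ∘ₗ (rotate A M n).lTensor B := by
  induction n with
  | zero => exact congrArg (fun f => actAt A S 1 ∘ₗ f) (LinearMap.lTensor_id B (TW A M 1)).symm
  | succ n ih =>
    refine LinearMap.ext fun x => ?_
    refine Eq.trans ?_ (congrArg (actAt A S (n + 2)) (lTensor_rotate_succ n x)).symm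
    rw [rotate_succ]
    refine (congrArg ((rotate A M n).lTensor A) (LinearMap.congr_fun
      (leftComm_shiftAct (A := A) (act := actAt A S n)) x)).trans ?_
    exact LinearMap.congr_fun (lTensor_shiftAct ih) _

/-- Operators on the factors that stay behind commute with the rotation, with a shift of index. -/
theorem rotate_faceAt {n : ℕ} (i : Fin n) (y : A ⊗[ℂ] TW A M n) :
    rotate A M (n + 1) ((faceAt R n i).lTensor A y) =
      faceAt R (n + 1) i.castSucc (rotate A M n y) := by
  induction n with
  | zero => exact i.elim0
  | succ n ih =>
    rw [rotate_succ (n + 1)]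
    conv_rhs => rw [rotate_succ]
    refine Fin.cases ?_ (fun i => ?_) i
    · rw [Fin.castSucc_zero, faceAt_zero', faceAt_zero']
      refine (lTensor_rotate_succ n _).trans ?_
      refine Eq.trans (congrArg _ (leftComm_lTensor_insert R (T := TW A M n) y)) ?_
      exact lTensor_lTensor_insert R _ _
    · rw [Fin.castSucc_succ, faceAt_succ, faceAt_succ]
      refine (congrArg ((rotate A M (n + 1)).lTensor A)
        (leftComm_lTensor_lTensor (faceAt R n i) y)).trans ?_
      refine (lTensor_lTensor_apply _ _ _).trans
        (Eq.trans ?_ (lTensor_lTensor_apply _ _ _).symm)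
      exact congrArg (fun f => LinearMap.lTensor A f _) (LinearMap.ext (ih i))

theorem rotate_degeneracyAt {n : ℕ} (i : Fin n) (y : A ⊗[ℂ] TW A M (n + 1)) :
    degeneracyAt R (n + 1) i.castSucc (rotate A M (n + 1) y) =
      rotate A M n ((degeneracyAt R n i).lTensor A y) := by
  induction n with
  | zero => exact i.elim0
  | succ n ih =>
    rw [rotate_succ (n + 1)]
    conv_rhs => rw [rotate_succ]
    refine Fin.cases ?_ (fun i => ?_) i
    · rw [Fin.castSucc_zero, degeneracyAt_zero', degeneracyAt_zero']
      refine (congrArg _ (lTensor_rotate_succ n _)).trans ?_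
      refine (lTensor_merge R _ _).symm.trans ?_
      exact congrArg _ (merge_lTensor_leftComm R (T := TW A M n) y)
    · rw [Fin.castSucc_succ, degeneracyAt_succ, degeneracyAt_succ]
      refine Eq.trans ?_ (congrArg ((rotate A M n).lTensor A)
        (leftComm_lTensor_lTensor (degeneracyAt R n i) y)).symm
      refine (lTensor_lTensor_apply _ _ _).trans
        (Eq.trans ?_ (lTensor_lTensor_apply _ _ _).symm)
      exact congrArg (fun f => LinearMap.lTensor A f _) (LinearMap.ext (ih i))

/-- Rotating twice: the third factor stays in front and the first two are moved past the rest. -/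
theorem rotate_rotate_succ (n : ℕ) (x : A ⊗[ℂ] (A ⊗[ℂ] (A ⊗[ℂ] TW A M n))) :
    rotate A M (n + 2) (rotate A M (n + 2) x) =
      (rotate A M (n + 1) ∘ₗ rotate A M (n + 1)).lTensor A (moveThird A (TW A M n) x) := by
  have h := congrArg ((rotate A M (n + 1)).lTensor A)
    (leftComm_lTensor_leftComm (rotate A M n) x)
  rw [rotate_succ (n + 1)]
  refine Eq.trans ?_ (h.trans (Eq.trans ?_ (lTensor_lTensor_apply _ _ _)))
  · exact congrArg (fun f => (rotate A M (n + 1)).lTensor A (TensorProduct.leftComm ℂ A A _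
      (f.lTensor A (TensorProduct.leftComm ℂ A A _ x)))) (rotate_succ n)
  · exact congrArg (fun f => (rotate A M (n + 1)).lTensor A
      (f.lTensor A (moveThird A (TW A M n) x))) (rotate_succ n).symm

theorem rotate_one (x : A ⊗[ℂ] (A ⊗[ℂ] TW A M 0)) :
    rotate A M 1 x = TensorProduct.leftComm ℂ A A (TW A M 0) x :=
  (LinearMap.congr_fun (rotate_succ 0) x).trans (lTensor_rotate_zero _)

theorem rotate_rotate_one (x : A ⊗[ℂ] (A ⊗[ℂ] TW A M 0)) :
    rotate A M 1 (rotate A M 1 x) = x := by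
  rw [rotate_one x]
  exact (rotate_one _).trans (leftComm_leftComm x)

/-- Multiplying two factors moved to the end is moving their product. -/
theorem degeneracyAt_last_rotate_rotate (n : ℕ) (x : A ⊗[ℂ] (A ⊗[ℂ] TW A M n)) :
    degeneracyAt R (n + 1) (Fin.last n) (rotate A M (n + 1) (rotate A M (n + 1) x)) =
      rotate A M n (merge R (TW A M n) x) := by
  induction n with
  | zero =>
    rw [rotate_rotate_one, Fin.last_zero, degeneracyAt_zero']
    rfl
  | succ n ih =>
    refine (congrArg _ (rotate_rotate_succ n x)).trans ?_
    rw [← Fin.succ_last, degeneracyAt_succ]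
    conv_rhs => rw [rotate_succ]
    refine (lTensor_lTensor_apply _ _ _).trans ?_
    refine Eq.trans ?_ (congrArg ((rotate A M n).lTensor A)
      (lTensor_merge_moveThird R (T := TW A M n) x))
    refine Eq.trans ?_ (lTensor_lTensor_apply _ _ _).symm
    exact congrArg (fun f => LinearMap.lTensor A f _) (LinearMap.ext ih)

/-- Inserting a unit in front of a factor and moving both to the end is inserting it after the
rotation. -/
theorem faceAt_last_rotate (n : ℕ) (x : A ⊗[ℂ] TW A M n) :
    rotate A M (n + 1) (rotate A M (n + 1) (insert R (TW A M n) x)) =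
      faceAt R (n + 1) (Fin.last n) (rotate A M n x) := by
  induction n with
  | zero =>
    refine (rotate_rotate_one _).trans ?_
    rw [Fin.last_zero, faceAt_zero']
    rfl
  | succ n ih =>
    refine (rotate_rotate_succ n _).trans ?_
    refine (congrArg _ (moveThird_insert R (T := TW A M n) x)).trans ?_
    rw [← Fin.succ_last, faceAt_succ]
    conv_rhs => rw [rotate_succ]
    refine (lTensor_lTensor_apply _ _ _).trans ?_
    refine Eq.trans ?_ (lTensor_lTensor_apply _ _ _).symm
    exact congrArg (fun f => LinearMap.lTensor A f _) (LinearMap.ext ih)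

/-- The right unit law for the last factor `A`, with the unit coming from the front. -/
theorem degeneracyAt_last_rotate_unit (n : ℕ) (x : TW A M (n + 1)) :
    degeneracyAt R (n + 1) (Fin.last n) (rotate A M (n + 1) (R.η.rTensor (TW A M (n + 1))
      (coactAt (rightOut R) (n + 1) (Fin.last n) x))) = x := by
  induction n with
  | zero =>
    rw [Fin.last_zero, coactAt_zero, degeneracyAt_zero']
    refine (congrArg _ (rotate_one _)).trans ?_
    exact merge_unit_rightOut R (T := TW A M 0) x
  | succ n ih =>
    rw [← Fin.succ_last, coactAt_succ, degeneracyAt_succ, rotate_succ (n + 1)]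
    refine (congrArg (fun z => (degeneracyAt R (n + 1) (Fin.last n)).lTensor A
      ((rotate A M (n + 1)).lTensor A z)) (leftComm_rTensor_behind R.η
        (coactAt (rightOut R) (n + 1) (Fin.last n)) x)).trans ?_
    refine (lTensor_lTensor_apply _ _ _).trans ((lTensor_lTensor_apply _ _ _).trans ?_)
    exact lTensor_eq_self (f := (degeneracyAt R (n + 1) (Fin.last n) ∘ₗ rotate A M (n + 1)) ∘ₗ
      (R.η.rTensor (TW A M (n + 1)) ∘ₗ coactAt (rightOut R) (n + 1) (Fin.last n))) ih _

end Words

/-! ### The cyclic operator and the inner operators -/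

section Ring

variable {C B : Type*} [AddCommGroup C] [Module ℂ C] [Coalgebra ℂ C]
  [AddCommGroup B] [Module ℂ B] [Coalgebra ℂ B] {H : RightHopfCoalgebra C B}
  {A : Type*} [AddCommGroup A] [Module ℂ A] {R : ComoduleRing H A}
  {T : Type*} [AddCommGroup T] [Module ℂ T]
  {act : B ⊗[ℂ] T →ₗ[ℂ] T} {K : T →ₗ[ℂ] B ⊗[ℂ] T}

/-- If `x` is balanced, the right `C`-coaction of `a⁽⁰⁾ ⊗ t ◁ a⁽¹⁾` on its last factor is the
right `C`-coaction of `a ⊗ t` on its first factor. -/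
theorem behind_right_theta (hT : IsSAYD H act K) {x : A ⊗[ℂ] T} (hx : Balanced R K x) :
    behind A (H.β.rTensor T ∘ₗ K) (theta R act x) =
      (theta R act).lTensor C (front (rightOut R) T x) := by
  have h := hT.shift.right_act _ hx.dom
  rw [rTensor_behind, front_front (r := rightOut R) (by rw [front_right_out]),
    lTensor_lTensor_apply] at h
  exact h

/-- The actions of two successive factors combine, by associativity, to the action of the product of
their coactions. -/
theorem lTensor_theta_theta (hT : IsSAYD H act K) {x : A ⊗[ℂ] (A ⊗[ℂ] T)}
    (hx : Balanced R (behind A K) x)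
    (h0 : front (rightOut R) (A ⊗[ℂ] T) x = behind A (front R.left T) x) :
    (theta R act).lTensor A (theta R (shiftAct A act) x) =
      shiftAct A (shiftAct A act)
        (diag H.toRightBicoalgebroid (out R) (front (out R) T) x) := by
  refine act_theta hT.shift hx (front_shiftAct (out R)) ?_
    (pair_mem_sq H.toRightBicoalgebroid (by rw [front_right_out])
      (congrArg (fun f => LinearMap.lTensor A f x) (LinearMap.ext fun y =>
        front_front (by rw [front_left_out]))) h0)
  rw [rTensor_comp_behind]
  refine LinearMap.ext fun y => ?_
  have h := (front_lTensor_behind (out R) (H.β.rTensor T ∘ₗ K) y)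
  have h' := congrArg (TensorProduct.leftComm ℂ C B (A ⊗[ℂ] T)) h
  rw [leftComm_leftComm] at h'
  exact h'.symm

/-- Since the multiplication is `B`-colinear, letting a product act is letting its factors act one
after the other. -/
theorem theta_merge {x : A ⊗[ℂ] (A ⊗[ℂ] T)} (hT : IsSAYD H act K)
    (hx : Balanced R (behind A K) x)
    (h0 : front (rightOut R) (A ⊗[ℂ] T) x = behind A (front R.left T) x) :
    theta R act (merge R T x) =
      merge R T ((theta R act).lTensor A (theta R (shiftAct A act) x)) := by
  rw [lTensor_theta_theta hT hx h0, theta, LinearMap.comp_apply, front_out_merge h0]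
  exact (LinearMap.congr_fun (merge_shiftAct R) _).symm

/-- Since `a ↦ η(a[-1]) ⊗ a[0]` is `B`-colinear, inserting a unit and letting both factors act is
letting `a` act. -/
theorem theta_theta_insert {x : A ⊗[ℂ] T} (hT : IsSAYD H act K)
    (hx : Balanced R (behind A K) (insert R T x)) :
    (theta R act).lTensor A (theta R (shiftAct A act) (insert R T x)) =
      insert R T (theta R act x) := by
  rw [lTensor_theta_theta hT hx (front_right_insert R x), diag_front_insert]
  exact (LinearMap.congr_fun (insert_shiftAct R) _).symm

/-- The action of a unit: `η_A(t[1])⁽⁰⁾ ⊗ t[0] ◁ η_A(t[1])⁽¹⁾ = η_A(α(t⁽⁻¹⁾)) ⊗ t⁽⁰⁾`, with a factor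
`a` standing by; it is the condition that identifies the two left `C`-coactions of `T`. -/
theorem theta_unit (hT : IsSAYD H act K) (x : A ⊗[ℂ] T) :
    theta R (shiftAct A act) (R.η.rTensor (A ⊗[ℂ] T) (behind A (H.β.rTensor T ∘ₗ K) x)) =
      R.η.rTensor (A ⊗[ℂ] T) (behind A (H.α.toLinearMap.rTensor T ∘ₗ K) x) := by
  induction x with
  | zero => simp
  | add x y hx hy => simp only [map_add, hx, hy]
  | tmul a t =>
    have h := congrArg (fun z => TensorProduct.leftComm ℂ A A T (a ⊗ₜ[ℂ] R.η.rTensor T z))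
      (hT.left_eq t)
    simp [theta, shiftAct, front, behind, out_η, sum_legs K t,
      sum_legs (Coalgebra.comul (R := ℂ) (A := B)),
      TensorProduct.sum_tmul, TensorProduct.tmul_sum] at h ⊢
    exact h.symm

end Ring

section Words

variable {C B : Type*} [AddCommGroup C] [Module ℂ C] [Coalgebra ℂ C]
  [AddCommGroup B] [Module ℂ B] [Coalgebra ℂ B] {H : RightHopfCoalgebra C B}
  {A M : Type u} [AddCommGroup A] [Module ℂ A] [AddCommGroup M] [Module ℂ M]
  (R : ComoduleRing H A) (S : SAYDModule H M)

/-- Moving one factor to the end commutes with the action of the next one. -/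
theorem theta_rotate (n : ℕ) (y : A ⊗[ℂ] (A ⊗[ℂ] TW A M n)) :
    theta (T := TW A M (n + 1)) R (actAt A S (n + 1)) (rotate A M (n + 1) y) =
      rotate A M (n + 1) ((theta R (actAt A S n)).lTensor A y) := by
  have h1 := theta_shift (R := R) (act := actAt A S n) (TensorProduct.leftComm ℂ A A _ y)
  have h2 := congrArg (TensorProduct.leftComm ℂ A A _) h1
  rw [leftComm_leftComm, leftComm_leftComm] at h2
  rw [rotate_succ]
  refine (theta_lTensor (R := R) (rotate_actAt S n) _).trans ?_
  exact congrArg ((rotate A M n).lTensor A) h2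

theorem cyclicOp_faceAt_succ {n : ℕ} (i : Fin n) (x : TW A M (n + 1)) :
    cyclicOp R S (n + 1) (faceAt R (n + 1) i.succ x) =
      faceAt R (n + 1) i.castSucc (cyclicOp R S n x) := by
  rw [cyclicOp_eq, cyclicOp_eq, ← rotate_faceAt, faceAt_succ]
  exact congrArg _ (theta_lTensor (R := R) (faceAt_actAt R S n i) x)

theorem cyclicOp_degeneracyAt_succ {n : ℕ} (i : Fin n) (x : TW A M (n + 2)) :
    cyclicOp R S n (degeneracyAt R (n + 1) i.succ x) =
      degeneracyAt R (n + 1) i.castSucc (cyclicOp R S (n + 1) x) := by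
  rw [cyclicOp_eq, cyclicOp_eq, degeneracyAt_succ]
  refine Eq.trans ?_ (rotate_degeneracyAt R i _).symm
  exact congrArg _ (theta_lTensor (R := R) (degeneracyAt_actAt R S n i) x)

/-- The operator `τ²` is a double rotation of the tensor in which both of the first factors have
acted. -/
theorem cyclicOp_cyclicOp (n : ℕ) (x : A ⊗[ℂ] (A ⊗[ℂ] TW A M n)) :
    cyclicOp R S (n + 1) (cyclicOp R S (n + 1) x) = rotate A M (n + 1) (rotate A M (n + 1)
      ((theta R (actAt A S n)).lTensor A (theta R (shiftAct A (actAt A S n)) x))) := by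
  rw [cyclicOp_eq (n + 1)]
  refine congrArg (rotate A M (n + 1)) ?_
  exact (congrArg _ (cyclicOp_eq (n + 1) x)).trans (theta_rotate R S n _)

variable {R S}

theorem cyclicOp_degeneracyAt_zero {n : ℕ} {x : A ⊗[ℂ] (A ⊗[ℂ] TW A M n)}
    (hx : (show TW A M (n + 2) from x) ∈ cochains R S (n + 1)) :
    cyclicOp R S n (degeneracyAt R (n + 1) 0 x) =
      degeneracyAt R (n + 1) (Fin.last n)
        (cyclicOp R S (n + 1) (cyclicOp R S (n + 1) x)) := by
  have hb := balanced_of_mem_cochains hx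
  rw [coactLast_succ] at hb
  have h0 := ((mem_chain_succ R).1 ((mem_cochains_iff R S).1 hx).1).1
  rw [cyclicOp_cyclicOp, degeneracyAt_last_rotate_rotate, cyclicOp_eq, degeneracyAt_zero']
  exact congrArg _ (theta_merge (isSAYD_actAt S n) hb h0)

theorem cyclicOp_cyclicOp_faceAt_zero {n : ℕ} {x : A ⊗[ℂ] TW A M n}
    (hx : (show TW A M (n + 1) from x) ∈ cochains R S n) :
    cyclicOp R S (n + 1) (cyclicOp R S (n + 1) (faceAt R (n + 1) 0 x)) =
      faceAt R (n + 1) (Fin.last n) (cyclicOp R S n x) := by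
  have hb := balanced_of_mem_cochains (faceAt_mem_cochains 0 hx)
  rw [coactLast_succ, faceAt_zero'] at hb
  rw [faceAt_zero']
  refine (cyclicOp_cyclicOp R S n _).trans ?_
  refine (congrArg (fun z => rotate A M (n + 1) (rotate A M (n + 1) z))
    (theta_theta_insert (isSAYD_actAt S n) hb)).trans ?_
  exact (faceAt_last_rotate R n _).trans (congrArg _ (cyclicOp_eq n x).symm)

/-- The last coface `τ δ₀` inserts a unit behind the last factor `A`, by `theta_unit`, so that the
right unit law applies. -/
theorem degeneracyAt_cyclicOp_faceAt_zero {n : ℕ} {x : A ⊗[ℂ] TW A M n}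
    (hx : (show TW A M (n + 1) from x) ∈ cochains R S n) :
    degeneracyAt R (n + 1) (Fin.last n) (cyclicOp R S (n + 1) (faceAt R (n + 1) 0 x)) = x := by
  have hb := balanced_of_mem_cochains hx
  have h := theta_unit (R := R) (isSAYD_actAt S n) x
  have hc := coactAt_last_of_mem_cochains hx
  refine Eq.trans ?_ (degeneracyAt_last_rotate_unit R n x)
  rw [faceAt_zero', cyclicOp_eq]
  refine congrArg (fun z => degeneracyAt R (n + 1) (Fin.last n) (rotate A M (n + 1) z)) ?_
  refine (congrArg _ ((insert_eq R _).trans (congrArg _ hb))).trans (h.trans ?_)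
  exact (congrArg _ hc).symm

end Words

/-! ### The order of the cyclic operator -/

theorem slice_congr_of_behind {V W Z : Type*} [AddCommGroup V] [Module ℂ V] [AddCommGroup W]
    [Module ℂ W] [AddCommGroup Z] [Module ℂ Z] {f g : W →ₗ[ℂ] Z ⊗[ℂ] W} {x : V ⊗[ℂ] W}
    (h : behind V f x = behind V g x) (φ : V →ₗ[ℂ] ℂ) : f (slice φ W x) = g (slice φ W x) := by
  rw [← slice_lTensor, lTensor_eq_of_behind h, slice_lTensor]

section Words

variable {A M : Type u} [AddCommGroup A] [Module ℂ A] [AddCommGroup M] [Module ℂ M]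

/-- The pure tensor `v 0 ⊗ ⋯ ⊗ v (n - 1) ⊗ m`. -/
def pureTensor (m : M) : (n : ℕ) → (ℕ → A) → TW A M n
  | 0, _ => (TW.zero A M).symm m
  | n + 1, v => (TW.succ A M n).symm (v 0 ⊗ₜ[ℂ] pureTensor m n fun i => v (i + 1))

theorem pureTensor_congr (m : M) {n : ℕ} {v w : ℕ → A} (h : ∀ i < n, v i = w i) :
    pureTensor m n v = pureTensor m n w := by
  induction n generalizing v w with
  | zero => rfl
  | succ n ih =>
    rw [pureTensor, pureTensor, h 0 n.succ_pos]
    congr 2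
    exact ih fun i hi => h (i + 1) (by omega)

/-- Linear maps on `A^{⊗ n} ⊗ M` that agree on pure tensors are equal. -/
theorem eq_of_pureTensor {N : Type*} [AddCommGroup N] [Module ℂ N] {n : ℕ}
    {f g : TW A M n →ₗ[ℂ] N} (h : ∀ m v, f (pureTensor m n v) = g (pureTensor m n v)) :
    f = g := by
  induction n with
  | zero => exact LinearMap.ext fun m => h m fun _ => 0
  | succ n ih =>
    have h' : ∀ a : A, f ∘ₗ TensorProduct.mk ℂ A (TW A M n) a =
        g ∘ₗ TensorProduct.mk ℂ A (TW A M n) a := fun a =>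
      ih fun m v => h m fun i => Nat.casesOn (motive := fun _ => A) i a v
    exact TensorProduct.ext' fun a t => LinearMap.congr_fun (h' a) t

theorem rotate_tmul_pureTensor (m : M) (n : ℕ) (v : ℕ → A) :
    rotate A M n (v n ⊗ₜ[ℂ] pureTensor m n v) = pureTensor m (n + 1) v := by
  induction n generalizing v with
  | zero => rfl
  | succ n ih =>
    rw [rotate_succ]
    exact congrArg (fun z => v 0 ⊗ₜ[ℂ] z) (ih fun i => v (i + 1))

/-- The permutation of the factors of `A^{⊗ (n+1)} ⊗ M` that moves the first one to the end. -/
def rotation (A M : Type u) [AddCommGroup A] [Module ℂ A] [AddCommGroup M] [Module ℂ M] (n : ℕ) :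
    Module.End ℂ (TW A M (n + 1)) := rotate A M n

/-- For the sequence `v` of period `n + 1` that continues the factors of a pure tensor, rotating is
shifting. -/
theorem rotation_pow_pureTensor (m : M) (n k : ℕ) {v : ℕ → A} (hv : ∀ i, v (i + (n + 1)) = v i) :
    (rotation A M n ^ k) (pureTensor m (n + 1) v) = pureTensor m (n + 1) fun i => v (i + k) := by
  induction k with
  | zero => rfl
  | succ k ih =>
    rw [pow_succ', Module.End.mul_apply, ih]
    have h := rotate_tmul_pureTensor m n fun i => v (i + (k + 1))
    have e : v (n + (k + 1)) = v (0 + k) :=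
      (congrArg v (by omega)).trans (hv (0 + k))
    rw [← h, e]
    refine congrArg (fun w => rotate A M n (v (0 + k) ⊗ₜ[ℂ] pureTensor m n w)) ?_
    exact funext fun i => congrArg v (by omega)

theorem rotation_pow (n : ℕ) : rotation A M n ^ (n + 1) = 1 := by
  refine eq_of_pureTensor fun m v => ?_
  have e : pureTensor m (n + 1) v = pureTensor m (n + 1) fun i => v (i % (n + 1)) :=
    pureTensor_congr m fun i hi => by rw [Nat.mod_eq_of_lt hi]
  rw [e, rotation_pow_pureTensor m n (n + 1) (v := fun i => v (i % (n + 1)))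
    fun i => by simp only [Nat.add_mod_right]]
  simp only [Nat.add_mod_right]
  rfl

variable {C B : Type*} [AddCommGroup C] [Module ℂ C] [Coalgebra ℂ C]
  [AddCommGroup B] [Module ℂ B] [Coalgebra ℂ B] {H : RightHopfCoalgebra C B}
  (R : ComoduleRing H A) (S : SAYDModule H M)

/-- Let the first `k` factors of `a₀ ⊗ ⋯ ⊗ aₙ₋₁ ⊗ m` act on `m`, in their order:
`a₀⁽⁰⁾ ⊗ ⋯ ⊗ aₖ₋₁⁽⁰⁾ ⊗ aₖ ⊗ ⋯ ⊗ aₙ₋₁ ⊗ ((m ◁ a₀⁽¹⁾) ◁ ⋯) ◁ aₖ₋₁⁽¹⁾`. -/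
def actFirst : (n : ℕ) → ℕ → (TW A M n →ₗ[ℂ] TW A M n)
  | _, 0 => LinearMap.id
  | 0, _ + 1 => LinearMap.id
  | n + 1, k + 1 => (actFirst n k).lTensor A ∘ₗ theta R (actAt A S n)

/-- Letting further factors act commutes with moving the first one to the end. -/
theorem actFirst_rotate {n k : ℕ} (hk : k ≤ n) (y : A ⊗[ℂ] TW A M n) :
    actFirst R S (n + 1) k (rotate A M n y) = rotate A M n ((actFirst R S n k).lTensor A y) := by
  induction k generalizing n with
  | zero =>
    have e : ∀ n, actFirst R S n 0 = LinearMap.id := fun n => by cases n <;> rfl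
    rw [e, e]
    exact (congrArg (rotate A M n) (LinearMap.congr_fun (LinearMap.lTensor_id A _) y)).symm
  | succ k ih =>
    obtain ⟨n, rfl⟩ : ∃ m, n = m + 1 := ⟨n - 1, by omega⟩
    refine (congrArg ((actFirst R S (n + 1) k).lTensor A) (theta_rotate R S n y)).trans ?_
    rw [rotate_succ]
    refine (lTensor_lTensor_apply _ _ _).trans ?_
    have h : actFirst R S (n + 1) k ∘ₗ rotate A M n =
        rotate A M n ∘ₗ (actFirst R S n k).lTensor A :=
      LinearMap.ext (ih (by omega))
    refine (congrArg (fun f => LinearMap.lTensor A f _) h).trans ?_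
    refine (lTensor_lTensor_apply _ _ _).symm.trans (congrArg ((rotate A M n).lTensor A) ?_)
    refine (leftComm_lTensor_lTensor _ _).symm.trans ?_
    exact congrArg (TensorProduct.leftComm ℂ A A _) (lTensor_lTensor_apply _ _ _)

/-- The operator `τᵏ` lets the first `k` factors act one after the other and then rotates `k`
times. -/
theorem cyclicOp_pow {n k : ℕ} (hk : k ≤ n + 1) (x : TW A M (n + 1)) :
    ((cyclicOp R S n : Module.End ℂ (TW A M (n + 1))) ^ k) x =
      (rotation A M n ^ k) (actFirst R S (n + 1) k x) := by
  induction k generalizing x with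
  | zero => rfl
  | succ k ih =>
    rw [pow_succ, pow_succ, Module.End.mul_apply, Module.End.mul_apply, ih (by omega), cyclicOp_eq]
    exact congrArg _ (actFirst_rotate R S (by omega) _)

variable {R S}

/-- When all factors act, they act through the diagonal coaction. -/
theorem actFirst_eq {n : ℕ} {x : A ⊗[ℂ] TW A M n}
    (hc : (show TW A M (n + 1) from x) ∈ chain M R n)
    (hb : Balanced R (coactLast S.coact n) x) :
    actFirst R S (n + 1) (n + 1) x = actAt A S (n + 1) (coactDiag R n x) := by
  induction n with
  | zero =>
    rw [coactDiag_zero]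
    exact LinearMap.congr_fun (LinearMap.lTensor_id A _) (theta R (actAt A S 0) x)
  | succ n ih =>
    obtain ⟨h0, h⟩ := (mem_chain_succ R).1 hc
    have hT := isSAYD_actAt (A := A) S (n + 1)
    have hb' : behind A (front R.left (TW A M n)) (theta R (actAt A S (n + 1)) x) =
        behind A (H.β.rTensor _ ∘ₗ coactLast S.coact (n + 1))
          (theta R (actAt A S (n + 1)) x) := by
      rw [behind_right_theta hT hb, h0]
      exact behind_theta_of_comm (front_shiftAct R.left) x
    have h1 : (actFirst R S (n + 1) (n + 1)).lTensor A (theta R (actAt A S (n + 1)) x) =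
        (actAt A S (n + 1) ∘ₗ coactDiag R n).lTensor A (theta R (actAt A S (n + 1)) x) := by
      refine lTensor_congr (fun w => w ∈ chain M R n ∧
        Balanced (T := TW A M n) R (coactLast S.coact n) w)
        (fun φ => ⟨theta_slice_mem_chain hc φ, ?_⟩) fun w hw => ih hw.1 hw.2
      rw [coactLast_succ] at hb'
      exact (slice_congr_of_behind hb' φ).trans (rTensor_behind _ _ _)
    refine h1.trans ?_
    rw [coactDiag_succ]
    refine act_theta hT hb (coactDiag_actAt S n) ?_ (pair_coactDiag_mem_sq hc)
    rw [rTensor_coactLast]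
    exact coactLast_coactDiag _ n

/-- When all `n + 1` factors have acted they act through the diagonal coaction, which on a cochain
is the coaction of `M`; stability makes the result trivial. -/
theorem cyclicOp_pow_eq_self {n : ℕ} {x : TW A M (n + 1)} (hx : x ∈ cochains R S n) :
    ((cyclicOp R S n : Module.End ℂ (TW A M (n + 1))) ^ (n + 1)) x = x := by
  obtain ⟨hc, hE⟩ := (mem_cochains_iff R S).1 hx
  rw [cyclicOp_pow R S le_rfl, rotation_pow, Module.End.one_apply]
  refine (actFirst_eq hc (balanced_of_mem_cochains hx)).trans ?_
  exact (congrArg _ hE).trans ((isSAYD_actAt S (n + 1)).stable x)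

end Words

/-! ### Cocyclic modules -/

namespace CocyclicModule

variable {V : ℕ → Type*} [∀ n, AddCommGroup (V n)] [∀ n, Module ℂ (V n)]

/-- A cocyclic module from its cofaces without the last one, its codegeneracies, and its cyclic
operators; the last coface is `τ δ₀`. -/
def ofInner (d : ∀ n, Fin (n + 1) → (V n →ₗ[ℂ] V (n + 1)))
    (s : ∀ n, Fin (n + 1) → (V (n + 1) →ₗ[ℂ] V n)) (t : ∀ n, V n →ₗ[ℂ] V n)
    (d_d : ∀ n (i j : Fin (n + 1)), i ≤ j → ∀ x,
      d (n + 1) j.succ (d n i x) = d (n + 1) i.castSucc (d n j x))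
    (s_s : ∀ n (i j : Fin (n + 1)), i ≤ j → ∀ x,
      s n j (s (n + 1) i.castSucc x) = s n i (s (n + 1) j.succ x))
    (s_d_of_le : ∀ n (i j : Fin (n + 1)), i ≤ j → ∀ x,
      s (n + 1) j.succ (d (n + 1) i.castSucc x) = d n i (s n j x))
    (s_d_self : ∀ n (i : Fin (n + 1)) x, s n i (d n i x) = x)
    (s_d_succ : ∀ n (i : Fin n) x, s n i.castSucc (d n i.succ x) = x)
    (s_d_of_gt : ∀ n (i j : Fin (n + 1)), j < i → ∀ x,
      s (n + 1) j.castSucc (d (n + 1) i.succ x) = d n i (s n j x))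
    (t_d_succ : ∀ n (i : Fin n) x, t (n + 1) (d n i.succ x) = d n i.castSucc (t n x))
    (t_t_d_zero : ∀ n x, t (n + 1) (t (n + 1) (d n 0 x)) = d n (Fin.last n) (t n x))
    (s_t_d_zero : ∀ n x, s n (Fin.last n) (t (n + 1) (d n 0 x)) = x)
    (t_s_succ : ∀ n (i : Fin n) x, t n (s n i.succ x) = s n i.castSucc (t (n + 1) x))
    (t_s_zero : ∀ n x, t n (s n 0 x) = s n (Fin.last n) (t (n + 1) (t (n + 1) x)))
    (t_pow : ∀ n, t n ^ (n + 1) = 1) : CocyclicModule V where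
  δ n i := Fin.lastCases (t (n + 1) ∘ₗ d n 0) (d n) i
  σ := s
  τ := t
  δ_comp_δ n i j hij := by
    ext x
    induction j using Fin.lastCases with
    | cast j =>
      obtain ⟨i, rfl⟩ : ∃ i' : Fin (n + 1), i = i'.castSucc :=
        ⟨i.castPred (ne_of_lt (hij.trans_lt j.castSucc_lt_last)), by simp⟩
      rw [← Fin.castSucc_succ]
      simp only [Fin.lastCases_castSucc, LinearMap.comp_apply]
      exact d_d n i j (Fin.castSucc_le_castSucc_iff.1 hij) x
    | last =>
      rw [Fin.succ_last]
      induction i using Fin.lastCases with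
      | cast i =>
        simp only [Fin.lastCases_castSucc, Fin.lastCases_last, LinearMap.comp_apply]
        have h := d_d n 0 i (Fin.zero_le i) x
        rw [Fin.castSucc_zero] at h
        rw [← h, t_d_succ]
      | last =>
        simp only [Fin.lastCases_castSucc, Fin.lastCases_last, LinearMap.comp_apply]
        have h := d_d n 0 0 le_rfl x
        rw [Fin.castSucc_zero] at h
        rw [← t_t_d_zero, ← h, t_d_succ, Fin.castSucc_zero]
  σ_comp_σ n i j hij := LinearMap.ext (s_s n i j hij)
  σ_comp_δ_of_le n i j hij := by
    ext x
    obtain ⟨i, rfl⟩ : ∃ i' : Fin (n + 1), i = i'.castSucc :=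
      ⟨i.castPred (ne_of_lt (hij.trans_lt j.castSucc_lt_last)), by simp⟩
    simp only [Fin.lastCases_castSucc, LinearMap.comp_apply]
    exact s_d_of_le n i j (Fin.castSucc_le_castSucc_iff.1 hij) x
  σ_comp_δ_self n i := by
    ext x
    simp only [Fin.lastCases_castSucc, LinearMap.comp_apply, s_d_self, LinearMap.id_apply]
  σ_comp_δ_succ n i := by
    ext x
    induction i using Fin.lastCases with
    | cast i =>
      rw [← Fin.castSucc_succ]
      simp only [Fin.lastCases_castSucc, LinearMap.comp_apply, s_d_succ, LinearMap.id_apply]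
    | last =>
      rw [Fin.succ_last]
      simp only [Fin.lastCases_last, LinearMap.comp_apply, s_t_d_zero, LinearMap.id_apply]
  σ_comp_δ_of_gt n i j hij := by
    ext x
    induction i using Fin.lastCases with
    | cast i =>
      rw [← Fin.castSucc_succ]
      simp only [Fin.lastCases_castSucc, LinearMap.comp_apply]
      exact s_d_of_gt n i j (Fin.castSucc_lt_castSucc_iff.1 hij) x
    | last =>
      rw [Fin.succ_last]
      simp only [Fin.lastCases_last, LinearMap.comp_apply]
      have h := s_d_of_le n 0 j (Fin.zero_le j) x
      rw [Fin.castSucc_zero] at h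
      rw [← t_s_succ, h]
  τ_comp_δ_succ n i := by
    ext x
    induction i using Fin.lastCases with
    | cast i =>
      rw [← Fin.castSucc_succ]
      simp only [Fin.lastCases_castSucc, LinearMap.comp_apply, t_d_succ]
    | last =>
      rw [Fin.succ_last]
      simp only [Fin.lastCases_last, Fin.lastCases_castSucc, LinearMap.comp_apply, t_t_d_zero]
  τ_comp_δ_zero n := by
    have h : (0 : Fin (n + 2)) = (0 : Fin (n + 1)).castSucc := rfl
    rw [h]
    simp only [Fin.lastCases_last, Fin.lastCases_castSucc]
  τ_comp_σ_succ n i := LinearMap.ext (t_s_succ n i)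
  τ_comp_σ_zero n := LinearMap.ext (t_s_zero n)
  τ_pow := t_pow

variable (X : CocyclicModule V)

/-- The coboundary squares to zero. -/
theorem b_b (n : ℕ) (x : V n) : X.b (n + 1) (X.b n x) = 0 := by
  let f : Fin (n + 3) × Fin (n + 2) → V (n + 2) := fun p =>
    ((-1 : ℂ) ^ (p.1 + p.2 : ℕ)) • X.δ (n + 1) p.1 (X.δ n p.2 x)
  have h : X.b (n + 1) (X.b n x) = ∑ p, f p := by
    simp only [b, LinearMap.sum_apply, LinearMap.smul_apply, map_sum, map_smul,
      Fintype.sum_prod_type, f, pow_add]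
    rw [Finset.sum_comm]
    simp only [Finset.smul_sum, smul_smul, mul_comm]
  rw [h, ← Finset.sum_filter_add_sum_filter_not Finset.univ
    (fun p : Fin (n + 3) × Fin (n + 2) => p.2.castSucc < p.1), ← eq_neg_iff_add_eq_zero,
    ← Finset.sum_neg_distrib]
  -- the terms with `i < j` cancel those with `j ≤ i` by `δⱼ δᵢ = δᵢ δⱼ₋₁`
  refine Finset.sum_bij (fun p hp => (p.2.castSucc, p.1.pred (Fin.ne_zero_of_lt
    (Finset.mem_filter.1 hp).2))) ?_ ?_ ?_ ?_
  · rintro ⟨j, i⟩ hp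
    simp only [Finset.mem_filter, Finset.mem_univ, true_and, not_lt, Fin.lt_def,
      Fin.val_castSucc, Fin.val_pred] at hp ⊢
    omega
  · rintro ⟨j, i⟩ hp ⟨j', i'⟩ hp' h
    simpa [Fin.pred_inj, and_comm] using h
  · rintro ⟨j, i⟩ hp
    simp only [Finset.mem_filter, Finset.mem_univ, true_and, not_lt, Fin.le_def,
      Fin.val_castSucc] at hp
    refine ⟨(i.succ, j.castLT (by omega)), ?_, ?_⟩
    · simp only [Finset.mem_filter, Finset.mem_univ, true_and, Fin.lt_def, Fin.val_castSucc,
        Fin.val_castLT, Fin.val_succ]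
      omega
    · simp
  · rintro ⟨j, i⟩ hp
    simp only [Finset.mem_filter, Finset.mem_univ, true_and] at hp
    obtain ⟨j, rfl⟩ : ∃ j' : Fin (n + 2), j = j'.succ :=
      ⟨j.pred (Fin.ne_zero_of_lt hp), by simp⟩
    have hδ := LinearMap.congr_fun (X.δ_comp_δ n i j (Fin.castSucc_lt_succ_iff.1 hp)) x
    simp only [LinearMap.comp_apply] at hδ
    simp only [f, Fin.pred_succ, hδ, Fin.val_succ, Fin.val_castSucc]
    rw [← neg_smul]
    congr 1
    ring

/-- The coboundary preserves the cyclic cochains. -/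
theorem τ_b {n : ℕ} {x : V n} (hx : (-1 : ℂ) ^ n • X.τ n x = x) :
    (-1 : ℂ) ^ (n + 1) • X.τ (n + 1) (X.b n x) = X.b n x := by
  have h2 : ((-1 : ℂ) ^ n) * (-1) ^ n = 1 := by rw [← mul_pow]; norm_num
  have hτ : X.τ n x = (-1 : ℂ) ^ n • x := by
    conv_rhs => rw [← hx]
    rw [smul_smul, h2, one_smul]
  have h0 : X.τ (n + 1) (X.δ n 0 x) = X.δ n (Fin.last (n + 1)) x :=
    LinearMap.congr_fun (X.τ_comp_δ_zero n) x
  have hs : ∀ i : Fin (n + 1), X.τ (n + 1) (X.δ n i.succ x) =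
      (-1 : ℂ) ^ n • X.δ n i.castSucc x := fun i => by
    rw [← map_smul, ← hτ]
    exact LinearMap.congr_fun (X.τ_comp_δ_succ n i) x
  have hb : X.b n x = ∑ i : Fin (n + 2), (-1 : ℂ) ^ (i : ℕ) • X.δ n i x := by
    simp only [b, LinearMap.sum_apply, LinearMap.smul_apply]
  rw [hb]
  conv_lhs => rw [Fin.sum_univ_succ]
  conv_rhs => rw [Fin.sum_univ_castSucc]
  simp only [map_add, map_sum, map_smul, h0, hs, smul_add, Finset.smul_sum, smul_smul,
    Fin.val_zero, pow_zero, one_smul, Fin.val_succ, Fin.val_castSucc, Fin.val_last]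
  refine (add_comm _ _).trans (congrArg (· + _) ?_)
  refine Finset.sum_congr rfl fun i _ => ?_
  congr 1
  linear_combination (-1 : ℂ) ^ (i : ℕ) * h2

theorem cyclicCoboundaries_le (n : ℕ) : X.cyclicCoboundaries n ≤ X.cyclicCocycles n := by
  cases n with
  | zero => exact bot_le
  | succ n =>
    rintro _ ⟨x, hx, rfl⟩
    exact ⟨X.b_b n x, X.τ_b hx⟩

end CocyclicModule

section Words

variable {C B : Type*} [AddCommGroup C] [Module ℂ C] [Coalgebra ℂ C]
  [AddCommGroup B] [Module ℂ B] [Coalgebra ℂ B] {H : RightHopfCoalgebra C B}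
  {A M : Type u} [AddCommGroup A] [Module ℂ A] [AddCommGroup M] [Module ℂ M]
  (R : ComoduleRing H A) (S : SAYDModule H M)

/-- The cocyclic module of a right `B`-comodule `C`-ring with coefficients in a stable anti
Yetter–Drinfeld module. -/
def cochainsCocyclic : CocyclicModule (fun n => cochains R S n) :=
  CocyclicModule.ofInner (V := fun n => cochains R S n)
    (fun n i => (faceAt R (n + 1) i).restrict fun _ => faceAt_mem_cochains i)
    (fun n i => (degeneracyAt R (n + 1) i).restrict fun _ => degeneracyAt_mem_cochains i)
    (fun n => (cyclicOp R S n).restrict fun _ => cyclicOp_mem_cochains)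
    (fun _ _ _ hij x => Subtype.ext (faceAt_faceAt R hij x.1))
    (fun _ _ _ hij x => Subtype.ext (degeneracyAt_degeneracyAt R hij x.2.1))
    (fun _ _ _ hij x => Subtype.ext (degeneracyAt_faceAt_of_le R hij x.2.1))
    (fun _ i x => Subtype.ext (degeneracyAt_faceAt_self R i x.1))
    (fun _ i x => Subtype.ext (degeneracyAt_faceAt_succ R i x.2.1))
    (fun _ _ _ hij x => Subtype.ext (degeneracyAt_faceAt_of_gt R hij x.1))
    (fun _ i x => Subtype.ext (cyclicOp_faceAt_succ R S i x.1))
    (fun _ x => Subtype.ext (cyclicOp_cyclicOp_faceAt_zero x.2))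
    (fun _ x => Subtype.ext (degeneracyAt_cyclicOp_faceAt_zero x.2))
    (fun _ i x => Subtype.ext (cyclicOp_degeneracyAt_succ R S i x.1))
    (fun _ x => Subtype.ext (cyclicOp_degeneracyAt_zero x.2))
    (fun n => LinearMap.ext fun x => Subtype.ext (by
      rw [Module.End.pow_restrict]
      exact cyclicOp_pow_eq_self x.2))

end Words

end HopfCyc

end

theorem mainTheorem7 {C B : Type*} {A M : Type u}
    [AddCommGroup C] [Module ℂ C] [Coalgebra ℂ C]
    [AddCommGroup B] [Module ℂ B] [Coalgebra ℂ B]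
    [AddCommGroup A] [Module ℂ A] [AddCommGroup M] [Module ℂ M]
    (H : HopfCyc.RightHopfCoalgebra C B)
    (R : HopfCyc.ComoduleRing H A) (S : HopfCyc.SAYDModule H M) :
    ∃ X : HopfCyc.CocyclicModule (fun n => HopfCyc.cochains R S n),
      (∀ n (i : Fin (n + 1)) (x : HopfCyc.cochains R S n),
        (X.δ n i.castSucc x : HopfCyc.TW A M (n + 2)) = HopfCyc.faceAt R (n + 1) i x) ∧
      (∀ n (i : Fin (n + 1)) (x : HopfCyc.cochains R S (n + 1)),
        (X.σ n i x : HopfCyc.TW A M (n + 1)) = HopfCyc.degeneracyAt R (n + 1) i x) ∧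
      (∀ n (x : HopfCyc.cochains R S n),
        (X.τ n x : HopfCyc.TW A M (n + 1)) = HopfCyc.cyclicOp R S n x) ∧
      (∀ n, X.cyclicCoboundaries n ≤ X.cyclicCocycles n) := by
  refine ⟨HopfCyc.cochainsCocyclic R S, fun n i x => ?_, fun n i x => rfl, fun n x => rfl,
    HopfCyc.CocyclicModule.cyclicCoboundaries_le _⟩
  simp only [HopfCyc.cochainsCocyclic, HopfCyc.CocyclicModule.ofInner, Fin.lastCases_castSucc]
  rfl
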